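/- Let $K$ be a field, $S=K[x_1,\dots,x_n,y_1,\dots,y_m]$ with $\deg x_i=(1,0)$, $\deg y_j=(0,1)$, and $R=S/J$ with $J$ a bihomogeneous ideal. For a positively graded $K$-algebra $A$ and a graded $A$-module $N$ put $t_s(N)=\sup\{j:\operatorname{Tor}^A_s(N,K)_j\neq0\}$ (with $\sup\emptyset=-\infty$) and $\operatorname{reg}_AN=\sup\{t_s(N)-s: s\ge0\}$; $A$ is Koszul if $\operatorname{reg}_AK=0$. Bigraded algebras and modules are regarded as graded by total degree when $\operatorname{reg}$, $\operatorname{indeg}$ (the least degree of a nonzero component) or the Koszul property is considered. For integers $a,b\ge0$, $(a,b)\ne(0,0)$, let $\Delta=\{(sa,sb):s\in\mathbb Z\}$ and $\tilde\Delta=\{(sa,tb):s,t\in\mathbb Z\}$. Let $R_\Delta$ be the subalgebra of $R$ with components $(R_\Delta)_i=R_{(ia,ib)}$ and $R_{\tilde\Delta}$ the subalgebra with components $(R_{\tilde\Delta})_{(i,j)}=R_{(ia,jb)}$ (where only $i=0$ is used if $a=0$, and only $j=0$ if $b=0$). For a bigraded $R$-module $M$ and integers $c,d\ge0$ let $M^{(c,d)}_\Delta$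 be the graded $R_\Delta$-module with components $M_{(ia+c,ib+d)}$ and $M^{(c,d)}_{\tilde\Delta}$ the bigraded $R_{\tilde\Delta}$-module with components $M_{(ia+c,jb+d)}$ (with the same convention on $i,j$). **Theorem.** Let $R$ be Koszul and $M$ a finitely generated bigraded $R$-module with $M_{(i,j)}=0$ whenever $i<0$ or $j<0$, with $\operatorname{indeg}(M)=0$ and $\operatorname{reg}_RM=r\in\mathbb Z$. (a) Let $c,d\ge 0$ be integers with $c<a$ or $d<b$. Then $$\operatorname{reg}_{R_\Delta}M^{(c,d)}_\Delta\le\begin{cases}\max\{0,\lceil\frac{r-c}{a}\rceil\}&\text{if } b=0,\ a>0,\\ \max\{0,\lceil\frac{r-d}{b}\rceil\}&\text{if } a=0,\ b>0,\\ \max\{0,\lceil\frac{r-c}{a}\rceil,\lceil\frac{r-d}{b}\rceil\}&\text{if } a,b\ge1.\end{cases}$$ (b) Let $c,d\ge 0$ be integers with $c<a$ if $a\ge1$ and $c=0$ if $a=0$, and $d<b$ if $b\ge1$ and $d=0$ if $b=0$. Then $$\operatorname{reg}_{R_{\tilde\Delta}}M^{(c,d)}_{\tilde\Delta}\le\begin{cases}\max\{0,\lceil\frac{r}{a}\rceil\}&\text{if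 } b=0,\ a>0,\\ \max\{0,\lceil\frac{r}{b}\rceil\}&\text{if } a=0,\ b>0,\\ \min\{r,\lceil\frac{r-c}{a}-\frac db+1\rceil\}&\text{if } 1\le a\le b.\end{cases}$$ In particular, if $1\le a\le b$, then $\operatorname{reg}_{R_{\tilde\Delta}}M\le\min\{r,\lceil\frac ra+1\rceil\}$, where $M$ is graded over $R_{\tilde\Delta}$ through the decomposition $M=\bigoplus_{0\le c<a,\,0\le d<b}M^{(c,d)}_{\tilde\Delta}$. -/

import Mathlib

open scoped TensorProduct

/-! ### Regularity of a graded module over a positively graded algebra -/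

section Regularity

universe u v w

variable {K : Type u} [Field K] {A : Type v} [CommRing A] [Algebra K A]
  {N : Type w} [AddCommGroup N] [Module K N] [Module A N]

/-- The graded maximal ideal `A₊`, generated by the homogeneous elements of positive degree. -/
def positiveIdeal (𝒜 : ℤ → Submodule K A) : Ideal A :=
  Ideal.span {x | ∃ i : ℤ, 0 < i ∧ x ∈ 𝒜 i}

/-- The degree `k` part of the graded free module `⨁_{i ∈ ι} A(-deg i)`: the `i`-th coordinate
has to lie in `A(-deg i)_k = A_{k - deg i}`. -/
def freeGrading (𝒜 : ℤ → Submodule K A) {ι : Type*} (deg : ι → ℤ) (k : ℤ) :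
    Submodule K (ι →₀ A) where
  carrier := {f | ∀ i, f i ∈ 𝒜 (k - deg i)}
  add_mem' hf hg i := (𝒜 _).add_mem (hf i) (hg i)
  zero_mem' _ := (𝒜 _).zero_mem
  smul_mem' c _ hf i := (𝒜 _).smul_mem c (hf i)

/-- A graded free resolution `… → F₁ → F₀ → N → 0` of the graded `A`-module `N`, where
`F_s = ⨁_{i ∈ ι s} A(-deg s i)` and all maps are homogeneous of degree `0`. -/
structure GradedFreeResolution (𝒜 : ℤ → Submodule K A) (𝒩 : ℤ → Submodule K N) where
  /-- the index set of a homogeneous basis of `F_s` -/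
  ι : ℕ → Type (max v w)
  /-- the degrees of the basis elements of `F_s` -/
  deg : ∀ s, ι s → ℤ
  /-- the differential `F_{s+1} → F_s` -/
  d : ∀ s, (ι (s + 1) →₀ A) →ₗ[A] (ι s →₀ A)
  /-- the augmentation `F₀ → N` -/
  ε : (ι 0 →₀ A) →ₗ[A] N
  d_homogeneous : ∀ s k, ∀ x ∈ freeGrading 𝒜 (deg (s + 1)) k, d s x ∈ freeGrading 𝒜 (deg s) k
  ε_homogeneous : ∀ k, ∀ x ∈ freeGrading 𝒜 (deg 0) k, ε x ∈ 𝒩 k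
  ε_surjective : Function.Surjective ε
  exact_zero : Function.Exact (d 0) ε
  exact_succ : ∀ s, Function.Exact (d (s + 1)) (d s)

namespace GradedFreeResolution

variable {𝒜 : ℤ → Submodule K A} {𝒩 : ℤ → Submodule K N} (F : GradedFreeResolution 𝒜 𝒩)

/-- The differential of the complex `K ⊗_A F`, where `K = A / A₊`. -/
noncomputable def torD (s : ℕ) :
    (A ⧸ positiveIdeal 𝒜) ⊗[A] (F.ι (s + 1) →₀ A) →ₗ[A] (A ⧸ positiveIdeal 𝒜) ⊗[A] (F.ι s →₀ A) :=
  (F.d s).lTensor (A ⧸ positiveIdeal 𝒜)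

/-- The `s`-cycles of `K ⊗_A F`. -/
noncomputable def torCycles : ∀ s : ℕ, Submodule A ((A ⧸ positiveIdeal 𝒜) ⊗[A] (F.ι s →₀ A))
  | 0 => ⊤
  | s + 1 => LinearMap.ker (F.torD s)

/-- The `s`-boundaries of `K ⊗_A F`. -/
noncomputable def torBoundaries (s : ℕ) : Submodule A ((A ⧸ positiveIdeal 𝒜) ⊗[A] (F.ι s →₀ A)) :=
  LinearMap.range (F.torD s)

/-- The degree `j` part of `K ⊗_A F_s`, with `K` placed in degree `0`. -/
def torDegree (s : ℕ) (j : ℤ) : Set ((A ⧸ positiveIdeal 𝒜) ⊗[A] (F.ι s →₀ A)) :=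
  {z | ∃ x ∈ freeGrading 𝒜 (F.deg s) j, z = 1 ⊗ₜ[A] x}

end GradedFreeResolution

/-- `Tor_s^A(N, K)_j ≠ 0`: the `s`-th homology of `K ⊗_A F` has a nonzero class of degree `j`,
where `F` is a graded free resolution of `N`. Graded free resolutions always exist, and the
condition does not depend on the choice of `F`. -/
def TorNonzero (𝒜 : ℤ → Submodule K A) (𝒩 : ℤ → Submodule K N) (s : ℕ) (j : ℤ) : Prop :=
  ∃ F : GradedFreeResolution 𝒜 𝒩,
    ∃ z ∈ F.torDegree s j, z ∈ F.torCycles s ∧ z ∉ F.torBoundaries s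

/-- `t_s(N) = sup {j : Tor_s^A(N, K)_j ≠ 0}`, which is `-∞` if `Tor_s^A(N, K) = 0`. -/
noncomputable def torTop (𝒜 : ℤ → Submodule K A) (𝒩 : ℤ → Submodule K N) (s : ℕ) : EReal :=
  sSup {t : EReal | ∃ j : ℤ, TorNonzero 𝒜 𝒩 s j ∧ t = ((j : ℝ) : EReal)}

/-- The Castelnuovo-Mumford regularity `reg_A N = sup {t_s(N) - s : s ≥ 0}`. -/
noncomputable def regularity (𝒜 : ℤ → Submodule K A) (𝒩 : ℤ → Submodule K N) : EReal :=
  ⨆ s : ℕ, (torTop 𝒜 𝒩 s - (s : EReal))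

/-- The grading of `K = A / A₊`, concentrated in degree `0`. -/
def residueGrading (𝒜 : ℤ → Submodule K A) (i : ℤ) : Submodule K (A ⧸ positiveIdeal 𝒜) :=
  if i = 0 then ⊤ else ⊥

/-- A positively graded `K`-algebra `A` is Koszul if `reg_A K = 0`. -/
def IsKoszul (𝒜 : ℤ → Submodule K A) : Prop :=
  regularity 𝒜 (residueGrading 𝒜) = 0

/-- `indeg N = k`: the least degree in which `N` is nonzero is `k`. -/
def HasInitialDegree (𝒩 : ℤ → Submodule K N) (k : ℤ) : Prop :=
  IsLeast {i : ℤ | 𝒩 i ≠ ⊥} k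

/-- The `ℤ`-grading by total degree of a bigraded module (or algebra). -/
def totalGrading (𝒩 : ℤ × ℤ → Submodule K N) (k : ℤ) : Submodule K N :=
  ⨆ e : {e : ℤ × ℤ // e.1 + e.2 = k}, 𝒩 e

end Regularity

/-! ### Standard bigraded algebras, their diagonals and generalized Veronese subrings -/

section Bigraded

variable {K : Type*} [Field K] {R : Type*} [CommRing R] [Algebra K R]
  {M : Type*} [AddCommGroup M] [Module K M] [Module R M] [IsScalarTower K R M]

/-- The bigrading of `K[x₁,…,xₙ,y₁,…,yₘ]` with `deg xᵢ = (1,0)` and `deg yⱼ = (0,1)`. -/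
def polynomialBigrading (K : Type*) [Field K] (n m : ℕ) :
    ℤ × ℤ → Submodule K (MvPolynomial (Fin n ⊕ Fin m) K) :=
  MvPolynomial.weightedHomogeneousSubmodule K
    (Sum.elim (fun _ => ((1 : ℤ), (0 : ℤ))) (fun _ => ((0 : ℤ), (1 : ℤ))))

/-- `R = S / J` with `S = K[x₁,…,xₙ,y₁,…,yₘ]` and `J` a bihomogeneous ideal: there is a surjective
`K`-algebra map `S → R` for which the bigraded components of `R` are the images of those of `S`.
(As `R` is the direct sum of its components, the kernel is then bihomogeneous.) -/
def IsStandardBigraded (𝒜 : ℤ × ℤ → Submodule K R) : Prop :=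
  ∃ (n m : ℕ) (π : MvPolynomial (Fin n ⊕ Fin m) K →ₐ[K] R),
    Function.Surjective π ∧ ∀ e, 𝒜 e = (polynomialBigrading K n m e).map π.toLinearMap

/-- The subring `⨁_{e ∈ D} R_e` of a bigraded algebra `R`, for a subgroup `D` of `ℤ²`. -/
def gradedSubalgebra (𝒜 : ℤ × ℤ → Submodule K R) [SetLike.GradedMonoid 𝒜]
    (D : AddSubgroup (ℤ × ℤ)) : Subalgebra K R :=
  (⨆ e : D, 𝒜 e).toSubalgebra
    (Submodule.mem_iSup_of_mem (0 : D) (SetLike.GradedOne.one_mem (A := 𝒜)))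
    (by
      intro x y hx hy
      induction hx using Submodule.iSup_induction' with
      | zero => simp
      | add x₁ x₂ _ _ h₁ h₂ => rw [add_mul]; exact add_mem h₁ h₂
      | mem i x hx =>
        induction hy using Submodule.iSup_induction' with
        | zero => simp
        | add y₁ y₂ _ _ h₁ h₂ => rw [mul_add]; exact add_mem h₁ h₂
        | mem j y hy =>
          exact Submodule.mem_iSup_of_mem (i + j) (SetLike.GradedMul.mul_mem (A := 𝒜) hx hy))

/-- The `⨁_{e ∈ D} R_e`-module `⨁_{e ∈ D} M_{e + v}`. -/
def gradedSubmodule (𝒜 : ℤ × ℤ → Submodule K R) [SetLike.GradedMonoid 𝒜]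
    (ℳ : ℤ × ℤ → Submodule K M) [SetLike.GradedSMul 𝒜 ℳ]
    (D : AddSubgroup (ℤ × ℤ)) (v : ℤ × ℤ) : Submodule (gradedSubalgebra 𝒜 D) M where
  toAddSubmonoid := (⨆ e : D, ℳ (e + v)).toAddSubmonoid
  smul_mem' := by
    rintro ⟨x, hx⟩ y hy
    change x ∈ ⨆ e : D, 𝒜 e at hx
    change y ∈ ⨆ e : D, ℳ (e + v) at hy
    change x • y ∈ ⨆ e : D, ℳ (e + v)
    induction hx using Submodule.iSup_induction' with
    | zero => simp
    | add x₁ x₂ _ _ h₁ h₂ => rw [add_smul]; exact add_mem h₁ h₂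
    | mem i x hx =>
      induction hy using Submodule.iSup_induction' with
      | zero => simp
      | add y₁ y₂ _ _ h₁ h₂ => rw [smul_add]; exact add_mem h₁ h₂
      | mem j y hy =>
        refine Submodule.mem_iSup_of_mem (i + j) ?_
        have h := SetLike.GradedSMul.smul_mem (A := 𝒜) (B := ℳ) hx hy
        rwa [vadd_eq_add, ← add_assoc] at h

/-- The `(a,b)`-diagonal `Δ = {(sa, sb) : s ∈ ℤ}`. -/
def diagonal (a b : ℕ) : AddSubgroup (ℤ × ℤ) :=
  AddSubgroup.zmultiples ((a : ℤ), (b : ℤ))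

/-- The set `Δ̃ = {(sa, tb) : s, t ∈ ℤ}`. -/
def veroneseLattice (a b : ℕ) : AddSubgroup (ℤ × ℤ) :=
  (AddSubgroup.zmultiples (a : ℤ)).prod (AddSubgroup.zmultiples (b : ℤ))

section
variable (𝒜 : ℤ × ℤ → Submodule K R) [SetLike.GradedMonoid 𝒜]
  (ℳ : ℤ × ℤ → Submodule K M) [SetLike.GradedSMul 𝒜 ℳ]

/-- The diagonal subalgebra `R_Δ`. (Components with negative index vanish when `R` is standard
bigraded and `(a,b) ≠ (0,0)`.) -/
abbrev DiagonalSubalgebra (a b : ℕ) : Subalgebra K R :=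
  gradedSubalgebra 𝒜 (diagonal a b)

/-- `(R_Δ)_i = R_{(ia, ib)}`. -/
def diagonalGrading (a b : ℕ) (i : ℤ) : Submodule K (DiagonalSubalgebra 𝒜 a b) :=
  (𝒜 (i * a, i * b)).comap (DiagonalSubalgebra 𝒜 a b).val.toLinearMap

/-- The sidediagonal module `M_Δ^{(c,d)}` over `R_Δ`. -/
abbrev SidediagonalModule (a b c d : ℕ) : Submodule (DiagonalSubalgebra 𝒜 a b) M :=
  gradedSubmodule 𝒜 ℳ (diagonal a b) ((c : ℤ), (d : ℤ))

/-- `(M_Δ^{(c,d)})_i = M_{(ia + c, ib + d)}`. -/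
def sidediagonalGrading (a b c d : ℕ) (i : ℤ) : Submodule K (SidediagonalModule 𝒜 ℳ a b c d) :=
  (ℳ (i * a + c, i * b + d)).comap ((SidediagonalModule 𝒜 ℳ a b c d).subtype.restrictScalars K)

/-- The generalized Veronese subring `R_Δ̃`. -/
abbrev VeroneseSubalgebra (a b : ℕ) : Subalgebra K R :=
  gradedSubalgebra 𝒜 (veroneseLattice a b)

/-- The bidegrees that occur in `R_Δ̃`: if `a = 0` only those `(i,j)` with `i = 0`, and if `b = 0`
only those with `j = 0`. In this way each component `R_{(sa, tb)}` of the subring occurs once. -/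
def IsVeroneseIndex (a b : ℕ) (e : ℤ × ℤ) : Prop :=
  (a = 0 → e.1 = 0) ∧ (b = 0 → e.2 = 0)

open Classical in
/-- `(R_Δ̃)_{(i,j)} = R_{(ia, jb)}`. -/
noncomputable def veroneseBigrading (a b : ℕ) (e : ℤ × ℤ) :
    Submodule K (VeroneseSubalgebra 𝒜 a b) :=
  if IsVeroneseIndex a b e then
    (𝒜 (e.1 * a, e.2 * b)).comap (VeroneseSubalgebra 𝒜 a b).val.toLinearMap
  else ⊥

/-- The relative Veronese module `M_Δ̃^{(c,d)}` over `R_Δ̃`. -/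
abbrev RelativeVeroneseModule (a b c d : ℕ) : Submodule (VeroneseSubalgebra 𝒜 a b) M :=
  gradedSubmodule 𝒜 ℳ (veroneseLattice a b) ((c : ℤ), (d : ℤ))

open Classical in
/-- `(M_Δ̃^{(c,d)})_{(i,j)} = M_{(ia + c, jb + d)}`. -/
noncomputable def relativeVeroneseBigrading (a b c d : ℕ) (e : ℤ × ℤ) :
    Submodule K (RelativeVeroneseModule 𝒜 ℳ a b c d) :=
  if IsVeroneseIndex a b e then
    (ℳ (e.1 * a + c, e.2 * b + d)).comap
      ((RelativeVeroneseModule 𝒜 ℳ a b c d).subtype.restrictScalars K)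
  else ⊥

end

/-- The bigrading of `M` itself as a module over `R_Δ̃`, for `a, b ≥ 1`, given by the decomposition
`M = ⨁_{c < a, d < b} M_Δ̃^{(c,d)}`: the component of degree `(i,j)` is
`⨁_{c < a, d < b} M_{(ia + c, jb + d)}`. -/
def veroneseRegrading (ℳ : ℤ × ℤ → Submodule K M) (a b : ℕ) (e : ℤ × ℤ) : Submodule K M :=
  ⨆ (c : Fin a) (d : Fin b), ℳ (e.1 * a + (c : ℕ), e.2 * b + (d : ℕ))

/-- The index set `I(a,b)`. -/
def sidediagonalIndices (a b : ℕ) : Set (ℕ × ℕ) :=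
  {p | p.1 < a ∨ p.2 < b}

/-- The index set `Ĩ(a,b)`, for `(a,b) ≠ (0,0)`. -/
def veroneseIndices (a b : ℕ) : Set (ℕ × ℕ) :=
  {p | (if a = 0 then p.1 = 0 else p.1 < a) ∧ (if b = 0 then p.2 = 0 else p.2 < b)}

end Bigraded

/-! ### Complexes of graded free modules, given by matrices -/

section FreeComplexes

set_option linter.unusedSectionVars false

universe u v

/-! Let `D` be one of the lattices Δ, Δ̃, let A = ⨁_{e ∈ D} R_e, and let P be a bigraded A-free
resolution of K. For the A-module N cut out of M along a coset v + D, Tor^A(N,K) is the homology of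
P ⊗_A N. The degrees of P lie in D, so this is the part of the homology of P ⊗_A M in the bidegrees
of v + D. Moreover P ⊗_A M = (P ⊗_A R) ⊗_R M, and P ⊗_A R is a complex of free R-modules. The
problem thus splits into two: vanishing of Tor^A(R,K) bidegree by bidegree, and the passage from R
to M.

From R to M: as reg_R M = r and M lives in ℕ², there is an R-free resolution of M whose i-th
generators have bidegrees u ≥ 0 with |u| ≤ r + i. Dimension shifting shows that H_n(P ⊗ M)_e
vanishes once H_{n-i}(P ⊗ R)_{e-u} vanishes for all 0 ≤ i ≤ n and all such u
(`HasRegularityBound.HV_of_self`).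

For R itself: Tor^A_n(R,K)_e = 0 for n < ℓ(e), where ℓ(e) is min(⌊e₁/a⌋, ⌊e₂/b⌋) for Δ and ⌊e₁/a⌋ +
⌊e₂/b⌋ for Δ̃ if a, b ≥ 1, and the only available quotient if a or b is 0
(`IsAcyclicityBound.HV_self`). If e ∈ D, only Tor^A(A,K) is seen. If e ∉ D, all components of R that
are seen from e along D lie in the ideal I of positive x-degree, or in that of positive y-degree.
Then R may be replaced by I, and the linear R-resolution of I leads to bidegrees of smaller total
degree.

The linearity of I (`HV_coneFamily`) is where the Koszul property of R enters. The quotient R/I is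
the subring B of the components of x-degree 0 (or y-degree 0), an algebra retract of R. If Y is the
base change to R of a B-resolution of K and E is an R-resolution of R/I, then Y ⊗ E resolves K over
R. Since E ⊗ K is a direct summand of Y ⊗ E ⊗ K, the Koszul bound on Tor^R(K,K) passes to
Tor^R(R/I,K).

The stated bounds then follow by arithmetic with floors and ceilings. Two general facts connect this
with the definition of regularity: `Tor` may be computed from a resolution of either argument
(`Resolves.balance`), and vanishing in bidegrees may be summed to vanishing in coarser degrees
(`HV.coarsen`). -/

theorem AddSubgroup.exists_finsupp_of_mem_iSup {ι Z : Type*} [AddCommGroup Z]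
    (S : ι → AddSubgroup Z) {x : Z} (hx : x ∈ ⨆ i, S i) :
    ∃ F : ι →₀ Z, (∀ i, F i ∈ S i) ∧ F.sum (fun _ z => z) = x := by
  classical
  induction hx using AddSubgroup.iSup_induction' with
  | h1 => exact ⟨0, fun i => zero_mem _, by simp⟩
  | hp i x hx =>
    refine ⟨Finsupp.single i x, fun j => ?_, by simp⟩
    by_cases h : i = j
    · subst h; simpa using hx
    · simp [Finsupp.single_eq_of_ne' h]
  | hadd x y _ _ h1 h2 =>
    obtain ⟨F, hF, rfl⟩ := h1
    obtain ⟨F', hF', rfl⟩ := h2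
    exact ⟨F + F', fun i => add_mem (hF i) (hF' i),
      Finsupp.sum_add_index' (fun _ => rfl) (fun _ _ _ => rfl)⟩

/-- Compatibility of a family of subgroups of a module with a family of subgroups of the ring. -/
def HomogeneousSMul {A G Z : Type*} [CommRing A] [AddCommGroup G] [AddCommGroup Z] [Module A Z]
    (𝒜 : G → AddSubgroup A) (𝒵 : G → AddSubgroup Z) : Prop :=
  ∀ ⦃g e : G⦄ ⦃a : A⦄ ⦃z : Z⦄, a ∈ 𝒜 g → z ∈ 𝒵 e → a • z ∈ 𝒵 (g + e)

/-- A complex of graded free `A`-modules in nonnegative homological degrees, with all its terms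
collected into one free module with homogeneous basis `κ`. -/
structure FreeCpx {A : Type v} [CommRing A] {G : Type*} [AddCommGroup G]
    (𝒜 : G → AddSubgroup A) where
  /-- the homogeneous basis -/
  κ : Type u
  /-- the homological degree of a basis element -/
  h : κ → ℕ
  /-- the internal degree of a basis element -/
  deg : κ → G
  /-- the differential of a basis element -/
  bd : κ → κ →₀ A
  bd_mem : ∀ k l, bd k l ∈ 𝒜 (deg k - deg l)
  bd_h : ∀ k l, bd k l ≠ 0 → h k = h l + 1
  bd_bd : ∀ k, (bd k).sum (fun l a => a • bd l) = 0

namespace FreeCpx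

variable {A : Type v} [CommRing A] {G : Type*} [AddCommGroup G] {𝒜 : G → AddSubgroup A}
  (D : FreeCpx.{u} 𝒜)
  {Z Z' : Type*} [AddCommGroup Z] [Module A Z] [AddCommGroup Z'] [Module A Z']

/-- The vector `(aₗ z)ₗ`. -/
noncomputable def vecSMul {κ : Type*} (a : κ →₀ A) : Z →ₗ[A] (κ →₀ Z) where
  toFun z := a.mapRange (fun x => x • z) (zero_smul A z)
  map_add' x y := by ext; simp
  map_smul' c x := by ext; simp [smul_smul, mul_comm]

@[simp] theorem vecSMul_apply {κ : Type*} (a : κ →₀ A) (z : Z) (l : κ) :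
    vecSMul a z l = a l • z := by simp [vecSMul]

variable (Z) in
/-- The differential of `D ⊗ Z`. -/
noncomputable def d : (D.κ →₀ Z) →ₗ[A] (D.κ →₀ Z) :=
  Finsupp.lsum A (fun k => vecSMul (D.bd k))

theorem d_single (k : D.κ) (z : Z) : D.d Z (Finsupp.single k z) = vecSMul (D.bd k) z := by
  simp [d]

theorem d_apply (f : D.κ →₀ Z) (l : D.κ) : D.d Z f l = f.sum (fun k z => D.bd k l • z) := by
  simp [d, Finsupp.sum_apply]

theorem d_mapRange (φ : Z →ₗ[A] Z') (f : D.κ →₀ Z) :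
    D.d Z' (Finsupp.mapRange.linearMap φ f) = Finsupp.mapRange.linearMap φ (D.d Z f) := by
  suffices h : D.d Z' ∘ₗ Finsupp.mapRange.linearMap φ = Finsupp.mapRange.linearMap φ ∘ₗ D.d Z from
    LinearMap.congr_fun h f
  refine Finsupp.lhom_ext' fun k => LinearMap.ext fun z => ?_
  ext l
  simp [d_single]

theorem d_d (f : D.κ →₀ Z) : D.d Z (D.d Z f) = 0 := by
  suffices h : D.d Z ∘ₗ D.d Z = 0 from LinearMap.congr_fun h f
  refine Finsupp.lhom_ext' fun k => LinearMap.ext fun z => ?_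
  have h1 : vecSMul (D.bd k) z =
      Finsupp.mapRange.linearMap (LinearMap.toSpanSingleton A Z z) (D.bd k) := by
    ext l; simp
  have h2 : D.d A (D.bd k) = 0 := by
    rw [← D.bd_bd k, d]
    simp only [Finsupp.coe_lsum]
    refine Finsupp.sum_congr fun l _ => ?_
    ext m; simp [mul_comm]
  simp only [LinearMap.comp_apply, Finsupp.lsingle_apply, d_single, h1, d_mapRange, h2, map_zero,
    LinearMap.zero_apply]

/-- The component of `D ⊗ Z` of homological degree `n` and internal degree `e`. -/
def part (𝒵 : G → AddSubgroup Z) (n : ℤ) (e : G) : AddSubgroup (D.κ →₀ Z) where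
  carrier := {f | ∀ k, f k ∈ 𝒵 (e - D.deg k) ∧ ((D.h k : ℤ) ≠ n → f k = 0)}
  add_mem' {f g} hf hg k := ⟨add_mem (hf k).1 (hg k).1, fun h => by
    simp [(hf k).2 h, (hg k).2 h]⟩
  zero_mem' k := ⟨zero_mem _, fun _ => rfl⟩
  neg_mem' {f} hf k := ⟨neg_mem (hf k).1, fun h => by simp [(hf k).2 h]⟩

variable {D} {𝒵 : G → AddSubgroup Z} {𝒵' : G → AddSubgroup Z'} {n : ℤ} {e : G}

theorem mem_part {f : D.κ →₀ Z} : f ∈ D.part 𝒵 n e ↔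
    ∀ k, f k ∈ 𝒵 (e - D.deg k) ∧ ((D.h k : ℤ) ≠ n → f k = 0) := Iff.rfl

theorem d_mem_part (hs : HomogeneousSMul 𝒜 𝒵) {f : D.κ →₀ Z} (hf : f ∈ D.part 𝒵 n e) :
    D.d Z f ∈ D.part 𝒵 (n - 1) e := by
  intro l
  rw [d_apply]
  refine ⟨sum_mem fun k _ => ?_, fun hl => Finset.sum_eq_zero fun k _ => ?_⟩
  · have := hs (D.bd_mem k l) (hf k).1
    rwa [show D.deg k - D.deg l + (e - D.deg k) = e - D.deg l by abel] at this
  · by_cases h0 : D.bd k l = 0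
    · simp [h0]
    · have := D.bd_h k l h0
      simp [(hf k).2 (by omega)]

theorem mapRange_mem_part (φ : Z →ₗ[A] Z') (hφ : ∀ e z, z ∈ 𝒵 e → φ z ∈ 𝒵' e) {f : D.κ →₀ Z}
    (hf : f ∈ D.part 𝒵 n e) : Finsupp.mapRange.linearMap φ f ∈ D.part 𝒵' n e := by
  intro k
  refine ⟨by simpa using hφ _ _ (hf k).1, fun h => by simp [(hf k).2 h]⟩

theorem eq_zero_of_mem_part (hn : n < 0) {f : D.κ →₀ Z} (hf : f ∈ D.part 𝒵 n e) : f = 0 := by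
  ext k
  exact (hf k).2 (by omega)

variable (D 𝒵 n e) in
/-- The homology of `D ⊗ Z` in homological degree `n` and internal degree `e` vanishes. -/
def HV : Prop := ∀ f ∈ D.part 𝒵 n e, D.d Z f = 0 → ∃ g ∈ D.part 𝒵 (n + 1) e, D.d Z g = f

theorem HV.of_neg (hn : n < 0) : D.HV 𝒵 n e := fun f hf _ =>
  ⟨0, zero_mem _, by rw [eq_zero_of_mem_part hn hf, map_zero]⟩

theorem HV.of_bot (h : ∀ k, 𝒵 (e - D.deg k) = ⊥) : D.HV 𝒵 n e := by
  intro f hf _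
  refine ⟨0, zero_mem _, ?_⟩
  ext k
  have := (hf k).1
  rw [h] at this
  rw [map_zero, (AddSubgroup.mem_bot.1 this)]; rfl

theorem part_congr {𝒵₂ : G → AddSubgroup Z} (h : ∀ k, 𝒵 (e - D.deg k) = 𝒵₂ (e - D.deg k)) :
    D.part 𝒵 n e = D.part 𝒵₂ n e := by
  ext f; simp only [mem_part, h]

theorem HV.congr {𝒵₂ : G → AddSubgroup Z} (h : ∀ k, 𝒵 (e - D.deg k) = 𝒵₂ (e - D.deg k))
    (H : D.HV 𝒵 n e) : D.HV 𝒵₂ n e := by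
  unfold HV at *
  simpa only [part_congr h] using H

/-- Lifting along a degreewise surjective map. -/
theorem exists_lift_part (φ : Z →ₗ[A] Z') (hφ : ∀ e, ∀ z ∈ 𝒵' e, ∃ y ∈ 𝒵 e, φ y = z)
    {f : D.κ →₀ Z'} (hf : f ∈ D.part 𝒵' n e) :
    ∃ g ∈ D.part 𝒵 n e, Finsupp.mapRange.linearMap φ g = f := by
  classical
  have : ∀ k, ∃ y ∈ 𝒵 (e - D.deg k), φ y = f k ∧ (f k = 0 → y = 0) := fun k => by
    by_cases h : f k = 0
    · exact ⟨0, zero_mem _, by simp [h], fun _ => rfl⟩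
    · obtain ⟨y, hy, hy'⟩ := hφ _ _ (hf k).1
      exact ⟨y, hy, hy', fun h' => absurd h' h⟩
  choose y hy hyf hy0 using this
  refine ⟨Finsupp.onFinset f.support y fun k hk => ?_, fun k => ⟨hy k, fun h => ?_⟩, ?_⟩
  · rw [Finsupp.mem_support_iff]; exact fun h => hk (hy0 k h)
  · exact hy0 k ((hf k).2 h)
  · ext k; simp [hyf]

/-- In a degreewise short exact sequence `0 → ker φ → Z → Z' → 0`, vanishing for the middle term
and for the kernel (one step lower) gives vanishing for the quotient. -/
theorem HV.quotient (hs : HomogeneousSMul 𝒜 𝒵) (φ : Z →ₗ[A] Z')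
    (hφ : ∀ e z, z ∈ 𝒵 e → φ z ∈ 𝒵' e)
    (hsurj : ∀ e, ∀ z ∈ 𝒵' e, ∃ y ∈ 𝒵 e, φ y = z) (h1 : D.HV 𝒵 n e)
    (h2 : D.HV (fun e => 𝒵 e ⊓ (LinearMap.ker φ).toAddSubgroup) (n - 1) e) : D.HV 𝒵' n e := by
  intro f hf hdf
  obtain ⟨f', hf', rfl⟩ := exists_lift_part φ hsurj hf
  have hm := d_mem_part hs hf'
  have hk : ∀ k, φ (D.d Z f' k) = 0 := fun k => by
    have := DFunLike.congr_fun ((d_mapRange D φ f').symm.trans hdf) k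
    simpa using this
  -- The boundary of the lift lies in the kernel and bounds there, so subtracting `g` turns the lift
  -- into a cycle of the middle term.
  obtain ⟨g, hg, hgd⟩ := h2 (D.d Z f') (fun k => ⟨⟨(hm k).1, hk k⟩, (hm k).2⟩) (d_d D f')
  rw [sub_add_cancel] at hg
  obtain ⟨w, hw, hwd⟩ := h1 (f' - g) (sub_mem hf' fun k => ⟨(hg k).1.1, (hg k).2⟩)
    (by rw [map_sub, hgd, sub_self])
  refine ⟨_, mapRange_mem_part φ hφ hw, ?_⟩
  rw [d_mapRange, hwd, map_sub, sub_eq_self]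
  ext k
  simpa using (hg k).1.2

/-- In a degreewise short exact sequence `0 → ker φ → Z → Z' → 0`, vanishing for the middle term
and for the quotient (one step higher) gives vanishing for the kernel. -/
theorem HV.kernel (φ : Z →ₗ[A] Z') (hs : HomogeneousSMul 𝒜 𝒵)
    (hφ : ∀ e z, z ∈ 𝒵 e → φ z ∈ 𝒵' e)
    (hsurj : ∀ e, ∀ z ∈ 𝒵' e, ∃ y ∈ 𝒵 e, φ y = z) (h1 : D.HV 𝒵 n e)
    (h2 : D.HV 𝒵' (n + 1) e) :
    D.HV (fun e => 𝒵 e ⊓ (LinearMap.ker φ).toAddSubgroup) n e := by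
  intro f hf hdf
  obtain ⟨g, hg, rfl⟩ := h1 f (fun k => ⟨(hf k).1.1, (hf k).2⟩) hdf
  obtain ⟨w, hw, hwd⟩ := h2 _ (mapRange_mem_part φ hφ hg) (by
    rw [d_mapRange]
    ext k
    simpa using (hf k).1.2)
  -- Subtracting the boundary of a lift of `w` moves the preimage `g` into the kernel without
  -- changing its boundary.
  obtain ⟨w', hw', rfl⟩ := exists_lift_part φ hsurj hw
  have hm := d_mem_part hs hw'
  rw [add_sub_cancel_right] at hm
  have hm2 := sub_mem hg hm
  refine ⟨g - D.d Z w', fun k => ⟨⟨(hm2 k).1, ?_⟩, (hm2 k).2⟩, by rw [map_sub, d_d, sub_zero]⟩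
  have := DFunLike.congr_fun hwd k
  rw [d_mapRange] at this
  simpa [sub_eq_zero] using this.symm

/-- Vanishing for a graded free module. -/
theorem HV.free {β : Type*} (p : β → G) (h : ∀ b, D.HV 𝒵 n (e - p b)) :
    D.HV (fun e => (⨅ b, (𝒵 (e - p b)).comap (Finsupp.applyAddHom b) : AddSubgroup (β →₀ Z)))
      n e := by
  classical
  intro f hf hdf
  have h1 : ∀ b, Finsupp.mapRange.linearMap (Finsupp.lapply b : (β →₀ Z) →ₗ[A] Z) f ∈
      D.part 𝒵 n (e - p b) := fun b k => by
    have := (hf k).1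
    simp only [AddSubgroup.mem_iInf] at this
    refine ⟨?_, fun h => by simp [(hf k).2 h]⟩
    have := this b
    rw [sub_right_comm]
    simpa using this
  choose g hg hgd using fun b => h b _ (h1 b) (by rw [d_mapRange, hdf, map_zero])
  -- Only finitely many coordinates occur in `f`, so finitely many of the chosen preimages need to
  -- be summed.
  let B : Finset β := f.support.biUnion fun k => (f k).support
  refine ⟨∑ b ∈ B, Finsupp.mapRange.linearMap (Finsupp.lsingle b : Z →ₗ[A] (β →₀ Z)) (g b),
    sum_mem fun b _ k => ⟨?_, fun h => ?_⟩, ?_⟩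
  · simp only [AddSubgroup.mem_iInf]
    intro b'
    have := (hg b k).1
    rw [sub_right_comm] at this
    by_cases hb : b = b'
    · subst hb; simpa using this
    · simp [Finsupp.single_eq_of_ne' hb]
  · simp [(hg b k).2 h]
  · simp only [map_sum, d_mapRange, hgd]
    ext k b
    simp only [Finsupp.finsetSum_apply, Finsupp.mapRange.linearMap_apply,
      Finsupp.mapRange_apply, Finsupp.lapply_apply, Finsupp.lsingle_apply]
    by_cases hb : b ∈ B
    · rw [Finset.sum_eq_single_of_mem b hb fun b' _ h => by simp [h.symm]]
      simp
    · rw [Finset.sum_eq_zero fun b' hb' => by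
        rw [Finsupp.single_eq_of_ne (by rintro rfl; exact hb hb')]]
      by_contra hne
      refine hb (Finset.mem_biUnion.2 ⟨k, ?_, ?_⟩)
      · rw [Finsupp.mem_support_iff]; intro h0; simp [h0] at hne
      · rw [Finsupp.mem_support_iff]; exact fun h0 => hne h0.symm

end FreeCpx

/-- Projections onto the components of a grading which are compatible with the action of the
homogeneous ring elements. -/
structure EquivariantProj {A G Z : Type*} [CommRing A] [AddCommGroup G] [AddCommGroup Z]
    [Module A Z] (𝒜 : G → AddSubgroup A) (𝒵 : G → AddSubgroup Z) (π : G → Z →+ Z) : Prop where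
  mem : ∀ e z, π e z ∈ 𝒵 e
  self : ∀ e, ∀ z ∈ 𝒵 e, π e z = z
  ne : ∀ e e', e ≠ e' → ∀ z ∈ 𝒵 e, π e' z = 0
  smul : ∀ g e, ∀ a ∈ 𝒜 g, ∀ z, π (g + e) (a • z) = a • π e z

namespace FreeCpx

variable {A : Type v} [CommRing A] {G : Type*} [AddCommGroup G] {𝒜 : G → AddSubgroup A}
  {D : FreeCpx.{u} 𝒜}
  {Z Z' : Type*} [AddCommGroup Z] [Module A Z] [AddCommGroup Z'] [Module A Z']
  {𝒵 : G → AddSubgroup Z} {n : ℤ} {e : G} {π : G → Z →+ Z}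

variable (D) in
/-- The component of homological degree `n` and internal degree `e` of an element of `D ⊗ Z`. -/
noncomputable def comp (π : G → Z →+ Z) (n : ℤ) (e : G) (f : D.κ →₀ Z) : D.κ →₀ Z :=
  Finsupp.onFinset f.support (fun k => if (D.h k : ℤ) = n then π (e - D.deg k) (f k) else 0)
    (fun k hk => by
      rw [Finsupp.mem_support_iff]
      rintro h
      simp [h] at hk)

theorem comp_apply (f : D.κ →₀ Z) (k : D.κ) :
    D.comp π n e f k = if (D.h k : ℤ) = n then π (e - D.deg k) (f k) else 0 := rfl

theorem comp_mem (hπ : EquivariantProj 𝒜 𝒵 π) (f : D.κ →₀ Z) :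
    D.comp π n e f ∈ D.part 𝒵 n e := by
  intro k
  rw [comp_apply]
  split_ifs with h
  · exact ⟨hπ.mem _ _, fun h' => absurd h h'⟩
  · exact ⟨zero_mem _, fun _ => rfl⟩

theorem comp_self (hπ : EquivariantProj 𝒜 𝒵 π) {f : D.κ →₀ Z} (hf : f ∈ D.part 𝒵 n e) :
    D.comp π n e f = f := by
  ext k
  rw [comp_apply]
  split_ifs with h
  · exact hπ.self _ _ (hf k).1
  · exact ((hf k).2 h).symm

/-- The matrix entries are homogeneous of degree `deg k - deg l` and the projections commute with
homogeneous scalars, so taking components is a chain map. -/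
theorem d_comp (hπ : EquivariantProj 𝒜 𝒵 π) (f : D.κ →₀ Z) :
    D.d Z (D.comp π (n + 1) e f) = D.comp π n e (D.d Z f) := by
  ext l
  have hsub : (D.comp π (n + 1) e f).support ⊆ f.support := Finsupp.support_onFinset_subset
  rw [comp_apply, d_apply, d_apply,
    Finsupp.sum_of_support_subset _ hsub _ (fun k _ => smul_zero _)]
  split_ifs with h
  · rw [Finsupp.sum, map_sum]
    refine Finset.sum_congr rfl fun k _ => ?_
    by_cases h0 : D.bd k l = 0
    · simp [h0]
    have := D.bd_h k l h0
    rw [comp_apply, if_pos (by omega), ← hπ.smul _ _ _ (D.bd_mem k l)]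
    congr 2
    abel
  · refine Finset.sum_eq_zero fun k _ => ?_
    by_cases h0 : D.bd k l = 0
    · simp [h0]
    have := D.bd_h k l h0
    rw [comp_apply, if_neg (by omega), smul_zero]

/-- A homogeneous boundary is the boundary of a homogeneous element. -/
theorem exists_part_of_boundary (hπ : EquivariantProj 𝒜 𝒵 π) {f : D.κ →₀ Z}
    (hf : f ∈ D.part 𝒵 n e) (g : D.κ →₀ Z) (hg : D.d Z g = f) :
    ∃ g' ∈ D.part 𝒵 (n + 1) e, D.d Z g' = f :=
  ⟨_, comp_mem hπ g, by rw [d_comp hπ, hg, comp_self hπ hf]⟩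

theorem comp_ne (hπ : EquivariantProj 𝒜 𝒵 π) {f : D.κ →₀ Z} (hf : f ∈ D.part 𝒵 n e) {e' : G}
    (he : e ≠ e') : D.comp π n e' f = 0 := by
  ext k
  rw [comp_apply]
  split_ifs with h
  · exact hπ.ne (e - D.deg k) _ (fun h' => he (sub_left_injective h')) _ (hf k).1
  · rfl

theorem comp_add (f g : D.κ →₀ Z) :
    D.comp π n e (f + g) = D.comp π n e f + D.comp π n e g := by
  ext k
  simp only [comp_apply, Finsupp.add_apply, map_add]
  split_ifs <;> simp

theorem comp_finset_sum {ι : Type*} (s : Finset ι) (f : ι → D.κ →₀ Z) :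
    D.comp π n e (∑ i ∈ s, f i) = ∑ i ∈ s, D.comp π n e (f i) := by
  classical
  have h0 : D.comp π n e (0 : D.κ →₀ Z) = 0 := by ext k; simp [comp_apply]
  induction s using Finset.induction_on with
  | empty => simpa using h0
  | insert a s ha ih => rw [Finset.sum_insert ha, Finset.sum_insert ha, comp_add, ih]

theorem mem_iSup_part (W : Set G) {f : D.κ →₀ Z} (hf : ∀ k, f k ∈ ⨆ w : W, 𝒵 (w - D.deg k))
    (hf' : ∀ k, (D.h k : ℤ) ≠ n → f k = 0) : f ∈ ⨆ w : W, D.part 𝒵 n w := by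
  classical
  rw [← Finsupp.sum_single f]
  refine sum_mem fun k hk => ?_
  have hn : (D.h k : ℤ) = n := by
    by_contra hne; exact (Finsupp.mem_support_iff.1 hk) (hf' k hne)
  have : f k ∈ (⨆ w : W, D.part 𝒵 n w).comap (Finsupp.singleAddHom k) := by
    refine (iSup_le fun w => ?_ : (⨆ w : W, 𝒵 (w - D.deg k)) ≤ _) (hf k)
    intro z hz
    refine AddSubgroup.mem_iSup_of_mem w fun k' => ?_
    by_cases hkk : k = k'
    · subst hkk; simpa using ⟨hz, fun h' => absurd hn h'⟩
    · simp [Finsupp.single_eq_of_ne' hkk]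
  exact this

theorem apply_mem_of_mem_iSup_part (W : Set G) {f : D.κ →₀ Z} (hf : f ∈ ⨆ w : W, D.part 𝒵 n w)
    (k : D.κ) : f k ∈ ⨆ w : W, 𝒵 (w - D.deg k) := by
  have : (⨆ w : W, D.part 𝒵 n w) ≤
      (⨆ w : W, 𝒵 (w - D.deg k)).comap (Finsupp.applyAddHom k) :=
    iSup_le fun w f hf => AddSubgroup.mem_iSup_of_mem w (hf k).1
  exact this hf

/-- Vanishing of the homology in all degrees of a set `W` gives vanishing in the coarser degree
which consists of all of `W`. -/
theorem HV.coarsen (hs : HomogeneousSMul 𝒜 𝒵) (hπ : EquivariantProj 𝒜 𝒵 π) (W : Set G)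
    (h : ∀ w ∈ W, D.HV 𝒵 n w) (f : D.κ →₀ Z)
    (hf : ∀ k, f k ∈ ⨆ w : W, 𝒵 (w - D.deg k)) (hf' : ∀ k, (D.h k : ℤ) ≠ n → f k = 0)
    (hd : D.d Z f = 0) :
    ∃ g : D.κ →₀ Z, (∀ k, g k ∈ ⨆ w : W, 𝒵 (w - D.deg k)) ∧
      (∀ k, (D.h k : ℤ) ≠ n + 1 → g k = 0) ∧ D.d Z g = f := by
  classical
  have hmem := mem_iSup_part (𝒵 := 𝒵) W hf hf'
  obtain ⟨F, hF, hFs⟩ := AddSubgroup.exists_finsupp_of_mem_iSup _ hmem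
  -- The differential preserves internal degrees, so each homogeneous component of the cycle is
  -- itself a cycle.
  have hFd : ∀ w, D.d Z (F w) = 0 := by
    intro w
    have h1 : D.comp π (n - 1) w (D.d Z f) = D.d Z (F w) := by
      rw [← hFs, Finsupp.sum, map_sum, comp_finset_sum]
      by_cases hw : w ∈ F.support
      · rw [Finset.sum_eq_single_of_mem w hw fun w' _ hne =>
          comp_ne hπ (d_mem_part hs (hF w')) fun h => hne (Subtype.ext h)]
        exact comp_self hπ (d_mem_part hs (hF w))
      · rw [Finsupp.notMem_support_iff.1 hw, map_zero]
        refine Finset.sum_eq_zero fun w' hw' =>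
          comp_ne hπ (d_mem_part hs (hF w')) fun h => hw ?_
        rwa [← Subtype.ext h]
    rw [← h1, hd]
    ext k; simp [comp_apply]
  choose g hg hgd using fun w : W => h w w.2 (F w) (hF w) (hFd w)
  refine ⟨∑ w ∈ F.support, g w, fun k => ?_, fun k hk => ?_, ?_⟩
  · rw [Finsupp.finsetSum_apply]
    exact sum_mem fun w _ => AddSubgroup.mem_iSup_of_mem w (hg w k).1
  · rw [Finsupp.finsetSum_apply]
    exact Finset.sum_eq_zero fun w _ => (hg w k).2 hk
  · rw [map_sum, ← hFs, Finsupp.sum]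
    exact Finset.sum_congr rfl fun w _ => hgd w

end FreeCpx

end FreeComplexes

/-! ### Total complexes `D ⊗ Z` and augmented resolutions -/

section TotalComplexes

set_option linter.unusedSectionVars false

universe u u' v

namespace FreeCpx

variable {A : Type v} [CommRing A] {G : Type*} [AddCommGroup G] {𝒜 : G → AddSubgroup A}
  (D : FreeCpx.{u} 𝒜)
  {Z Z' : Type*} [AddCommGroup Z] [Module A Z] [AddCommGroup Z'] [Module A Z']

/-- The map `1 ⊗ φ` on `D ⊗ Z`, with the sign `(-1)^p` in homological degree `p` of `D`. -/
noncomputable def sgn (φ : Z →ₗ[A] Z') : (D.κ →₀ Z) →ₗ[A] (D.κ →₀ Z') :=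
  Finsupp.lsum A (fun k => (-1 : A) ^ D.h k • (Finsupp.lsingle k ∘ₗ φ))

theorem sgn_single (φ : Z →ₗ[A] Z') (k : D.κ) (z : Z) :
    D.sgn φ (Finsupp.single k z) = Finsupp.single k ((-1 : A) ^ D.h k • φ z) := by
  simp [sgn]

@[simp] theorem sgn_apply (φ : Z →ₗ[A] Z') (f : D.κ →₀ Z) (k : D.κ) :
    D.sgn φ f k = (-1 : A) ^ D.h k • φ (f k) := by
  suffices h : Finsupp.lapply k ∘ₗ D.sgn φ = (-1 : A) ^ D.h k • (φ ∘ₗ Finsupp.lapply k) from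
    LinearMap.congr_fun h f
  refine Finsupp.lhom_ext' fun l => LinearMap.ext fun z => ?_
  by_cases h : l = k
  · subst h; simp [sgn_single]
  · simp [sgn_single, Finsupp.single_eq_of_ne' h]

/-- The total differential of `D ⊗ Z`, where `Z` is a module with differential `δ`. -/
noncomputable def tot (δ : Z →ₗ[A] Z) : (D.κ →₀ Z) →ₗ[A] (D.κ →₀ Z) := D.d Z + D.sgn δ

theorem tot_apply (δ : Z →ₗ[A] Z) (f : D.κ →₀ Z) (k : D.κ) :
    D.tot δ f k = D.d Z f k + (-1 : A) ^ D.h k • δ (f k) := by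
  simp [tot]

theorem sgn_mapRange {Y : Type*} [AddCommGroup Y] [Module A Y] (φ : Y →ₗ[A] Z)
    (ψ : Z →ₗ[A] Z') (f : D.κ →₀ Y) :
    D.sgn ψ (Finsupp.mapRange.linearMap φ f) = D.sgn (ψ ∘ₗ φ) f := by
  ext k; simp

theorem mapRange_sgn {Y : Type*} [AddCommGroup Y] [Module A Y] (φ : Y →ₗ[A] Z)
    (ψ : Z →ₗ[A] Z') (f : D.κ →₀ Y) :
    Finsupp.mapRange.linearMap ψ (D.sgn φ f) = D.sgn (ψ ∘ₗ φ) f := by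
  ext k; simp

/-- The sign alternates with the homological degree, which `d` lowers by one. This anticommutation
makes the total differential square to zero. -/
theorem d_sgn (φ : Z →ₗ[A] Z') (f : D.κ →₀ Z) :
    D.d Z' (D.sgn φ f) = - D.sgn φ (D.d Z f) := by
  suffices h : D.d Z' ∘ₗ D.sgn φ = - (D.sgn φ ∘ₗ D.d Z) from LinearMap.congr_fun h f
  refine Finsupp.lhom_ext' fun k => LinearMap.ext fun z => ?_
  ext l
  simp only [LinearMap.comp_apply, Finsupp.lsingle_apply, sgn_single, d_single, vecSMul_apply,
    LinearMap.neg_apply, Finsupp.neg_apply, sgn_apply, map_smul, Finsupp.smul_apply]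
  by_cases h : D.bd k l = 0
  · simp [h]
  · rw [D.bd_h k l h, pow_succ]
    simp

theorem tot_tot {δ : Z →ₗ[A] Z} (hδ : δ ∘ₗ δ = 0) (f : D.κ →₀ Z) :
    D.tot δ (D.tot δ f) = 0 := by
  have h1 : D.sgn δ (D.sgn δ f) = 0 := by
    ext k
    have := LinearMap.congr_fun hδ (f k)
    simp only [LinearMap.comp_apply] at this
    simp [this]
  simp [tot, d_d, d_sgn, h1]

/-- The component of degree `(n, e)` of `D ⊗ Z`, where `Z` is graded homologically and
internally. -/
def totPart (𝒵 : ℤ → G → AddSubgroup Z) (n : ℤ) (e : G) : AddSubgroup (D.κ →₀ Z) where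
  carrier := {f | ∀ k, f k ∈ 𝒵 (n - D.h k) (e - D.deg k)}
  add_mem' hf hg k := add_mem (hf k) (hg k)
  zero_mem' _ := zero_mem _
  neg_mem' hf k := neg_mem (hf k)

variable {D} {𝒵 : ℤ → G → AddSubgroup Z} {δ : Z →ₗ[A] Z} {n : ℤ} {e : G}

theorem tot_mem_totPart (hs : ∀ m, HomogeneousSMul 𝒜 (𝒵 m))
    (hδ : ∀ m e z, z ∈ 𝒵 m e → δ z ∈ 𝒵 (m - 1) e) {f : D.κ →₀ Z} (hf : f ∈ D.totPart 𝒵 n e) :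
    D.tot δ f ∈ D.totPart 𝒵 (n - 1) e := by
  intro l
  rw [tot_apply]
  refine add_mem ?_ ?_
  · rw [d_apply]
    refine sum_mem fun k _ => ?_
    by_cases h0 : D.bd k l = 0
    · simp only [h0, zero_smul]; exact zero_mem _
    have := hs _ (D.bd_mem k l) (hf k)
    have h1 := D.bd_h k l h0
    rwa [show D.deg k - D.deg l + (e - D.deg k) = e - D.deg l by abel,
      show n - (D.h k : ℤ) = n - 1 - D.h l by omega] at this
  · have := hδ _ _ _ (hf l)
    rw [show n - (D.h l : ℤ) - 1 = n - 1 - D.h l by omega] at this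
    rcases neg_one_pow_eq_or A (D.h l) with h | h <;> rw [h]
    · simpa using this
    · simpa using this

/-- If `Z` is acyclic, then so is `D ⊗ Z`. -/
theorem tot_acyclic (hs : ∀ m, HomogeneousSMul 𝒜 (𝒵 m))
    (hδ : ∀ m e z, z ∈ 𝒵 m e → δ z ∈ 𝒵 (m - 1) e) (hδδ : δ ∘ₗ δ = 0)
    (hac : ∀ m e, ∀ z ∈ 𝒵 m e, δ z = 0 → ∃ w ∈ 𝒵 (m + 1) e, δ w = z)
    {f : D.κ →₀ Z} (hf : f ∈ D.totPart 𝒵 n e) (hd : D.tot δ f = 0) :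
    ∃ g ∈ D.totPart 𝒵 (n + 1) e, D.tot δ g = f := by
  classical
  -- Finite support bounds the homological degrees in `D`; the induction removes the top one each
  -- time.
  obtain ⟨m, hm⟩ : ∃ m, ∀ k, f k ≠ 0 → D.h k < m := by
    refine ⟨f.support.sup D.h + 1, fun k hk => ?_⟩
    exact Nat.lt_succ_of_le (Finset.le_sup (f := D.h) (Finsupp.mem_support_iff.2 hk))
  induction m generalizing f with
  | zero =>
    refine ⟨0, zero_mem _, ?_⟩
    ext k
    by_contra h
    exact absurd (hm k (by simpa using Ne.symm h)) (Nat.not_lt_zero _)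
  | succ m ih =>
    -- Nothing arrives from above the top degree of `D`, so the cycle condition there involves only
    -- `δ`.
    have hz : ∀ k, D.h k = m → δ (f k) = 0 := by
      intro k hk
      have h1 := DFunLike.congr_fun hd k
      rw [tot_apply, d_apply, Finsupp.sum, Finset.sum_eq_zero fun l hl => ?_] at h1
      · rcases neg_one_pow_eq_or A (D.h k) with h | h <;> rw [h] at h1 <;> simpa using h1
      · by_cases h0 : D.bd l k = 0
        · simp [h0]
        · have := D.bd_h l k h0
          have := hm l (Finsupp.mem_support_iff.1 hl)
          omega
    have : ∀ k, ∃ w ∈ 𝒵 (n + 1 - D.h k) (e - D.deg k),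
        (f k = 0 → w = 0) ∧ (D.h k ≠ m → w = 0) ∧ (D.h k = m → (-1 : A) ^ m • δ w = f k) := by
      intro k
      by_cases h : D.h k = m ∧ f k ≠ 0
      · obtain ⟨w, hw, hw'⟩ := hac _ _ _ (hf k) (hz k h.1)
        rw [show n - (D.h k : ℤ) + 1 = n + 1 - D.h k by omega] at hw
        refine ⟨(-1 : A) ^ m • w, ?_, fun h' => absurd h' h.2, fun h' => absurd h.1 h', ?_⟩
        · rcases neg_one_pow_eq_or A m with h | h <;> rw [h] <;> simpa using hw
        · intro _
          rw [map_smul, smul_smul, ← mul_pow, hw']; simp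
      · refine ⟨0, zero_mem _, fun _ => rfl, fun _ => rfl, fun h' => ?_⟩
        have : f k = 0 := by by_contra h0; exact h ⟨h', h0⟩
        simp [this]
    choose w hw hw0 hwm hwd using this
    -- `g` is concentrated in degree `m` of `D`. Subtracting its total boundary clears that degree
    -- of `f` and alters only lower ones.
    let g : D.κ →₀ Z := Finsupp.onFinset f.support w fun k hk =>
      Finsupp.mem_support_iff.2 fun h => hk (hw0 k h)
    have hg : g ∈ D.totPart 𝒵 (n + 1) e := hw
    have hgt := tot_mem_totPart hs hδ hg
    rw [add_sub_cancel_right] at hgt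
    obtain ⟨g', hg', hgd'⟩ := ih (sub_mem hf hgt) (by rw [map_sub, hd, tot_tot D hδδ, sub_zero])
      (by
        intro k hk
        by_contra hlt
        refine hk ?_
        rw [Finsupp.sub_apply, tot_apply, d_apply, Finsupp.sum, Finset.sum_eq_zero fun l hl => ?_]
        · change f k - (0 + (-1 : A) ^ D.h k • δ (w k)) = 0
          by_cases h : D.h k = m
          · rw [h, hwd k h]; simp
          · rw [hwm k h]
            have : f k = 0 := by
              by_contra h0
              have := hm k h0
              omega
            simp [this]
        · change D.bd l k • w l = 0
          by_cases h0 : D.bd l k = 0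
          · simp [h0]
          · have := D.bd_h l k h0
            rw [hwm l (by omega), smul_zero])
    exact ⟨g + g', add_mem hg hg', by rw [map_add, hgd']; abel⟩

/-! #### Resolutions -/

variable {N : Type*} [AddCommGroup N] [Module A N]

/-- `D` with the augmentation `ε` is a graded free resolution of `N`, in the sense that all
homogeneous strands are exact. -/
structure Resolves (D : FreeCpx.{u} 𝒜) (𝒩 : G → AddSubgroup N) (ε : (D.κ →₀ A) →ₗ[A] N) :
    Prop where
  one_mem : (1 : A) ∈ 𝒜 0
  mul_mem : HomogeneousSMul 𝒜 𝒜
  smul_mem : HomogeneousSMul 𝒜 𝒩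
  ε_zero : ∀ k a, D.h k ≠ 0 → ε (Finsupp.single k a) = 0
  ε_mem : ∀ e, ∀ x ∈ D.part 𝒜 0 e, ε x ∈ 𝒩 e
  ε_d : ∀ x, ε (D.d A x) = 0
  surj : ∀ e, ∀ y ∈ 𝒩 e, ∃ x ∈ D.part 𝒜 0 e, ε x = y
  exact_zero : ∀ e, ∀ x ∈ D.part 𝒜 0 e, ε x = 0 → ∃ y ∈ D.part 𝒜 1 e, D.d A y = x
  exact_pos : ∀ n : ℤ, 0 < n → ∀ e, D.HV 𝒜 n e

theorem Resolves.ε_part {D : FreeCpx.{u} 𝒜} {𝒩 : G → AddSubgroup N} {ε : (D.κ →₀ A) →ₗ[A] N}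
    (hD : D.Resolves 𝒩 ε) (hn : n ≠ 0) {x : D.κ →₀ A} (hx : x ∈ D.part 𝒜 n e) : ε x = 0 := by
  rw [← Finsupp.sum_single x, Finsupp.sum, map_sum]
  refine Finset.sum_eq_zero fun k hk => hD.ε_zero _ _ fun h => ?_
  exact (Finsupp.mem_support_iff.1 hk) ((hx k).2 (by rw [h]; exact_mod_cast hn.symm))

/-- The grading of the augmented complex `D → N`. -/
noncomputable def coneGrading (D : FreeCpx.{u} 𝒜) (𝒩 : G → AddSubgroup N) (n : ℤ) (e : G) :
    AddSubgroup ((D.κ →₀ A) × N) :=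
  (D.part 𝒜 n e).prod (if n = -1 then 𝒩 e else ⊥)

/-- The differential of the augmented complex `D → N`. -/
noncomputable def coneDiff (D : FreeCpx.{u} 𝒜) (ε : (D.κ →₀ A) →ₗ[A] N) :
    ((D.κ →₀ A) × N) →ₗ[A] ((D.κ →₀ A) × N) :=
  (D.d A ∘ₗ LinearMap.fst A _ _).prod (ε ∘ₗ LinearMap.fst A _ _)

theorem mem_coneGrading {D : FreeCpx.{u} 𝒜} {𝒩 : G → AddSubgroup N} {z : (D.κ →₀ A) × N} :
    z ∈ coneGrading D 𝒩 n e ↔ z.1 ∈ D.part 𝒜 n e ∧ z.2 ∈ 𝒩 e ∧ (n ≠ -1 → z.2 = 0) := by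
  unfold coneGrading
  rw [AddSubgroup.mem_prod]
  split_ifs with h
  · simp [h]
  · simp only [AddSubgroup.mem_bot]
    constructor
    · rintro ⟨h1, h2⟩; exact ⟨h1, by rw [h2]; exact zero_mem _, fun _ => h2⟩
    · rintro ⟨h1, _, h2⟩; exact ⟨h1, h2 h⟩

theorem smul_mem_part {𝒵 : G → AddSubgroup Z} (hs : HomogeneousSMul 𝒜 𝒵) :
    HomogeneousSMul 𝒜 (D.part 𝒵 n) := by
  intro g e a f ha hf k
  refine ⟨?_, fun h => by simp [(hf k).2 h]⟩
  have := hs ha (hf k).1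
  rwa [← add_sub_assoc] at this

/-- With `N` placed in homological degree `-1`, the augmented complex `E → N` is acyclic because `E`
resolves `N`, and tensoring with `D` preserves this by `tot_acyclic`. Comparisons between `D ⊗ E`
and `D ⊗ N` all come from here. -/
theorem Resolves.cone_acyclic {E : FreeCpx.{u} 𝒜} {𝒩 : G → AddSubgroup N}
    {ε : (E.κ →₀ A) →ₗ[A] N} (hE : E.Resolves 𝒩 ε) (D : FreeCpx.{u'} 𝒜)
    {f : D.κ →₀ ((E.κ →₀ A) × N)} (hf : f ∈ D.totPart (coneGrading E 𝒩) n e)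
    (hd : D.tot (coneDiff E ε) f = 0) :
    ∃ g ∈ D.totPart (coneGrading E 𝒩) (n + 1) e, D.tot (coneDiff E ε) g = f := by
  refine tot_acyclic ?_ ?_ ?_ ?_ hf hd
  · intro m g e a z ha hz
    rw [mem_coneGrading] at hz ⊢
    exact ⟨smul_mem_part hE.mul_mem ha hz.1, hE.smul_mem ha hz.2.1,
      fun h => by simp [hz.2.2 h]⟩
  · intro m e z hz
    rw [mem_coneGrading] at hz ⊢
    refine ⟨d_mem_part hE.mul_mem hz.1, ?_, fun h => hE.ε_part (by omega) hz.1⟩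
    by_cases hm : m = 0
    · subst hm; exact hE.ε_mem _ _ hz.1
    · change ε z.1 ∈ _
      rw [hE.ε_part hm hz.1]; exact zero_mem _
  · refine LinearMap.ext fun z => Prod.ext (d_d E _) (hE.ε_d _)
  · intro m e z hz hz0
    rw [mem_coneGrading] at hz
    have h1 : E.d A z.1 = 0 := congrArg Prod.fst hz0
    have h2 : ε z.1 = 0 := congrArg Prod.snd hz0
    suffices h : ∃ w ∈ E.part 𝒜 (m + 1) e, E.d A w = z.1 ∧ ε w = z.2 by
      obtain ⟨w, hw, hw1, hw2⟩ := h
      exact ⟨(w, 0), mem_coneGrading.2 ⟨hw, zero_mem _, fun _ => rfl⟩, Prod.ext hw1 hw2⟩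
    rcases lt_trichotomy m 0 with hm | hm | hm
    · have hz1 := eq_zero_of_mem_part hm hz.1
      by_cases hm1 : m = -1
      · obtain ⟨w, hw, hw'⟩ := hE.surj e z.2 hz.2.1
        refine ⟨w, by rwa [hm1], ?_, hw'⟩
        rw [hz1]
        exact eq_zero_of_mem_part (by omega) (d_mem_part hE.mul_mem hw)
      · exact ⟨0, zero_mem _, by rw [hz1, map_zero], by rw [hz.2.2 hm1, map_zero]⟩
    · subst hm
      obtain ⟨w, hw, hw'⟩ := hE.exact_zero e z.1 hz.1 h2
      exact ⟨w, hw, hw', by rw [hE.ε_part one_ne_zero hw, hz.2.2 (by omega)]⟩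
    · obtain ⟨w, hw, hw'⟩ := hE.exact_pos m hm e z.1 hz.1 h1
      exact ⟨w, hw, hw', by rw [hE.ε_part (by omega) hw, hz.2.2 (by omega)]⟩

end FreeCpx

end TotalComplexes

/-! ### Balancing `Tor` -/

section Balance

set_option linter.unusedSectionVars false

universe u u' v

namespace FreeCpx

variable {A : Type v} [CommRing A] {G : Type*} [AddCommGroup G] {𝒜 : G → AddSubgroup A}
  {D : FreeCpx.{u} 𝒜} {E : FreeCpx.{u'} 𝒜}
  {N : Type*} [AddCommGroup N] [Module A N] {𝒩 : G → AddSubgroup N}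
  {N' : Type*} [AddCommGroup N'] [Module A N'] {𝒩' : G → AddSubgroup N'}
  {ε : (E.κ →₀ A) →ₗ[A] N} {n : ℤ} {e : G}

theorem fst_tot (F : D.κ →₀ ((E.κ →₀ A) × N)) :
    Finsupp.mapRange.linearMap (LinearMap.fst A _ _) (D.tot (coneDiff E ε) F) =
      D.tot (E.d A) (Finsupp.mapRange.linearMap (LinearMap.fst A _ _) F) := by
  rw [tot, tot, LinearMap.add_apply, LinearMap.add_apply, map_add, d_mapRange, mapRange_sgn,
    sgn_mapRange]
  rfl

theorem snd_tot (F : D.κ →₀ ((E.κ →₀ A) × N)) :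
    Finsupp.mapRange.linearMap (LinearMap.snd A _ _) (D.tot (coneDiff E ε) F) =
      D.d N (Finsupp.mapRange.linearMap (LinearMap.snd A _ _) F) +
        D.sgn ε (Finsupp.mapRange.linearMap (LinearMap.fst A _ _) F) := by
  rw [tot, LinearMap.add_apply, map_add, d_mapRange, mapRange_sgn, sgn_mapRange]
  rfl

theorem ext_fst_snd {κ Y Y' : Type*} [AddCommGroup Y] [Module A Y] [AddCommGroup Y'] [Module A Y']
    {F F' : κ →₀ (Y × Y')}
    (h1 : Finsupp.mapRange.linearMap (LinearMap.fst A Y Y') F =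
      Finsupp.mapRange.linearMap (LinearMap.fst A Y Y') F')
    (h2 : Finsupp.mapRange.linearMap (LinearMap.snd A Y Y') F =
      Finsupp.mapRange.linearMap (LinearMap.snd A Y Y') F') : F = F' := by
  refine Finsupp.ext fun k => Prod.ext ?_ ?_
  · simpa using DFunLike.congr_fun h1 k
  · simpa using DFunLike.congr_fun h2 k

theorem Resolves.sgn_mem (hE : E.Resolves 𝒩 ε) {x : D.κ →₀ (E.κ →₀ A)}
    (hx : x ∈ D.totPart (E.part 𝒜) n e) : D.sgn ε x ∈ D.part 𝒩 n e := by
  intro k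
  rw [sgn_apply]
  by_cases h : (D.h k : ℤ) = n
  · refine ⟨?_, fun h' => absurd h h'⟩
    have h1 := hx k
    rw [h, sub_self] at h1
    have := hE.ε_mem _ _ h1
    rcases neg_one_pow_eq_or A (D.h k) with h | h <;> rw [h] <;> simpa using this
  · rw [hE.ε_part (sub_ne_zero.2 (Ne.symm h)) (hx k)]
    exact ⟨by simp, fun _ => by simp⟩

/-- Cycles of `D ⊗ N` lift to `D ⊗ E` if `E` resolves `N`. -/
theorem Resolves.lift_cycle (hE : E.Resolves 𝒩 ε) {f : D.κ →₀ N} (hf : f ∈ D.part 𝒩 n e)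
    (hd : D.d N f = 0) :
    ∃ x ∈ D.totPart (E.part 𝒜) n e, D.tot (E.d A) x = 0 ∧
      ∃ y ∈ D.part 𝒩 (n + 1) e, f = D.d N y + D.sgn ε x := by
  -- Since `N` sits in degree `-1` of the augmented complex, a cycle of degree `n` in `D ⊗ N` has
  -- total degree `n - 1`. The two components of a preimage are the lift `x` and the correction `y`.
  obtain ⟨g, hg, hgd⟩ := hE.cone_acyclic D (n := n - 1) (e := e)
    (f := Finsupp.mapRange.linearMap (LinearMap.inr A _ _) f)
    (by
      intro k
      rw [mem_coneGrading]
      refine ⟨?_, ?_, fun h => ?_⟩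
      · simp
      · simpa using (hf k).1
      · simpa using (hf k).2 (by omega))
    (by
      refine ext_fst_snd (A := A) ?_ ?_
      · rw [fst_tot]
        have : Finsupp.mapRange.linearMap (LinearMap.fst A (E.κ →₀ A) N)
            (Finsupp.mapRange.linearMap (LinearMap.inr A _ _) f) = 0 := by ext; simp
        rw [this, map_zero, map_zero]
      · rw [snd_tot]
        have h1 : Finsupp.mapRange.linearMap (LinearMap.fst A (E.κ →₀ A) N)
            (Finsupp.mapRange.linearMap (LinearMap.inr A _ _) f) = 0 := by ext; simp
        have h2 : Finsupp.mapRange.linearMap (LinearMap.snd A (E.κ →₀ A) N)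
            (Finsupp.mapRange.linearMap (LinearMap.inr A _ _) f) = f := by ext; simp
        rw [h1, h2, hd, map_zero, map_zero, add_zero])
  rw [sub_add_cancel] at hg
  refine ⟨Finsupp.mapRange.linearMap (LinearMap.fst A _ _) g, fun k => ?_, ?_,
    Finsupp.mapRange.linearMap (LinearMap.snd A _ _) g, fun k => ⟨?_, fun h => ?_⟩, ?_⟩
  · simpa using (mem_coneGrading.1 (hg k)).1
  · rw [← fst_tot, hgd]; ext; simp
  · simpa using (mem_coneGrading.1 (hg k)).2.1
  · simpa using (mem_coneGrading.1 (hg k)).2.2 (by omega)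
  · rw [← snd_tot, hgd]; ext; simp

/-- A cycle of `D ⊗ E` which becomes a boundary in `D ⊗ N` is a boundary if `E` resolves `N`. -/
theorem Resolves.boundary_of_boundary (hE : E.Resolves 𝒩 ε) {x : D.κ →₀ (E.κ →₀ A)}
    (hx : x ∈ D.totPart (E.part 𝒜) n e) (hd : D.tot (E.d A) x = 0)
    {y : D.κ →₀ N} (hy : y ∈ D.part 𝒩 (n + 1) e) (hyx : D.d N y = D.sgn ε x) :
    ∃ z ∈ D.totPart (E.part 𝒜) (n + 1) e, D.tot (E.d A) z = x := by
  -- The relation between `x` and `y` says exactly that the pair `(x, -y)` is a cycle for the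
  -- augmented complex.
  set F : D.κ →₀ ((E.κ →₀ A) × N) := Finsupp.mapRange.linearMap (LinearMap.inl A _ _) x -
    Finsupp.mapRange.linearMap (LinearMap.inr A _ _) y with hF
  have h1 : Finsupp.mapRange.linearMap (LinearMap.fst A (E.κ →₀ A) N) F = x := by
    refine Finsupp.ext fun k => ?_
    simp [hF]
  have h2 : Finsupp.mapRange.linearMap (LinearMap.snd A (E.κ →₀ A) N) F = -y := by
    refine Finsupp.ext fun k => ?_
    simp [hF]
  have hFk : ∀ k, F k = (x k, - y k) := fun k => by simp [hF]
  obtain ⟨g, hg, hgd⟩ := hE.cone_acyclic D (n := n) (e := e) (f := F)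
    (by
      intro k
      rw [mem_coneGrading, hFk]
      exact ⟨hx k, neg_mem (hy k).1, fun h => by simp [(hy k).2 (by omega)]⟩)
    (by
      refine ext_fst_snd (A := A) ?_ ?_
      · rw [fst_tot, h1, hd, map_zero]
      · rw [snd_tot, h1, h2, map_neg, hyx, map_zero]; abel)
  refine ⟨Finsupp.mapRange.linearMap (LinearMap.fst A _ _) g, fun k => ?_, ?_⟩
  · simpa using (mem_coneGrading.1 (hg k)).1
  · rw [← fst_tot, hgd, h1]

variable (D E) in
/-- The isomorphism `D ⊗ E ≅ E ⊗ D`. -/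
noncomputable def swap : (D.κ →₀ (E.κ →₀ A)) →ₗ[A] (E.κ →₀ (D.κ →₀ A)) :=
  Finsupp.lsum A fun k => Finsupp.lsum A fun l =>
    -- The Koszul sign is what makes the exchange of factors commute with the total differentials.
    (-1 : A) ^ (D.h k * E.h l) • (Finsupp.lsingle l ∘ₗ Finsupp.lsingle k)

theorem swap_single (k : D.κ) (l : E.κ) (a : A) :
    swap D E (Finsupp.single k (Finsupp.single l a)) =
      Finsupp.single l (Finsupp.single k ((-1 : A) ^ (D.h k * E.h l) * a)) := by
  rw [swap, Finsupp.lsum_single, Finsupp.lsum_single]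
  simp

theorem lhom_ext₂ {κ κ' Y : Type*} [AddCommMonoid Y] [Module A Y]
    {φ ψ : (κ →₀ (κ' →₀ A)) →ₗ[A] Y}
    (h : ∀ k l a, φ (Finsupp.single k (Finsupp.single l a)) =
      ψ (Finsupp.single k (Finsupp.single l a))) : φ = ψ :=
  Finsupp.lhom_ext' fun k => Finsupp.lhom_ext' fun l => LinearMap.ext fun a => h k l a

theorem swap_apply (x : D.κ →₀ (E.κ →₀ A)) (k : D.κ) (l : E.κ) :
    swap D E x l k = (-1 : A) ^ (D.h k * E.h l) * x k l := by
  suffices h : Finsupp.lapply k ∘ₗ Finsupp.lapply l ∘ₗ swap D E =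
      (-1 : A) ^ (D.h k * E.h l) • (Finsupp.lapply l ∘ₗ Finsupp.lapply k) from
    LinearMap.congr_fun h x
  refine lhom_ext₂ fun k' l' a => ?_
  classical
  simp only [LinearMap.comp_apply, swap_single, Finsupp.lapply_apply, LinearMap.smul_apply,
    smul_eq_mul, Finsupp.single_apply]
  by_cases hl : l' = l <;> by_cases hk : k' = k <;> simp [hl, hk]

theorem swap_swap (x : D.κ →₀ (E.κ →₀ A)) : swap E D (swap D E x) = x := by
  ext k l
  rw [swap_apply, swap_apply, ← mul_assoc, mul_comm (E.h l), ← mul_pow]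
  simp

theorem swap_mem {x : D.κ →₀ (E.κ →₀ A)} (hx : x ∈ D.totPart (E.part 𝒜) n e) :
    swap D E x ∈ E.totPart (D.part 𝒜) n e := by
  intro l k
  rw [swap_apply]
  have := hx k l
  refine ⟨?_, fun h => by rw [this.2 (by omega), mul_zero]⟩
  have h1 := this.1
  rw [sub_right_comm] at h1
  rcases neg_one_pow_eq_or A (D.h k * E.h l) with h | h <;> rw [h] <;> simpa using h1

theorem swap_tot (x : D.κ →₀ (E.κ →₀ A)) :
    swap D E (D.tot (E.d A) x) = E.tot (D.d A) (swap D E x) := by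
  suffices h : swap D E ∘ₗ D.tot (E.d A) = E.tot (D.d A) ∘ₗ swap D E from
    LinearMap.congr_fun h x
  apply lhom_ext₂
  intro k l a
  classical
  simp only [LinearMap.comp_apply, swap_single]
  ext l' k'
  have key (b : A) : D.d A (Finsupp.single l (Finsupp.single k b) l') k' =
      if l = l' then D.bd k k' * b else 0 := by
    split_ifs with h
    · subst h; simp [d_single]
    · simp [Finsupp.single_eq_of_ne' h]
  have key' (b : A) : E.d A (Finsupp.single k (Finsupp.single l b) k') l' =
      if k = k' then E.bd l l' * b else 0 := by
    split_ifs with h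
    · subst h; simp [d_single]
    · simp [Finsupp.single_eq_of_ne' h]
  simp only [swap_apply, tot_apply, d_single, vecSMul_apply, Finsupp.add_apply,
    Finsupp.smul_apply, smul_eq_mul, key, key']
  simp only [Finsupp.single_apply]
  by_cases hk : k = k' <;> by_cases hl : l = l'
  · subst hk; subst hl
    by_cases h1 : D.bd k k = 0
    · by_cases h2 : E.bd l l = 0
      · simp [h1, h2]
      · have := E.bd_h _ _ h2; omega
    · have := D.bd_h _ _ h1; omega
  · subst hk
    by_cases h2 : E.bd l l' = 0
    · simp [h2, hl]
    · rw [E.bd_h _ _ h2]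
      simp only [hl, if_false, if_true, mul_add, pow_add]
      ring_nf
  · subst hl
    by_cases h2 : D.bd k k' = 0
    · simp [h2, hk]
    · rw [D.bd_h _ _ h2]
      simp only [hk, if_false, if_true, add_mul, pow_add]
      have hs : ((-1 : A) ^ E.h l) ^ 2 = 1 := by rw [← pow_mul, mul_comm, pow_mul]; simp
      ring_nf
      simp [pow_mul, hs]
  · simp [hk, hl]

/-- `Tor` is balanced: the homology of `E ⊗ N'` vanishes if that of `P ⊗ N` does, where
`E` resolves `N` and `P` resolves `N'`. -/
theorem Resolves.balance (hE : E.Resolves 𝒩 ε) {ε' : (D.κ →₀ A) →ₗ[A] N'}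
    (hD : D.Resolves 𝒩' ε') (h : D.HV 𝒩 n e) : E.HV 𝒩' n e := by
  intro f hf hd
  -- The cycle of `E ⊗ N'` is lifted to `E ⊗ D`, swapped into `D ⊗ E` and pushed down to `D ⊗ N`,
  -- where it bounds by hypothesis. The bounding element then travels back the same way.
  obtain ⟨x, hx, hxd, y, hy, rfl⟩ := hD.lift_cycle hf hd
  have hx' := swap_mem hx
  have hxd' : D.tot (E.d A) (swap E D x) = 0 := by rw [← swap_tot, hxd, map_zero]
  obtain ⟨u, hu, hud⟩ := h _ (hE.sgn_mem hx') (by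
    have h1 : D.d _ (swap E D x) = - D.sgn (E.d A) (swap E D x) := by
      rw [tot, LinearMap.add_apply] at hxd'
      exact eq_neg_of_add_eq_zero_left hxd'
    rw [d_sgn, h1, map_neg, neg_neg]
    ext k
    simp [hE.ε_d])
  obtain ⟨z, hz, rfl⟩ : ∃ z ∈ E.totPart (D.part 𝒜) (n + 1) e, E.tot (D.d A) z = x := by
    obtain ⟨z, hz, hzx⟩ := hE.boundary_of_boundary hx' hxd' hu hud
    exact ⟨swap D E z, swap_mem hz, by rw [← swap_tot, hzx, swap_swap]⟩
  refine ⟨y - E.sgn ε' z, sub_mem hy (hD.sgn_mem hz), ?_⟩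
  have h2 : E.sgn ε' (E.sgn (D.d A) z) = 0 := by ext k; simp [hD.ε_d]
  rw [map_sub, d_sgn, tot, LinearMap.add_apply, map_add, h2]
  abel

end FreeCpx

end Balance

/-! ### Residue modules, tensor products of complexes, base change -/

section Constructions

set_option linter.unusedSectionVars false

universe u u' v

/-- The residue module `A / 𝔪`, concentrated in degree `0`. -/
def residueFamily {A G : Type*} [CommRing A] [AddCommGroup G] (𝔪 : Ideal A) (e : G) :
    AddSubgroup (A ⧸ 𝔪) where
  carrier := {x | e ≠ 0 → x = 0}
  add_mem' hx hy h := by rw [hx h, hy h, add_zero]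
  zero_mem' _ := rfl
  neg_mem' hx h := by rw [hx h, neg_zero]

theorem mem_residueFamily {A G : Type*} [CommRing A] [AddCommGroup G] {𝔪 : Ideal A} {e : G}
    {x : A ⧸ 𝔪} : x ∈ residueFamily 𝔪 e ↔ (e ≠ 0 → x = 0) := Iff.rfl

/-- `𝔪` contains everything of nonzero degree, nothing nonzero of degree zero, and
`A = A₀ + 𝔪`. -/
structure IsResidueIdeal {A G : Type*} [CommRing A] [AddCommGroup G] (𝒜 : G → AddSubgroup A)
    (𝔪 : Ideal A) : Prop where
  one_mem : (1 : A) ∈ 𝒜 0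
  mul_mem : HomogeneousSMul 𝒜 𝒜
  mem : ∀ g, g ≠ 0 → ∀ a ∈ 𝒜 g, a ∈ 𝔪
  zero : ∀ a ∈ 𝒜 0, a ∈ 𝔪 → a = 0
  surj : ∀ y : A ⧸ 𝔪, ∃ a ∈ 𝒜 0, Ideal.Quotient.mk 𝔪 a = y

theorem IsResidueIdeal.smul_mem {A G : Type*} [CommRing A] [AddCommGroup G]
    {𝒜 : G → AddSubgroup A} {𝔪 : Ideal A} (h : IsResidueIdeal 𝒜 𝔪) :
    HomogeneousSMul 𝒜 (residueFamily 𝔪 : G → AddSubgroup (A ⧸ 𝔪)) := by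
  intro g e a z ha hz hge
  by_cases he : e = 0
  · subst he
    obtain ⟨z, rfl⟩ := Ideal.Quotient.mk_surjective z
    rw [Algebra.smul_def]
    change Ideal.Quotient.mk 𝔪 a * _ = 0
    rw [Ideal.Quotient.eq_zero_iff_mem.2 (h.mem g (by simpa using hge) a ha), zero_mul]
  · rw [hz he, smul_zero]

namespace FreeCpx

section Tensor

variable {A : Type v} [CommRing A] {G : Type*} [AddCommGroup G] {𝒜 : G → AddSubgroup A}
  (D : FreeCpx.{u} 𝒜) (E : FreeCpx.{u'} 𝒜)

/-- The differential of `D ⊗ E` as an endomorphism of the free module on the product basis. -/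
noncomputable def tensorEnd : (D.κ × E.κ →₀ A) →ₗ[A] (D.κ × E.κ →₀ A) :=
  (Finsupp.curryLinearEquiv A).symm.toLinearMap ∘ₗ D.tot (E.d A) ∘ₗ
    (Finsupp.curryLinearEquiv A).toLinearMap

theorem curry_tensorEnd (f : D.κ × E.κ →₀ A) :
    Finsupp.curryLinearEquiv A (tensorEnd D E f) =
      D.tot (E.d A) (Finsupp.curryLinearEquiv A f) := by
  simp [tensorEnd]

theorem tensorEnd_apply (f : D.κ × E.κ →₀ A) (l : D.κ) (k : E.κ) :
    tensorEnd D E f (l, k) = D.tot (E.d A) (Finsupp.curryLinearEquiv A f) l k := by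
  rw [← curry_tensorEnd]; rfl

theorem curry_single (l : D.κ) (k : E.κ) (a : A) :
    Finsupp.curryLinearEquiv A (Finsupp.single (l, k) a) =
      Finsupp.single l (Finsupp.single k a) := by
  simp

open Classical in
theorem tensorEnd_single_apply (p q : D.κ × E.κ) :
    tensorEnd D E (Finsupp.single p 1) q = (if p.2 = q.2 then D.bd p.1 q.1 else 0) +
      (if p.1 = q.1 then (-1) ^ D.h p.1 * E.bd p.2 q.2 else 0) := by
  obtain ⟨l, k⟩ := p
  obtain ⟨l', k'⟩ := q
  rw [tensorEnd_apply, curry_single, tot_apply, d_single]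
  simp only [vecSMul_apply, Finsupp.add_apply, Finsupp.smul_apply, smul_eq_mul]
  congr 1
  · simp [Finsupp.single_apply]
  · by_cases h : l = l'
    · subst h; simp [d_single]
    · simp [h, Finsupp.single_eq_of_ne' h]

/-- The tensor product of two complexes of graded free modules. -/
@[reducible] noncomputable def tensor (h0 : HomogeneousSMul 𝒜 𝒜) (h1 : (1 : A) ∈ 𝒜 0) :
    FreeCpx.{max u u'} 𝒜 where
  κ := D.κ × E.κ
  h p := D.h p.1 + E.h p.2
  deg p := D.deg p.1 + E.deg p.2
  bd p := tensorEnd D E (Finsupp.single p 1)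
  bd_mem p q := by
    classical
    rw [tensorEnd_single_apply]
    refine add_mem ?_ ?_ <;> split_ifs with h
    · rw [h, add_sub_add_right_eq_sub]; exact D.bd_mem _ _
    · exact zero_mem _
    · have := E.bd_mem p.2 q.2
      rw [h, add_sub_add_left_eq_sub]
      rcases neg_one_pow_eq_or A (D.h q.1) with h | h <;> rw [h] <;> simpa using this
    · exact zero_mem _
  bd_h p q hpq := by
    classical
    rw [tensorEnd_single_apply] at hpq
    by_cases h1 : p.2 = q.2 ∧ D.bd p.1 q.1 ≠ 0
    · rw [h1.1, D.bd_h _ _ h1.2]; omega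
    by_cases h2 : p.1 = q.1 ∧ E.bd p.2 q.2 ≠ 0
    · rw [h2.1, E.bd_h _ _ h2.2]; omega
    exfalso
    apply hpq
    split_ifs with h3 h4 h4
    · have e1 : D.bd p.1 q.1 = 0 := by by_contra h; exact h1 ⟨h3, h⟩
      have e2 : E.bd p.2 q.2 = 0 := by by_contra h; exact h2 ⟨h4, h⟩
      simp [e1, e2]
    · have e1 : D.bd p.1 q.1 = 0 := by by_contra h; exact h1 ⟨h3, h⟩
      simp [e1]
    · have e2 : E.bd p.2 q.2 = 0 := by by_contra h; exact h2 ⟨h4, h⟩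
      simp [e2]
    · simp
  bd_bd p := by
    have h2 : ∀ f, f.sum (fun l a => a • tensorEnd D E (Finsupp.single l 1)) =
        tensorEnd D E f := fun f => by
      conv_rhs => rw [← Finsupp.sum_single f, Finsupp.sum, map_sum]
      refine Finset.sum_congr rfl fun l _ => ?_
      simp only [← map_smul, Finsupp.smul_single, smul_eq_mul, mul_one]
    rw [h2]
    apply (Finsupp.curryLinearEquiv A).injective
    rw [curry_tensorEnd, curry_tensorEnd, map_zero]
    exact tot_tot D (LinearMap.ext fun x => d_d E x) _

variable {D E} (h0 : HomogeneousSMul 𝒜 𝒜) (h1 : (1 : A) ∈ 𝒜 0)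

theorem tensor_d (f : D.κ × E.κ →₀ A) : (D.tensor E h0 h1).d A f = tensorEnd D E f := by
  suffices h : (D.tensor E h0 h1).d A = tensorEnd D E from LinearMap.congr_fun h f
  refine Finsupp.lhom_ext' fun p => LinearMap.ext_ring ?_
  simp only [LinearMap.comp_apply, Finsupp.lsingle_apply]
  refine Eq.trans (d_single (D.tensor E h0 h1) p (1 : A)) ?_
  ext q
  rw [vecSMul_apply, smul_eq_mul, mul_one]

theorem mem_tensor_part {n : ℤ} {e : G} {f : D.κ × E.κ →₀ A} :
    f ∈ (D.tensor E h0 h1).part 𝒜 n e ↔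
      Finsupp.curryLinearEquiv A f ∈ D.totPart (E.part 𝒜) n e := by
  constructor
  · intro hf l k
    have := hf (l, k)
    refine ⟨?_, fun h => ?_⟩
    · rw [sub_sub]; exact this.1
    · refine this.2 fun h' => h ?_
      have h2 : ((D.h l + E.h k : ℕ) : ℤ) = n := h'
      push_cast at h2
      omega
  · rintro hf ⟨l, k⟩
    have := hf l k
    refine ⟨?_, fun h => ?_⟩
    · have h2 := this.1
      rw [sub_sub] at h2; exact h2
    · refine this.2 fun h' => h ?_
      change ((D.h l + E.h k : ℕ) : ℤ) = n
      push_cast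
      omega

variable {N : Type*} [AddCommGroup N] [Module A N] {𝒩 : G → AddSubgroup N}
  {ε : (E.κ →₀ A) →ₗ[A] N}

theorem Resolves.tensor_boundary (hE : E.Resolves 𝒩 ε) {n : ℤ} {e : G} {x : D.κ × E.κ →₀ A}
    (hx : x ∈ (D.tensor E h0 h1).part 𝒜 n e) (hd : (D.tensor E h0 h1).d A x = 0)
    {y : D.κ →₀ N} (hy : y ∈ D.part 𝒩 (n + 1) e)
    (hyx : D.d N y = D.sgn ε (Finsupp.curryLinearEquiv A x)) :
    ∃ z ∈ (D.tensor E h0 h1).part 𝒜 (n + 1) e, (D.tensor E h0 h1).d A z = x := by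
  rw [mem_tensor_part] at hx
  rw [tensor_d] at hd
  obtain ⟨z, hz, hzx⟩ := hE.boundary_of_boundary hx (by rw [← curry_tensorEnd, hd, map_zero])
    hy hyx
  refine ⟨(Finsupp.curryLinearEquiv A).symm z, ?_, ?_⟩
  · rw [mem_tensor_part]; simpa using hz
  · rw [tensor_d]
    apply (Finsupp.curryLinearEquiv A).injective
    rw [curry_tensorEnd]; simpa using hzx

/-- If `E` resolves `N` and the homology of `D ⊗ N` is the residue module, then `D ⊗ E` resolves
the residue module. -/
theorem Resolves.tensor_resolves {𝔪 : Ideal A} (h𝔪 : IsResidueIdeal 𝒜 𝔪) (hE : E.Resolves 𝒩 ε)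
    {l₀ : D.κ} {k₀ : E.κ} (hl₀ : D.h l₀ = 0) (hl₀' : D.deg l₀ = 0)
    (hl : ∀ l, D.h l = 0 → l = l₀) (hk₀ : E.h k₀ = 0) (hk₀' : E.deg k₀ = 0)
    (hk : ∀ k, E.h k = 0 → k = k₀) (hD𝔪 : ∀ l, D.bd l l₀ ∈ 𝔪) (hE𝔪 : ∀ k, E.bd k k₀ ∈ 𝔪)
    (hD : ∀ n e, n ≠ 0 ∨ e ≠ 0 → D.HV 𝒩 n e) :
    (D.tensor E h0 h1).Resolves (residueFamily 𝔪)
      ((Submodule.mkQ 𝔪) ∘ₗ (Finsupp.lapply (l₀, k₀) : (D.κ × E.κ →₀ A) →ₗ[A] A)) := by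
  classical
  let X := D.tensor E h0 h1
  have hbd : ∀ p : D.κ × E.κ, X.bd p (l₀, k₀) ∈ 𝔪 := fun p => by
    change tensorEnd D E (Finsupp.single p 1) (l₀, k₀) ∈ 𝔪
    rw [tensorEnd_single_apply]
    refine add_mem ?_ ?_ <;> split_ifs
    · exact hD𝔪 _
    · exact zero_mem _
    · exact 𝔪.mul_mem_left _ (hE𝔪 _)
    · exact zero_mem _
  have hε : ∀ x : D.κ × E.κ →₀ A, ((Submodule.mkQ 𝔪) ∘ₗ
      (Finsupp.lapply (l₀, k₀) : (D.κ × E.κ →₀ A) →ₗ[A] A)) x =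
        Ideal.Quotient.mk 𝔪 (x (l₀, k₀)) := fun x => rfl
  have hdeg : X.deg (l₀, k₀) = 0 := by
    change D.deg l₀ + E.deg k₀ = 0
    rw [hl₀', hk₀', add_zero]
  -- Cycles of `D ⊗ E` map to cycles of `D ⊗ N`, because `ε` kills the boundaries of `E`.
  have hcyc : ∀ n e x, x ∈ X.part 𝒜 n e → X.d A x = 0 →
      D.d N (D.sgn ε (Finsupp.curryLinearEquiv A x)) = 0 := by
    intro n e x hx hd
    have h2 : D.tot (E.d A) (Finsupp.curryLinearEquiv A x) = 0 := by
      rw [← curry_tensorEnd, ← tensor_d h0 h1, hd, map_zero]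
    rw [tot, LinearMap.add_apply] at h2
    rw [d_sgn, eq_neg_of_add_eq_zero_left h2, map_neg, neg_neg]
    ext k
    simp [hE.ε_d]
  refine ⟨h1, h0, h𝔪.smul_mem, ?_, ?_, ?_, ?_, ?_, ?_⟩
  · rintro ⟨l, k⟩ a hlk
    rw [hε, Finsupp.single_apply, if_neg, map_zero]
    rintro ⟨⟩
    apply hlk
    change D.h l₀ + E.h k₀ = 0
    rw [hl₀, hk₀]
  · intro e x hx he
    rw [hε, Ideal.Quotient.eq_zero_iff_mem]
    have := (hx (l₀, k₀)).1
    rw [hdeg, sub_zero] at this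
    exact h𝔪.mem e he _ this
  · intro x
    rw [hε, Ideal.Quotient.eq_zero_iff_mem, d_apply]
    exact sum_mem fun p _ => 𝔪.mul_mem_right _ (hbd p)
  · intro e y hy
    by_cases he : e = 0
    · subst he
      obtain ⟨a, ha, rfl⟩ := h𝔪.surj y
      refine ⟨Finsupp.single (l₀, k₀) a, fun q => ?_, by simp [hε]⟩
      by_cases hq : (l₀, k₀) = q
      · subst hq
        rw [hdeg, sub_zero, Finsupp.single_eq_same]
        refine ⟨ha, fun h => absurd ?_ h⟩
        change ((D.h l₀ + E.h k₀ : ℕ) : ℤ) = 0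
        rw [hl₀, hk₀]; rfl
      · rw [Finsupp.single_eq_of_ne' hq]
        exact ⟨zero_mem _, fun _ => rfl⟩
    · exact ⟨0, zero_mem _, by rw [map_zero, hy he]⟩
  · intro e x hx hx0
    -- In homological degree 0 the only basis element is `(l₀, k₀)`. For `e = 0` its coefficient
    -- lies in `A₀ ∩ 𝔪 = 0`; for `e ≠ 0` the vanishing for `D ⊗ N` applies.
    by_cases he : e = 0
    · subst he
      refine hE.tensor_boundary h0 h1 hx ?_ (y := 0) (zero_mem _) ?_
      · exact eq_zero_of_mem_part (by omega) (d_mem_part h0 hx)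
      · rw [hε, Ideal.Quotient.eq_zero_iff_mem] at hx0
        have h2 := (hx (l₀, k₀)).1
        rw [hdeg, sub_zero] at h2
        have h3 := h𝔪.zero _ h2 hx0
        rw [map_zero]
        have h4 : x = 0 := by
          ext ⟨l, k⟩
          by_contra hne
          have h5 : D.h l + E.h k = 0 := by
            by_contra h; exact hne ((hx (l, k)).2 (by exact_mod_cast h))
          rw [hl l (by omega), hk k (by omega)] at hne
          exact hne h3
        rw [h4, map_zero, map_zero]
    · have h2 : X.d A x = 0 := eq_zero_of_mem_part (by omega) (d_mem_part h0 hx)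
      obtain ⟨y, hy, hyx⟩ := hD 0 e (Or.inr he) _ (hE.sgn_mem ((mem_tensor_part h0 h1).1 hx))
        (hcyc _ _ _ hx h2)
      exact hE.tensor_boundary h0 h1 hx h2 hy hyx
  · intro n hn e x hx hd
    obtain ⟨y, hy, hyx⟩ := hD n e (Or.inl hn.ne') _ (hE.sgn_mem ((mem_tensor_part h0 h1).1 hx))
      (hcyc _ _ _ hx hd)
    exact hE.tensor_boundary h0 h1 hx hd hy hyx

/-- Vanishing of the homology of `(D ⊗ E) ⊗ A/𝔪` implies vanishing for the direct summand
`E ⊗ A/𝔪`. -/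
theorem HV.of_tensor {𝔪 : Ideal A} {l₀ : D.κ} (hl₀ : D.h l₀ = 0) (hl₀' : D.deg l₀ = 0)
    (hD𝔪 : ∀ l, D.bd l l₀ ∈ 𝔪) {n : ℤ} {e : G}
    (H : (D.tensor E h0 h1).HV (residueFamily 𝔪) n e) : E.HV (residueFamily 𝔪) n e := by
  classical
  let X := D.tensor E h0 h1
  intro f hf hd
  have hbd0 : ∀ l, D.bd l₀ l = 0 := fun l => by
    by_contra h
    have := D.bd_h _ _ h
    omega
  have hinj : Function.Injective (fun k : E.κ => (l₀, k)) := fun a b h => (Prod.ext_iff.1 h).2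
  have hF : ∀ q, (Finsupp.mapDomain (fun k : E.κ => (l₀, k)) f) q =
      if q.1 = l₀ then f q.2 else 0 := by
    rintro ⟨l, k⟩
    split_ifs with h
    · simp only at h
      subst h; exact Finsupp.mapDomain_apply hinj f k
    · refine Finsupp.mapDomain_of_notMem_range _ _ ?_
      rintro ⟨k', hk'⟩
      exact h (Prod.ext_iff.1 hk').1.symm
  -- `E ⊗ A/𝔪` is embedded as the row of `l₀`. The coordinates of a preimage in this row suffice,
  -- since the entries of `D` into `l₀` lie in `𝔪` and act as zero on `A/𝔪`.
  obtain ⟨g, hg, hgd⟩ := H (Finsupp.mapDomain (fun k : E.κ => (l₀, k)) f)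
    (by
      intro q
      rw [hF]
      split_ifs with h
      · have := hf q.2
        have e1 : X.deg q = E.deg q.2 := by
          change D.deg q.1 + E.deg q.2 = _
          rw [h, hl₀', zero_add]
        have e2 : X.h q = E.h q.2 := by
          change D.h q.1 + E.h q.2 = _
          rw [h, hl₀, zero_add]
        rwa [e1, e2]
      · exact ⟨zero_mem _, fun _ => rfl⟩)
    (by
      ext q
      rw [d_apply, Finsupp.sum_mapDomain_index (fun _ => smul_zero _)
        (fun _ _ _ => smul_add _ _ _), Finsupp.coe_zero, Pi.zero_apply]
      by_cases h : l₀ = q.1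
      · have h2 := DFunLike.congr_fun hd q.2
        rw [d_apply] at h2
        simpa [tensorEnd_single_apply, hbd0, h.symm, ← h, hl₀] using h2
      · simp [tensorEnd_single_apply, hbd0, h])
  let g' : E.κ →₀ (A ⧸ 𝔪) := Finsupp.comapDomain (fun k : E.κ => (l₀, k)) g hinj.injOn
  have hg' : ∀ k, g' k = g (l₀, k) := fun k => rfl
  refine ⟨g', fun k => ?_, ?_⟩
  · have := hg (l₀, k)
    have e1 : X.deg (l₀, k) = E.deg k := by
      change D.deg l₀ + E.deg k = _
      rw [hl₀', zero_add]
    have e2 : X.h (l₀, k) = E.h k := by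
      change D.h l₀ + E.h k = _
      rw [hl₀, zero_add]
    rwa [e1, e2] at this
  · ext k
    have h2 := DFunLike.congr_fun hgd (l₀, k)
    rw [hF, if_pos rfl, d_apply] at h2
    rw [← h2, d_apply]
    have h3 : ∀ (p : D.κ × E.κ) (z : A ⧸ 𝔪),
        tensorEnd D E (Finsupp.single p 1) (l₀, k) • z =
        if l₀ = p.1 then E.bd p.2 k • z else 0 := by
      intro p z
      have h4 : (if p.2 = k then D.bd p.1 l₀ else 0) • z = 0 := by
        obtain ⟨z, rfl⟩ := Ideal.Quotient.mk_surjective z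
        rw [Algebra.smul_def]
        change Ideal.Quotient.mk 𝔪 _ * _ = 0
        rw [Ideal.Quotient.eq_zero_iff_mem.2, zero_mul]
        split_ifs
        · exact hD𝔪 _
        · exact zero_mem _
      rw [tensorEnd_single_apply, add_smul, h4, zero_add]
      by_cases h : l₀ = p.1
      · rw [if_pos h.symm, if_pos h, ← h, hl₀]; simp
      · rw [if_neg (Ne.symm h), if_neg h, zero_smul]
    simp only [h3]
    rw [Finsupp.sum, Finsupp.sum]
    rw [← Finset.sum_filter]
    refine Finset.sum_bij' (fun k _ => (l₀, k)) (fun p _ => p.2) ?_ ?_ ?_ ?_ ?_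
    · intro k' hk'
      simpa [hg'] using hk'
    · rintro ⟨l, k'⟩ hp
      simp only [Finset.mem_filter, Finsupp.mem_support_iff] at hp ⊢
      rw [hg', hp.2]; exact hp.1
    · intro k' _; rfl
    · rintro ⟨l, k'⟩ hp
      simp only [Finset.mem_filter] at hp
      rw [hp.2]
    · intro k' _; rfl

end Tensor

section BaseChange

variable {A : Type v} [CommRing A] {G : Type*} [AddCommGroup G] {𝒜 : G → AddSubgroup A}
  {R : Type*} [CommRing R] {G' : Type*} [AddCommGroup G'] {ℛ : G' → AddSubgroup R}

/-- Base change of a complex of graded free modules along a homogeneous ring homomorphism. -/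
@[reducible] noncomputable def map (D : FreeCpx.{u} 𝒜) (f : A →+* R) (φ : G →+ G')
    (hf : ∀ g, ∀ a ∈ 𝒜 g, f a ∈ ℛ (φ g)) : FreeCpx.{u} ℛ where
  κ := D.κ
  h := D.h
  deg k := φ (D.deg k)
  bd k := (D.bd k).mapRange f (map_zero f)
  bd_mem k l := by
    rw [Finsupp.mapRange_apply, ← map_sub]
    exact hf _ _ (D.bd_mem k l)
  bd_h k l h := D.bd_h k l fun h0 => h (by simp [h0])
  bd_bd k := by
    have h := D.bd_bd k
    ext m
    have h2 := congrArg f (DFunLike.congr_fun h m)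
    rw [Finsupp.sum_apply, Finsupp.sum, map_sum] at h2
    rw [Finsupp.sum_apply, Finsupp.sum_mapRange_index (by simp), Finsupp.sum]
    simpa using h2

/-- This is `(D ⊗_A R) ⊗_R Z = D ⊗_A Z`: when the two actions on `Z` are compatible, base change
does not affect the complex with values in `Z`. -/
theorem map_d {D : FreeCpx.{u} 𝒜} {f : A →+* R} {φ : G →+ G'}
    {hf : ∀ g, ∀ a ∈ 𝒜 g, f a ∈ ℛ (φ g)} {Z : Type*} [AddCommGroup Z] [Module A Z] [Module R Z]
    (h : ∀ (a : A) (z : Z), f a • z = a • z) (x : D.κ →₀ Z) :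
    (D.map f φ hf).d Z x = D.d Z x := by
  ext l
  have h1 := d_apply (D.map f φ hf) x l
  refine h1.trans ?_
  rw [d_apply]
  refine Finsupp.sum_congr fun k _ => ?_
  rw [← h]
  rfl

end BaseChange

end FreeCpx

end Constructions

/-! ### The canonical graded free resolution -/

section Builder

set_option linter.unusedSectionVars false

universe u v

/-- The data of the last step in the construction of a free resolution: a graded free module with
basis `C`, and the submodule which has to be covered next. -/
structure ResolutionStage (A : Type v) [CommRing A] (G : Type) where
  C : Type (max u v)
  deg : C → G
  Ker : Submodule A (C →₀ A)

variable {A : Type v} [CommRing A] {G : Type} [AddCommGroup G] (𝒜 : G → AddSubgroup A)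

/-- The next free module has a basis vector for each nonzero homogeneous element. -/
noncomputable def ResolutionStage.next (S : ResolutionStage.{u} A G) :
    ResolutionStage.{u} A G where
  -- Leaving out zero forces each new degree to be an earlier one plus a degree in which the ring is
  -- nonzero, so the degrees stay in the expected cone.
  C := {p : G × (S.C →₀ A) // p.2 ∈ S.Ker ∧ (∀ k, p.2 k ∈ 𝒜 (p.1 - S.deg k)) ∧ p.2 ≠ 0}
  deg p := p.1.1
  Ker := LinearMap.ker (Finsupp.linearCombination A (fun p : {p : G × (S.C →₀ A) //
    p.2 ∈ S.Ker ∧ (∀ k, p.2 k ∈ 𝒜 (p.1 - S.deg k)) ∧ p.2 ≠ 0} => p.1.2))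

/-- The steps of the canonical free resolution. -/
noncomputable def ResolutionStage.iter (S : ResolutionStage.{u} A G) : ℕ → ResolutionStage.{u} A G
  | 0 => S
  | n + 1 => (S.iter n).next 𝒜

namespace ResolutionStage

variable (S : ResolutionStage.{u} A G)

/-- The inclusion of the basis of a term into the basis of the whole complex. -/
def incl (n : ℕ) (c : (S.iter 𝒜 n).C) : Σ n, (S.iter 𝒜 n).C := ⟨n, c⟩

theorem incl_injective (n : ℕ) : Function.Injective (S.incl 𝒜 n) := fun a b h => by
  simpa [incl] using h

/-- The differential on the basis of the canonical free resolution. -/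
noncomputable def bd : (Σ n, (S.iter 𝒜 n).C) → ((Σ n, (S.iter 𝒜 n).C) →₀ A)
  | ⟨0, _⟩ => 0
  | ⟨n + 1, p⟩ => Finsupp.mapDomain (S.incl 𝒜 n) p.1.2

theorem mapDomain_incl_apply {n : ℕ} (x : (S.iter 𝒜 n).C →₀ A) (q : Σ n, (S.iter 𝒜 n).C) :
    (Finsupp.mapDomain (S.incl 𝒜 n) x q ≠ 0 → q.1 = n) ∧
      ∀ c, q = ⟨n, c⟩ → Finsupp.mapDomain (S.incl 𝒜 n) x q = x c := by
  constructor
  · intro h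
    by_contra hq
    refine h (Finsupp.mapDomain_of_notMem_range _ _ ?_)
    rintro ⟨c, rfl⟩
    exact hq rfl
  · rintro c rfl
    exact Finsupp.mapDomain_apply (S.incl_injective 𝒜 n) _ _

theorem bd_linearCombination (n : ℕ) (x : (S.iter 𝒜 (n + 1)).C →₀ A) :
    Finsupp.linearCombination A (S.bd 𝒜) (Finsupp.mapDomain (S.incl 𝒜 (n + 1)) x) =
      Finsupp.mapDomain (S.incl 𝒜 n) (Finsupp.linearCombination A
        (fun p : (S.iter 𝒜 (n + 1)).C => p.1.2) x) := by
  rw [Finsupp.linearCombination_mapDomain, Finsupp.linearCombination_apply,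
    Finsupp.linearCombination_apply, Finsupp.sum, Finsupp.sum]
  change _ = Finsupp.lmapDomain A A (S.incl 𝒜 n) _
  rw [map_sum]
  refine Finset.sum_congr rfl fun p _ => ?_
  rw [map_smul]
  rfl

/-- The canonical free resolution as a complex. -/
@[reducible] noncomputable def cpx : FreeCpx.{max u v} 𝒜 where
  κ := Σ n, (S.iter 𝒜 n).C
  h := Sigma.fst
  deg p := (S.iter 𝒜 p.1).deg p.2
  bd := S.bd 𝒜
  bd_mem := by
    rintro ⟨_ | n, p⟩ q
    · exact zero_mem _
    · by_cases h : S.bd 𝒜 ⟨n + 1, p⟩ q = 0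
      · rw [h]; exact zero_mem _
      · obtain ⟨m, c⟩ := q
        have hm : m = n := (S.mapDomain_incl_apply 𝒜 _ _).1 h
        subst hm
        change Finsupp.mapDomain (S.incl 𝒜 m) p.1.2 _ ∈ _
        rw [(S.mapDomain_incl_apply 𝒜 _ _).2 c rfl]
        exact p.2.2.1 c
  bd_h := by
    rintro ⟨_ | n, p⟩ q h
    · exact absurd rfl h
    · have := (S.mapDomain_incl_apply 𝒜 _ _).1 h
      rw [this]
  bd_bd := by
    rintro ⟨_ | _ | n, p⟩
    · rfl
    · change (Finsupp.mapDomain (S.incl 𝒜 0) p.1.2).sum _ = 0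
      rw [Finsupp.sum_mapDomain_index (by simp) (by intros; rw [add_smul])]
      exact Finset.sum_eq_zero fun c _ => smul_zero _
    · have h := S.bd_linearCombination 𝒜 n p.1.2
      have h2 : Finsupp.linearCombination A (fun p : (S.iter 𝒜 (n + 1)).C => p.1.2) p.1.2 = 0 :=
        p.2.1
      rw [h2, Finsupp.mapDomain_zero, Finsupp.linearCombination_apply] at h
      exact h

theorem cpx_d (f : (S.cpx 𝒜).κ →₀ A) :
    (S.cpx 𝒜).d A f = Finsupp.linearCombination A (S.bd 𝒜) f := by
  rw [Finsupp.linearCombination_apply, FreeCpx.d, Finsupp.lsum_apply]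
  refine Finsupp.sum_congr fun l _ => ?_
  ext m
  simp [mul_comm]

theorem exists_mapDomain {n : ℕ} {e : G} {f : (S.cpx 𝒜).κ →₀ A}
    (hf : f ∈ (S.cpx 𝒜).part 𝒜 n e) :
    ∃ x : (S.iter 𝒜 n).C →₀ A, f = Finsupp.mapDomain (S.incl 𝒜 n) x ∧
      ∀ c, x c ∈ 𝒜 (e - (S.iter 𝒜 n).deg c) := by
  have hinj := S.incl_injective 𝒜 n
  refine ⟨Finsupp.comapDomain (S.incl 𝒜 n) f hinj.injOn, ?_, fun c => (hf ⟨n, c⟩).1⟩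
  rw [Finsupp.mapDomain_comapDomain _ hinj]
  intro q hq
  obtain ⟨m, c⟩ := q
  have : m = n := by
    by_contra h
    exact (Finsupp.mem_support_iff.1 hq) ((hf ⟨m, c⟩).2 (by exact_mod_cast h))
  subst this
  exact ⟨c, rfl⟩

/-- By construction a nonzero homogeneous element of the kernel labels a basis vector of the next
term, whose boundary it is. -/
theorem exact_ker (h1 : (1 : A) ∈ 𝒜 0) {n : ℕ} {e : G} (x : (S.iter 𝒜 n).C →₀ A)
    (hx : ∀ c, x c ∈ 𝒜 (e - (S.iter 𝒜 n).deg c)) (hK : x ∈ (S.iter 𝒜 n).Ker) :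
    ∃ y ∈ (S.cpx 𝒜).part 𝒜 (n + 1 : ℕ) e,
      (S.cpx 𝒜).d A y = Finsupp.mapDomain (S.incl 𝒜 n) x := by
  by_cases h0 : x = 0
  · exact ⟨0, zero_mem _, by rw [map_zero, h0, Finsupp.mapDomain_zero]⟩
  let p : (S.iter 𝒜 (n + 1)).C := ⟨(e, x), hK, hx, h0⟩
  refine ⟨Finsupp.single ⟨n + 1, p⟩ 1, fun q => ?_, ?_⟩
  · by_cases hq : (⟨n + 1, p⟩ : Σ n, (S.iter 𝒜 n).C) = q
    · subst hq
      rw [Finsupp.single_eq_same]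
      refine ⟨?_, fun h => absurd rfl h⟩
      change (1 : A) ∈ 𝒜 (e - e)
      rwa [sub_self]
    · rw [Finsupp.single_eq_of_ne' hq]
      exact ⟨zero_mem _, fun _ => rfl⟩
  · rw [cpx_d, Finsupp.linearCombination_single, one_smul]
    rfl

/-- All degrees which occur lie in a given cone. -/
theorem deg_mem (P : G → Prop) (hP : ∀ g g', P g → P g' → P (g + g'))
    (h𝒜 : ∀ g, ∀ a ∈ 𝒜 g, a ≠ 0 → P g) (h0 : ∀ c, P (S.deg c)) (k : (S.cpx 𝒜).κ) :
    P ((S.cpx 𝒜).deg k) := by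
  obtain ⟨n, p⟩ := k
  induction n with
  | zero => exact h0 p
  | succ n ih =>
    obtain ⟨c, hc⟩ := Finsupp.ne_iff.1 p.2.2.2
    have := hP _ _ (h𝒜 _ _ (p.2.2.1 c) hc) (ih c)
    rwa [sub_add_cancel] at this

variable {N : Type*} [AddCommGroup N] [Module A N]

/-- The augmentation of the canonical free resolution. -/
noncomputable def augBasis (w : (S.iter 𝒜 0).C → N) : (Σ n, (S.iter 𝒜 n).C) → N
  | ⟨0, c⟩ => w c
  | ⟨_ + 1, _⟩ => 0

theorem resolves {𝒩 : G → AddSubgroup N} (w : (S.iter 𝒜 0).C → N)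
    (hS : (S.iter 𝒜 0).Ker = LinearMap.ker (Finsupp.linearCombination A w))
    (one_mem : (1 : A) ∈ 𝒜 0) (mul_mem : HomogeneousSMul 𝒜 𝒜)
    (smul_mem : HomogeneousSMul 𝒜 𝒩) (hw : ∀ c, w c ∈ 𝒩 ((S.iter 𝒜 0).deg c))
    (hsurj : ∀ e, ∀ y ∈ 𝒩 e, ∃ x : (S.iter 𝒜 0).C →₀ A, (∀ c, x c ∈ 𝒜 (e - (S.iter 𝒜 0).deg c)) ∧
      Finsupp.linearCombination A w x = y) :
    (S.cpx 𝒜).Resolves 𝒩 (Finsupp.linearCombination A (S.augBasis 𝒜 w)) := by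
  have h0 : ∀ x : (S.iter 𝒜 0).C →₀ A, Finsupp.linearCombination A (S.augBasis 𝒜 w)
      (Finsupp.mapDomain (S.incl 𝒜 0) x) =
        Finsupp.linearCombination A w x := fun x => by
    rw [Finsupp.linearCombination_mapDomain]; rfl
  refine ⟨one_mem, mul_mem, smul_mem, ?_, ?_, ?_, ?_, ?_, ?_⟩
  · rintro ⟨_ | n, c⟩ a h
    · exact absurd rfl h
    · rw [Finsupp.linearCombination_single]; exact smul_zero _
  · intro e x hx
    obtain ⟨x, rfl, hx'⟩ := S.exists_mapDomain 𝒜 (n := 0) hx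
    refine (h0 x).symm ▸ ?_
    rw [Finsupp.linearCombination_apply]
    refine sum_mem fun c _ => ?_
    have := smul_mem (hx' c) (hw c)
    rwa [sub_add_cancel] at this
  · intro x
    rw [cpx_d]
    suffices h : Finsupp.linearCombination A (S.augBasis 𝒜 w) ∘ₗ
        Finsupp.linearCombination A (S.bd 𝒜) = 0 from LinearMap.congr_fun h x
    refine Finsupp.lhom_ext' fun q => LinearMap.ext_ring ?_
    simp only [LinearMap.comp_apply, Finsupp.lsingle_apply, Finsupp.linearCombination_single,
      one_smul, LinearMap.zero_apply]
    obtain ⟨_ | _ | n, p⟩ := q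
    · exact map_zero _
    · refine (h0 _).trans ?_
      have := p.2.1
      exact (SetLike.ext_iff.1 hS _).1 this
    · change Finsupp.linearCombination A (S.augBasis 𝒜 w)
        (Finsupp.mapDomain (S.incl 𝒜 (n + 1)) p.1.2) = 0
      rw [Finsupp.linearCombination_mapDomain, Finsupp.linearCombination_apply]
      exact Finset.sum_eq_zero fun c _ => smul_zero _
  · intro e y hy
    obtain ⟨x, hx, rfl⟩ := hsurj e y hy
    refine ⟨Finsupp.mapDomain (S.incl 𝒜 0) x, fun q => ?_, h0 x⟩
    by_cases hq : Finsupp.mapDomain (S.incl 𝒜 0) x q = 0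
    · rw [hq]; exact ⟨zero_mem _, fun _ => rfl⟩
    · obtain ⟨m, c⟩ := q
      have hm : m = 0 := (S.mapDomain_incl_apply 𝒜 _ _).1 hq
      subst hm
      rw [(S.mapDomain_incl_apply 𝒜 _ _).2 c rfl]
      exact ⟨hx c, fun h => absurd rfl h⟩
  · intro e x hx hx0
    obtain ⟨x, rfl, hx'⟩ := S.exists_mapDomain 𝒜 (n := 0) hx
    refine S.exact_ker 𝒜 one_mem x hx' ?_
    rw [hS]
    exact (h0 x).symm.trans hx0
  · intro n hn e x hx hx0
    obtain ⟨m, rfl⟩ : ∃ m : ℕ, n = (m + 1 : ℕ) := ⟨(n - 1).toNat, by omega⟩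
    obtain ⟨x, rfl, hx'⟩ := S.exists_mapDomain 𝒜 (n := m + 1) hx
    refine S.exact_ker 𝒜 one_mem x hx' ?_
    rw [cpx_d] at hx0
    have h2 := (S.bd_linearCombination 𝒜 m x).symm.trans hx0
    exact Finsupp.mapDomain_injective (S.incl_injective 𝒜 _) (h2.trans Finsupp.mapDomain_zero.symm)

end ResolutionStage

/-- The first step of the canonical resolution of the cyclic module `A / I`. -/
@[reducible] noncomputable def cyclicStage {A : Type v} [CommRing A] (G : Type) [AddCommGroup G]
    (I : Ideal A) : ResolutionStage.{v} A G where
  C := PUnit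
  deg _ := 0
  Ker := LinearMap.ker (Finsupp.linearCombination A (fun _ : PUnit => Ideal.Quotient.mk I 1))

/-- The canonical resolution of the cyclic module `A / I`. -/
@[reducible] noncomputable def cyclicCpx (I : Ideal A) : FreeCpx.{v} 𝒜 :=
  (cyclicStage G I).cpx 𝒜

/-- The basis element in homological degree `0` of the resolution of a cyclic module. -/
noncomputable def cyclicGen (I : Ideal A) : (cyclicCpx 𝒜 I).κ := ⟨0, PUnit.unit⟩

variable {𝒜}

theorem eq_cyclicGen (I : Ideal A) (k : (cyclicCpx 𝒜 I).κ) (hk : (cyclicCpx 𝒜 I).h k = 0) :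
    k = cyclicGen 𝒜 I := by
  obtain ⟨n, c⟩ := k
  change n = 0 at hk
  subst hk
  rfl

theorem cyclicCpx_resolves (I : Ideal A) {𝒩 : G → AddSubgroup (A ⧸ I)}
    (one_mem : (1 : A) ∈ 𝒜 0) (mul_mem : HomogeneousSMul 𝒜 𝒜) (smul_mem : HomogeneousSMul 𝒜 𝒩)
    (hN : ∀ e, ∀ y : A ⧸ I, y ∈ 𝒩 e ↔ ∃ a ∈ 𝒜 e, Ideal.Quotient.mk I a = y) :
    (cyclicCpx 𝒜 I).Resolves 𝒩 (Finsupp.linearCombination A ((cyclicStage G I).augBasis 𝒜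
      (fun _ => Ideal.Quotient.mk I 1))) := by
  refine (cyclicStage G I).resolves 𝒜 _ rfl one_mem mul_mem smul_mem ?_ ?_
  · intro _; exact (hN _ _).2 ⟨1, one_mem, rfl⟩
  · intro e y hy
    obtain ⟨a, ha, rfl⟩ := (hN e y).1 hy
    refine ⟨Finsupp.single PUnit.unit a, ?_, ?_⟩
    · rintro ⟨⟩
      change Finsupp.single PUnit.unit a PUnit.unit ∈ 𝒜 (e - 0)
      rwa [Finsupp.single_eq_same, sub_zero]
    · refine (Finsupp.linearCombination_single A a _).trans ?_
      rw [Algebra.smul_def, Ideal.Quotient.algebraMap_eq, ← map_mul, mul_one]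

/-- A relation on the single generator of `A / I` is an element of `I`. For `I ≤ 𝔪` the
differentials into the generator therefore vanish modulo `𝔪`, which is what allows a tensor factor
to be split off. -/
theorem cyclicCpx_bd_mem (I : Ideal A) (k : (cyclicCpx 𝒜 I).κ) :
    (cyclicCpx 𝒜 I).bd k (cyclicGen 𝒜 I) ∈ I := by
  obtain ⟨_ | _ | n, p⟩ := k
  · exact zero_mem _
  · have h : ∀ x : PUnit.{v + 1} →₀ A,
        Finsupp.linearCombination A (fun _ => Ideal.Quotient.mk I 1) x = 0 →
          x PUnit.unit ∈ I := by
      intro x hx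
      rw [Finsupp.unique_single x, Finsupp.linearCombination_single,
        Algebra.smul_def, Ideal.Quotient.algebraMap_eq, ← map_mul, mul_one] at hx
      exact Ideal.Quotient.eq_zero_iff_mem.1 hx
    change Finsupp.mapDomain ((cyclicStage G I).incl 𝒜 0) p.1.2 _ ∈ _
    have e := ((cyclicStage G I).mapDomain_incl_apply 𝒜 (n := 0) p.1.2 (cyclicGen 𝒜 I)).2
      PUnit.unit rfl
    exact e.symm ▸ h p.1.2 p.2.1
  · by_contra h
    refine h ?_
    change (ResolutionStage.bd 𝒜 (cyclicStage G I) ⟨n + 1 + 1, p⟩) (cyclicGen 𝒜 I) ∈ I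
    have : (ResolutionStage.bd 𝒜 (cyclicStage G I) ⟨n + 1 + 1, p⟩) (cyclicGen 𝒜 I) = 0 := by
      by_contra h0
      have h2 := ((cyclicStage G I).mapDomain_incl_apply 𝒜 _ _).1 h0
      exact absurd h2 (Nat.succ_ne_zero n).symm
    rw [this]; exact zero_mem _

theorem cyclicCpx_deg_mem (I : Ideal A) (P : G → Prop) (hP : ∀ g g', P g → P g' → P (g + g'))
    (h𝒜 : ∀ g, ∀ a ∈ 𝒜 g, a ≠ 0 → P g) (h0 : P 0) (k : (cyclicCpx 𝒜 I).κ) :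
    P ((cyclicCpx 𝒜 I).deg k) :=
  (cyclicStage G I).deg_mem 𝒜 P hP h𝒜 (fun _ => h0) k

end Builder

/-! ### Arbitrary graded free resolutions as complexes; an upper bound for `Tor` -/

section TorResolutions

set_option linter.unusedSectionVars false
open scoped TensorProduct

universe u v w

/-- The underlying family of additive subgroups of a family of subspaces. -/
abbrev addFamily {K G Z : Type*} [Field K] [AddCommGroup Z] [Module K Z]
    (𝒵 : G → Submodule K Z) (g : G) : AddSubgroup Z := (𝒵 g).toAddSubgroup

section Residue

variable {A : Type*} [CommRing A] (𝔪 : Ideal A)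

theorem exists_one_tmul {Z : Type*} [AddCommGroup Z] [Module A Z] (z : (A ⧸ 𝔪) ⊗[A] Z) :
    ∃ x : Z, z = 1 ⊗ₜ[A] x := by
  induction z using TensorProduct.induction_on with
  | zero => exact ⟨0, by simp⟩
  | tmul q x =>
    obtain ⟨a, rfl⟩ := Ideal.Quotient.mk_surjective q
    refine ⟨a • x, ?_⟩
    rw [← TensorProduct.smul_tmul, Algebra.smul_def, mul_one]
    rfl
  | add z₁ z₂ h₁ h₂ =>
    obtain ⟨x₁, rfl⟩ := h₁
    obtain ⟨x₂, rfl⟩ := h₂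
    exact ⟨x₁ + x₂, by rw [TensorProduct.tmul_add]⟩

theorem one_tmul_eq_zero_iff {ι : Type*} (x : ι →₀ A) :
    (1 : A ⧸ 𝔪) ⊗ₜ[A] x = 0 ↔ ∀ i, x i ∈ 𝔪 := by
  classical
  rw [← (TensorProduct.finsuppScalarRight A A (A ⧸ 𝔪) ι).map_eq_zero_iff, Finsupp.ext_iff]
  refine forall_congr' fun i => ?_
  rw [TensorProduct.finsuppScalarRight_apply_tmul_apply, Algebra.smul_def, mul_one,
    Finsupp.zero_apply]
  exact Ideal.Quotient.eq_zero_iff_mem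

open Classical in
theorem residue_equivariantProj {G : Type*} [AddCommGroup G] {𝒜 : G → AddSubgroup A}
    (h : IsResidueIdeal 𝒜 𝔪) : EquivariantProj 𝒜 (residueFamily 𝔪 : G → AddSubgroup (A ⧸ 𝔪))
      (fun e => if e = 0 then AddMonoidHom.id _ else 0) where
  mem e z he := by simp [he]
  self e z hz := by
    split_ifs with h
    · rfl
    · exact (hz h).symm
  ne e e' hee z hz := by
    split_ifs with h
    · exact hz fun h' => hee (h'.trans h.symm)
    · rfl
  smul g e a ha z := by
    by_cases hg : g = 0
    · subst hg
      rw [zero_add]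
      split_ifs <;> simp
    · have h0 : ∀ y : A ⧸ 𝔪, a • y = 0 := fun y => by
        rw [Algebra.smul_def, Ideal.Quotient.algebraMap_eq,
          Ideal.Quotient.eq_zero_iff_mem.2 (h.mem g hg a ha), zero_mul]
      rw [h0, h0, map_zero]

end Residue

section OfResolution

variable {K : Type u} [Field K] {A : Type v} [CommRing A] [Algebra K A]
  {N : Type w} [AddCommGroup N] [Module K N] [Module A N]
  {𝒜 : ℤ → Submodule K A} {𝒩 : ℤ → Submodule K N}

namespace GradedFreeResolution

variable (F : GradedFreeResolution 𝒜 𝒩)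

theorem mk_injective (s : ℕ) : Function.Injective (Sigma.mk s : F.ι s → Σ s, F.ι s) :=
  sigma_mk_injective

/-- The matrix of the differential of a graded free resolution. -/
noncomputable def matrix : (Σ s, F.ι s) → ((Σ s, F.ι s) →₀ A)
  | ⟨0, _⟩ => 0
  | ⟨s + 1, k⟩ => Finsupp.mapDomain (Sigma.mk s) (F.d s (Finsupp.single k 1))

/-- The augmentation on the basis. -/
noncomputable def augBasis : (Σ s, F.ι s) → N
  | ⟨0, k⟩ => F.ε (Finsupp.single k 1)
  | ⟨_ + 1, _⟩ => 0

theorem mapDomain_mk_apply {κ : ℕ → Type*} {Y : Type*} [AddCommGroup Y] {s : ℕ} (x : κ s →₀ Y)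
    (q : Σ s, κ s) :
    (Finsupp.mapDomain (Sigma.mk s) x q ≠ 0 → q.1 = s) ∧
      ∀ c, q = ⟨s, c⟩ → Finsupp.mapDomain (Sigma.mk s) x q = x c := by
  constructor
  · intro h
    by_contra hq
    refine h (Finsupp.mapDomain_of_notMem_range _ _ ?_)
    rintro ⟨c, rfl⟩
    exact hq rfl
  · rintro c rfl
    exact Finsupp.mapDomain_apply sigma_mk_injective _ _

theorem matrix_linearCombination (s : ℕ) (x : F.ι (s + 1) →₀ A) :
    Finsupp.linearCombination A F.matrix (Finsupp.mapDomain (Sigma.mk (s + 1)) x) =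
      Finsupp.mapDomain (Sigma.mk s) (F.d s x) := by
  suffices h : Finsupp.linearCombination A F.matrix ∘ₗ Finsupp.lmapDomain A A (Sigma.mk (s + 1)) =
      Finsupp.lmapDomain A A (Sigma.mk s) ∘ₗ F.d s from LinearMap.congr_fun h x
  refine Finsupp.lhom_ext' fun q => LinearMap.ext_ring ?_
  simp only [LinearMap.comp_apply, Finsupp.lsingle_apply, Finsupp.lmapDomain_apply,
    Finsupp.mapDomain_single, Finsupp.linearCombination_single, one_smul]
  rfl

theorem single_mem_freeGrading (h1 : (1 : A) ∈ 𝒜 0) {s : ℕ} (k : F.ι s) :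
    Finsupp.single k (1 : A) ∈ freeGrading 𝒜 (F.deg s) (F.deg s k) := by
  intro i
  by_cases h : k = i
  · subst h; simpa using h1
  · rw [Finsupp.single_eq_of_ne' h]; exact zero_mem _

variable (h1 : (1 : A) ∈ 𝒜 0)

/-- A graded free resolution as a complex. -/
@[reducible] noncomputable def toFreeCpx : FreeCpx.{max v w} (addFamily 𝒜) where
  κ := Σ s, F.ι s
  h := Sigma.fst
  deg p := F.deg p.1 p.2
  bd := F.matrix
  bd_mem := by
    rintro ⟨_ | s, k⟩ q
    · exact zero_mem _
    · by_cases h : F.matrix ⟨s + 1, k⟩ q = 0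
      · rw [h]; exact zero_mem _
      · obtain ⟨m, c⟩ := q
        have hm : m = s := (mapDomain_mk_apply _ _).1 h
        subst hm
        change Finsupp.mapDomain (Sigma.mk m) _ _ ∈ _
        rw [(mapDomain_mk_apply _ _).2 c rfl]
        exact F.d_homogeneous m _ _ (F.single_mem_freeGrading h1 k) c
  bd_h := by
    rintro ⟨_ | s, k⟩ q h
    · exact absurd rfl h
    · have := (mapDomain_mk_apply _ _).1 h
      rw [this]
  bd_bd := by
    rintro ⟨_ | _ | s, k⟩
    · rfl
    · change (Finsupp.mapDomain (Sigma.mk 0) _).sum _ = 0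
      rw [Finsupp.sum_mapDomain_index (by simp) (by intros; rw [add_smul])]
      exact Finset.sum_eq_zero fun c _ => smul_zero _
    · have h := F.matrix_linearCombination s (F.d (s + 1) (Finsupp.single k 1))
      rw [(F.exact_succ s).apply_apply_eq_zero, Finsupp.mapDomain_zero,
        Finsupp.linearCombination_apply] at h
      exact h

theorem toFreeCpx_d (f : (Σ s, F.ι s) →₀ A) :
    (F.toFreeCpx h1).d A f = Finsupp.linearCombination A F.matrix f := by
  rw [Finsupp.linearCombination_apply, FreeCpx.d, Finsupp.lsum_apply]
  refine Finsupp.sum_congr fun l _ => ?_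
  ext m
  simp [mul_comm]

theorem exists_mapDomain_mk {Y : Type*} [AddCommGroup Y] [Module A Y] {𝒴 : ℤ → AddSubgroup Y}
    {s : ℕ} {e : ℤ} {f : (Σ s, F.ι s) →₀ Y} (hf : f ∈ (F.toFreeCpx h1).part 𝒴 s e) :
    ∃ x : F.ι s →₀ Y, f = Finsupp.mapDomain (Sigma.mk s) x ∧ ∀ c, x c ∈ 𝒴 (e - F.deg s c) := by
  have hinj := F.mk_injective s
  refine ⟨Finsupp.comapDomain (Sigma.mk s) f hinj.injOn, ?_, fun c => (hf ⟨s, c⟩).1⟩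
  rw [Finsupp.mapDomain_comapDomain _ hinj]
  intro q hq
  obtain ⟨m, c⟩ := q
  have : m = s := by
    by_contra h
    exact (Finsupp.mem_support_iff.1 hq) ((hf ⟨m, c⟩).2 (by exact_mod_cast h))
  subst this
  exact ⟨c, rfl⟩

theorem mapDomain_mk_mem {Y : Type*} [AddCommGroup Y] [Module A Y] {𝒴 : ℤ → AddSubgroup Y}
    {s : ℕ} {e : ℤ} {x : F.ι s →₀ Y} (hx : ∀ c, x c ∈ 𝒴 (e - F.deg s c)) :
    Finsupp.mapDomain (Sigma.mk s) x ∈ (F.toFreeCpx h1).part 𝒴 s e := by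
  intro q
  by_cases hq : Finsupp.mapDomain (Sigma.mk s) x q = 0
  · rw [hq]; exact ⟨zero_mem _, fun _ => rfl⟩
  · obtain ⟨m, c⟩ := q
    have hm : m = s := (mapDomain_mk_apply _ _).1 hq
    subst hm
    rw [(mapDomain_mk_apply _ _).2 c rfl]
    exact ⟨hx c, fun h => absurd rfl h⟩

variable {πA : ℤ → A →+ A} {πN : ℤ → N →+ N}

/-- Exactness of `F` concerns arbitrary elements. Projecting a preimage to the component of the
right degree makes it homogeneous, which gives exactness of every strand. -/
theorem toFreeCpx_resolves (hA : EquivariantProj (addFamily 𝒜) (addFamily 𝒜) πA)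
    (hN : EquivariantProj (addFamily 𝒜) (addFamily 𝒩) πN)
    (hmul : HomogeneousSMul (addFamily 𝒜) (addFamily 𝒜))
    (hsmul : HomogeneousSMul (addFamily 𝒜) (addFamily 𝒩))
    (hspan : ∀ a, a ∈ ⨆ j, addFamily 𝒜 j) :
    (F.toFreeCpx h1).Resolves (addFamily 𝒩) (Finsupp.linearCombination A F.augBasis) := by
  have h0 : ∀ x : F.ι 0 →₀ A, Finsupp.linearCombination A F.augBasis
      (Finsupp.mapDomain (Sigma.mk 0) x) = F.ε x := fun x => by
    suffices h : Finsupp.linearCombination A F.augBasis ∘ₗ Finsupp.lmapDomain A A (Sigma.mk 0) =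
      F.ε from LinearMap.congr_fun h x
    refine Finsupp.lhom_ext' fun q => LinearMap.ext_ring ?_
    simp only [LinearMap.comp_apply, Finsupp.lsingle_apply, Finsupp.lmapDomain_apply,
      Finsupp.mapDomain_single, Finsupp.linearCombination_single, one_smul]
    rfl
  refine ⟨h1, hmul, hsmul, ?_, ?_, ?_, ?_, ?_, ?_⟩
  · rintro ⟨_ | n, c⟩ a h
    · exact absurd rfl h
    · rw [Finsupp.linearCombination_single]; exact smul_zero _
  · intro e x hx
    obtain ⟨x, rfl, hx'⟩ := F.exists_mapDomain_mk h1 (s := 0) hx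
    rw [h0 x]
    exact F.ε_homogeneous _ _ hx'
  · intro x
    rw [toFreeCpx_d]
    suffices h : Finsupp.linearCombination A F.augBasis ∘ₗ
        Finsupp.linearCombination A F.matrix = 0 from LinearMap.congr_fun h x
    refine Finsupp.lhom_ext' fun q => LinearMap.ext_ring ?_
    simp only [LinearMap.comp_apply, Finsupp.lsingle_apply, Finsupp.linearCombination_single,
      one_smul, LinearMap.zero_apply]
    obtain ⟨_ | _ | n, p⟩ := q
    · exact map_zero _
    · exact (h0 _).trans (F.exact_zero.apply_apply_eq_zero _)
    · change Finsupp.linearCombination A F.augBasis (Finsupp.mapDomain (Sigma.mk (n + 1)) _) = 0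
      rw [Finsupp.linearCombination_mapDomain, Finsupp.linearCombination_apply]
      exact Finset.sum_eq_zero fun c _ => smul_zero _
  · intro e y hy
    obtain ⟨x, rfl⟩ := F.ε_surjective y
    have hcomm : ∀ x : F.ι 0 →₀ A, ∃ x' ∈ freeGrading 𝒜 (F.deg 0) e, F.ε x' = πN e (F.ε x) := by
      intro x
      induction x using Finsupp.induction_linear with
      | zero => exact ⟨0, zero_mem _, by simp⟩
      | add x y hx hy =>
        obtain ⟨x', hx', hx⟩ := hx
        obtain ⟨y', hy', hy⟩ := hy
        exact ⟨x' + y', add_mem hx' hy', by simp [hx, hy]⟩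
      | single k a =>
        have hk := F.ε_homogeneous _ _ (F.single_mem_freeGrading h1 k)
        have he : ∀ a, F.ε (Finsupp.single k a) = a • F.ε (Finsupp.single k 1) := fun a => by
          rw [← map_smul, Finsupp.smul_single, smul_eq_mul, mul_one]
        refine ⟨Finsupp.single k (πA (e - F.deg 0 k) a), fun i => ?_, ?_⟩
        · by_cases h : k = i
          · subst h; rw [Finsupp.single_eq_same]; exact hA.mem _ _
          · rw [Finsupp.single_eq_of_ne' h]; exact zero_mem _
        · rw [he, he a]
          have ha := hspan a
          induction ha using AddSubgroup.iSup_induction' with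
          | h1 => simp
          | hadd x y _ _ hx hy => simp only [map_add, add_smul, hx, hy]
          | hp j x hx =>
            have hm := hsmul hx hk
            by_cases hj : j = e - F.deg 0 k
            · subst hj
              rw [hA.self _ _ hx, hN.self]
              rwa [sub_add_cancel] at hm
            · rw [hA.ne _ _ hj _ hx, zero_smul, hN.ne _ _ _ _ hm]
              intro h; exact hj (by rw [← h]; abel)
    obtain ⟨x', hx', hx⟩ := hcomm x
    refine ⟨_, F.mapDomain_mk_mem h1 (s := 0) (𝒴 := addFamily 𝒜) hx', ?_⟩
    rw [h0, hx, hN.self _ _ hy]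
  · intro e x hx hx0
    obtain ⟨x', rfl, hx'⟩ := F.exists_mapDomain_mk h1 (s := 0) hx
    rw [h0] at hx0
    obtain ⟨y, rfl⟩ := (F.exact_zero _).1 hx0
    refine FreeCpx.exists_part_of_boundary hA hx (Finsupp.mapDomain (Sigma.mk 1) y) ?_
    rw [toFreeCpx_d]
    exact F.matrix_linearCombination 0 y
  · intro n hn e x hx hx0
    obtain ⟨m, rfl⟩ : ∃ m : ℕ, n = (m + 1 : ℕ) := ⟨(n - 1).toNat, by omega⟩
    obtain ⟨x', rfl, hx'⟩ := F.exists_mapDomain_mk h1 (s := m + 1) hx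
    rw [toFreeCpx_d, matrix_linearCombination] at hx0
    have hx1 := Finsupp.mapDomain_injective (F.mk_injective m)
      (hx0.trans Finsupp.mapDomain_zero.symm)
    obtain ⟨y, rfl⟩ := (F.exact_succ m _).1 hx1
    refine FreeCpx.exists_part_of_boundary hA hx (Finsupp.mapDomain (Sigma.mk (m + 2)) y) ?_
    rw [toFreeCpx_d]
    exact F.matrix_linearCombination (m + 1) y

/-- Every element of `A/𝔪 ⊗ F_s` has the form `1 ⊗ x`, and it vanishes exactly when all coordinates
of `x` lie in `𝔪`. So the cycles and boundaries defining `Tor` are those of the complex with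
coefficients in `A/𝔪`. -/
theorem mem_torBoundaries (h𝔪 : IsResidueIdeal (addFamily 𝒜) (positiveIdeal 𝒜)) {s : ℕ} {j : ℤ}
    (h : (F.toFreeCpx h1).HV (residueFamily (positiveIdeal 𝒜)) s j)
    {z : (A ⧸ positiveIdeal 𝒜) ⊗[A] (F.ι s →₀ A)} (hz : z ∈ F.torDegree s j)
    (hz' : z ∈ F.torCycles s) : z ∈ F.torBoundaries s := by
  obtain ⟨x, hx, rfl⟩ := hz
  set 𝔪 := positiveIdeal 𝒜
  let q := 𝔪.mkQ
  have hmap : ∀ {s : ℕ} (x : F.ι s →₀ A), Finsupp.mapDomain (Sigma.mk s)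
      (Finsupp.mapRange.linearMap q x) = Finsupp.mapRange.linearMap q
        (Finsupp.mapDomain (Sigma.mk s : F.ι s → Σ s, F.ι s) x) := fun x =>
    Finsupp.mapDomain_mapRange _ _ _ (map_zero _) (map_add q)
  have hf := F.mapDomain_mk_mem h1 (𝒴 := residueFamily 𝔪)
    (x := Finsupp.mapRange.linearMap q x) (s := s) (e := j) fun c hc => by
      rw [Finsupp.mapRange.linearMap_apply, Finsupp.mapRange_apply]
      exact Ideal.Quotient.eq_zero_iff_mem.2 (h𝔪.mem _ hc _ (hx c))
  have hd : (F.toFreeCpx h1).d (A ⧸ 𝔪) (Finsupp.mapDomain (Sigma.mk s)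
      (Finsupp.mapRange.linearMap q x)) = 0 := by
    rw [hmap, FreeCpx.d_mapRange, toFreeCpx_d]
    cases s with
    | zero =>
      rw [Finsupp.linearCombination_mapDomain, Finsupp.linearCombination_apply, Finsupp.sum,
        Finset.sum_eq_zero fun c _ => ?_, map_zero]
      exact smul_zero _
    | succ s =>
      rw [matrix_linearCombination, ← hmap]
      have h0 : (1 : A ⧸ 𝔪) ⊗ₜ[A] F.d s x = 0 := hz'
      rw [one_tmul_eq_zero_iff] at h0
      have : Finsupp.mapRange.linearMap q (F.d s x) = 0 := by
        ext c
        exact Ideal.Quotient.eq_zero_iff_mem.2 (h0 c)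
      rw [this, Finsupp.mapDomain_zero]
  obtain ⟨g, hg, hgd⟩ := h _ hf hd
  obtain ⟨y, rfl, -⟩ := F.exists_mapDomain_mk h1 (s := s + 1) hg
  obtain ⟨y, rfl⟩ := Finsupp.mapRange_surjective q (map_zero q)
    (Submodule.mkQ_surjective 𝔪) y
  change (F.toFreeCpx h1).d (A ⧸ 𝔪) (Finsupp.mapDomain _ (Finsupp.mapRange.linearMap q y)) = _
    at hgd
  rw [hmap, FreeCpx.d_mapRange, toFreeCpx_d, matrix_linearCombination, ← hmap] at hgd
  have h2 := Finsupp.mapDomain_injective (F.mk_injective s) hgd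
  refine ⟨1 ⊗ₜ y, ?_⟩
  change (1 : A ⧸ 𝔪) ⊗ₜ[A] F.d s y = _
  rw [← sub_eq_zero, ← TensorProduct.tmul_sub, one_tmul_eq_zero_iff]
  intro c
  rw [← Ideal.Quotient.eq_zero_iff_mem, Finsupp.sub_apply, map_sub, sub_eq_zero]
  exact DFunLike.congr_fun h2 c

end GradedFreeResolution

/-- `Tor_s(N, K)_j` can be computed from a resolution of `K`. -/
theorem not_torNonzero_of_HV {πA : ℤ → A →+ A} {πN : ℤ → N →+ N}
    (hA : EquivariantProj (addFamily 𝒜) (addFamily 𝒜) πA)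
    (hN : EquivariantProj (addFamily 𝒜) (addFamily 𝒩) πN)
    (hsmul : HomogeneousSMul (addFamily 𝒜) (addFamily 𝒩))
    (hspan : ∀ a, a ∈ ⨆ j, addFamily 𝒜 j)
    (h𝔪 : IsResidueIdeal (addFamily 𝒜) (positiveIdeal 𝒜))
    {P : FreeCpx (addFamily 𝒜)} {ε : (P.κ →₀ A) →ₗ[A] (A ⧸ positiveIdeal 𝒜)}
    (hP : P.Resolves (residueFamily (positiveIdeal 𝒜)) ε) {s : ℕ} {j : ℤ}
    (h : P.HV (addFamily 𝒩) s j) : ¬ TorNonzero 𝒜 𝒩 s j := by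
  -- The witness may come from any resolution `F`; balancing against `P` treats all of them at once.
  rintro ⟨F, z, hz, hz', hz''⟩
  exact hz'' (F.mem_torBoundaries h𝔪.one_mem h𝔪
    ((F.toFreeCpx_resolves h𝔪.one_mem hA hN h𝔪.mul_mem hsmul hspan).balance hP h) hz hz')

end OfResolution

end TorResolutions

/-! ### Positive ideals, and bigraded resolutions under the total grading -/

section ToResolution

set_option linter.unusedSectionVars false
open scoped TensorProduct

universe u v w

theorem positiveIdeal_eq_span {K A G : Type*} [Field K] [CommRing A] [Algebra K A]
    [AddCommGroup G] {𝒜 : ℤ → Submodule K A} {𝒱 : G → AddSubgroup A} {wt : G → ℤ}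
    (h : ∀ j, addFamily 𝒜 j = ⨆ g : {g // wt g = j}, 𝒱 g) :
    positiveIdeal 𝒜 = Ideal.span {x | ∃ g, 0 < wt g ∧ x ∈ 𝒱 g} := by
  refine le_antisymm (Ideal.span_le.2 ?_) (Ideal.span_le.2 ?_)
  · rintro x ⟨j, hj, hx⟩
    have hx' : x ∈ addFamily 𝒜 j := hx
    rw [h] at hx'
    have : (⨆ g : {g // wt g = j}, 𝒱 g) ≤
        (Ideal.span {x | ∃ g, 0 < wt g ∧ x ∈ 𝒱 g}).toAddSubgroup :=
      iSup_le fun g y hy => Ideal.subset_span ⟨g, by rw [g.2]; exact hj, hy⟩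
    exact this hx'
  · rintro x ⟨g, hg, hx⟩
    refine Ideal.subset_span ⟨wt g, hg, ?_⟩
    change x ∈ addFamily 𝒜 (wt g)
    rw [h]
    exact AddSubgroup.mem_iSup_of_mem (⟨g, rfl⟩ : {g' // wt g' = wt g}) hx

/-- An ideal generated by homogeneous elements of positive weight has no nonzero elements in a
degree which cannot be reached from such elements. -/
theorem eq_zero_of_mem_span {A G : Type*} [CommRing A] [AddCommGroup G] {𝒱 : G → AddSubgroup A}
    {wt : G → ℤ} {π : G → A →+ A} (hπ : EquivariantProj 𝒱 𝒱 π) (hspan : ∀ a, a ∈ ⨆ g, 𝒱 g)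
    (mul_mem : HomogeneousSMul 𝒱 𝒱) {e : G} (he : ∀ g g', 0 < wt g → g' + g = e → 𝒱 g' = ⊥)
    {a : A} (ha : a ∈ 𝒱 e) (ha' : a ∈ Ideal.span {x | ∃ g, 0 < wt g ∧ x ∈ 𝒱 g}) : a = 0 := by
  rw [← hπ.self e a ha]
  clear ha
  have key : ∀ g, 0 < wt g → ∀ x ∈ 𝒱 g, ∀ b, π e (b * x) = 0 := by
    intro g hg x hx b
    induction hspan b using AddSubgroup.iSup_induction' with
    | h1 => simp
    | hadd b c _ _ hb hc => rw [add_mul, map_add, hb, hc, add_zero]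
    | hp g' b hb =>
      by_cases h : g' + g = e
      · rw [he g g' hg h] at hb
        rw [AddSubgroup.mem_bot.1 hb, zero_mul, map_zero]
      · exact hπ.ne _ e h _ (mul_mem hb hx)
  have : ∀ b, π e (b * a) = 0 := by
    refine Submodule.span_induction (p := fun x _ => ∀ b, π e (b * x) = 0) ?_ ?_ ?_ ?_ ha'
    · rintro x ⟨g, hg, hx⟩
      exact key g hg x hx
    · simp
    · intro x y _ _ hx hy b; rw [mul_add, map_add, hx, hy, add_zero]
    · intro c x _ hx b; rw [smul_eq_mul, ← mul_assoc]; exact hx _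
  simpa using this 1

/-- An element of degree 0 in the ideal could be nonzero only if a generator of degree `g` with `0 <
wt g` had a cofactor of degree `-g`, and that component is zero. -/
theorem isResidueIdeal_span {A G : Type*} [CommRing A] [AddCommGroup G] {𝒱 : G → AddSubgroup A}
    {wt : G → ℤ} {π : G → A →+ A} (hπ : EquivariantProj 𝒱 𝒱 π)
    (hspan : ∀ a, a ∈ ⨆ g, 𝒱 g)
    (one_mem : (1 : A) ∈ 𝒱 0) (mul_mem : HomogeneousSMul 𝒱 𝒱)
    (hpos : ∀ g, g ≠ 0 → wt g ≤ 0 → 𝒱 g = ⊥) (hneg : ∀ g, 0 < wt g → 𝒱 (-g) = ⊥) :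
    IsResidueIdeal 𝒱 (Ideal.span {x | ∃ g, 0 < wt g ∧ x ∈ 𝒱 g}) := by
  have hmem : ∀ g, g ≠ 0 → ∀ a ∈ 𝒱 g, a ∈ Ideal.span {x | ∃ g, 0 < wt g ∧ x ∈ 𝒱 g} := by
    intro g hg a ha
    by_cases h : 0 < wt g
    · exact Ideal.subset_span ⟨g, h, ha⟩
    · rw [hpos g hg (not_lt.1 h)] at ha
      rw [AddSubgroup.mem_bot.1 ha]; exact zero_mem _
  refine ⟨one_mem, mul_mem, hmem, ?_, ?_⟩
  · intro a ha ha'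
    refine eq_zero_of_mem_span hπ hspan mul_mem (fun g g' hg h => ?_) ha ha'
    rw [eq_neg_of_add_eq_zero_left h, hneg g hg]
  · intro y
    obtain ⟨a, rfl⟩ := Ideal.Quotient.mk_surjective y
    induction hspan a using AddSubgroup.iSup_induction' with
    | h1 => exact ⟨0, zero_mem _, rfl⟩
    | hadd b c _ _ hb hc =>
      obtain ⟨b', hb', hb⟩ := hb
      obtain ⟨c', hc', hc⟩ := hc
      exact ⟨b' + c', add_mem hb' hc', by rw [map_add, map_add, hb, hc]⟩
    | hp g a ha =>
      by_cases h : g = 0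
      · subst h; exact ⟨a, ha, rfl⟩
      · exact ⟨0, zero_mem _, by
          rw [map_zero, Ideal.Quotient.eq_zero_iff_mem.2 (hmem g h a ha)]⟩

theorem Submodule.toAddSubgroup_iSup_eq {K Z ι : Type*} [Ring K] [AddCommGroup Z] [Module K Z]
    (S : ι → Submodule K Z) : (⨆ i, S i).toAddSubgroup = ⨆ i, (S i).toAddSubgroup := by
  refine le_antisymm (fun x hx => ?_)
    (iSup_le fun i => (Submodule.toAddSubgroup_le _ _).2 (le_iSup S i))
  induction (hx : x ∈ ⨆ i, S i) using Submodule.iSup_induction' with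
  | zero => exact zero_mem _
  | add x y _ _ hx hy => exact add_mem hx hy
  | mem i x hx => exact AddSubgroup.mem_iSup_of_mem (S := fun i => (S i).toAddSubgroup) i hx

/-- The total degree. -/
def totalDegree : ℤ × ℤ →+ ℤ := AddMonoidHom.fst ℤ ℤ + AddMonoidHom.snd ℤ ℤ

@[simp] theorem totalDegree_apply (e : ℤ × ℤ) : totalDegree e = e.1 + e.2 := rfl

theorem totalGrading_eq {K Z : Type*} [Field K] [AddCommGroup Z] [Module K Z]
    (𝒵 : ℤ × ℤ → Submodule K Z) (j : ℤ) :
    addFamily (totalGrading 𝒵) j = ⨆ e : {e // totalDegree e = j}, addFamily 𝒵 e := by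
  change (⨆ e : {e : ℤ × ℤ // e.1 + e.2 = j}, 𝒵 e).toAddSubgroup = _
  rw [Submodule.toAddSubgroup_iSup_eq]
  rfl

theorem totalGrading_sub_eq {K Z : Type*} [Field K] [AddCommGroup Z] [Module K Z]
    (𝒵 : ℤ × ℤ → Submodule K Z) (j : ℤ) (δ : ℤ × ℤ) :
    addFamily (totalGrading 𝒵) (j - totalDegree δ) =
      ⨆ w : {e | totalDegree e = j}, addFamily 𝒵 (w - δ) := by
  rw [totalGrading_eq]
  refine le_antisymm (iSup_le fun e => ?_) (iSup_le fun w => ?_)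
  · refine le_iSup_of_le ⟨e.1 + δ, ?_⟩ ?_
    · rw [Set.mem_ofPred_eq, map_add, e.2, sub_add_cancel]
    · rw [add_sub_cancel_right]
  · exact le_iSup (fun e : {e // totalDegree e = j - totalDegree δ} => addFamily 𝒵 e)
      ⟨w.1 - δ, by rw [map_sub, w.2]⟩

variable {K : Type u} [Field K] {A : Type v} [CommRing A] [Algebra K A]
  {N : Type w} [AddCommGroup N] [Module K N] [Module A N]
  {𝒜 : ℤ × ℤ → Submodule K A} {𝒩 : ℤ × ℤ → Submodule K N}

namespace FreeCpx

variable (D : FreeCpx.{max v w} (addFamily 𝒜))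

/-- The inclusion of the term of homological degree `s`. -/
noncomputable def termIncl (Y : Type*) [AddCommGroup Y] [Module A Y] (s : ℕ) :
    ({k // D.h k = s} →₀ Y) →ₗ[A] (D.κ →₀ Y) := Finsupp.lmapDomain Y A Subtype.val

/-- The restriction to the term of homological degree `s`. -/
noncomputable def termRes (Y : Type*) [AddCommGroup Y] [Module A Y] (s : ℕ) :
    (D.κ →₀ Y) →ₗ[A] ({k // D.h k = s} →₀ Y) :=
  Finsupp.lcomapDomain Subtype.val Subtype.val_injective

variable {D} {Y : Type*} [AddCommGroup Y] [Module A Y]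

@[simp] theorem termRes_apply (s : ℕ) (f : D.κ →₀ Y) (k : {k // D.h k = s}) :
    D.termRes Y s f k = f k := rfl

@[simp] theorem termIncl_apply (s : ℕ) (f : {k // D.h k = s} →₀ Y) (k : {k // D.h k = s}) :
    D.termIncl Y s f k = f k := Finsupp.mapDomain_apply Subtype.val_injective _ _

theorem termIncl_eq_zero {s : ℕ} (f : {k // D.h k = s} →₀ Y) {k : D.κ} (hk : D.h k ≠ s) :
    D.termIncl Y s f k = 0 :=
  Finsupp.mapDomain_of_notMem_range _ _ (by rintro ⟨k, rfl⟩; exact hk k.2)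

theorem termRes_termIncl (s : ℕ) (f : {k // D.h k = s} →₀ Y) :
    D.termRes Y s (D.termIncl Y s f) = f := by ext; simp

theorem termIncl_termRes {s : ℕ} {f : D.κ →₀ Y} (hf : ∀ k, D.h k ≠ s → f k = 0) :
    D.termIncl Y s (D.termRes Y s f) = f := by
  ext k
  by_cases hk : D.h k = s
  · exact termIncl_apply s _ ⟨k, hk⟩
  · rw [termIncl_eq_zero _ hk, hf k hk]

theorem d_eq_zero_of_h {s : ℕ} {f : D.κ →₀ Y} (hf : ∀ k, D.h k ≠ s + 1 → f k = 0) (k : D.κ)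
    (hk : D.h k ≠ s) : D.d Y f k = 0 := by
  rw [d_apply]
  refine Finset.sum_eq_zero fun l _ => ?_
  by_cases h : D.bd l k = 0
  · change D.bd l k • f l = 0
    rw [h, zero_smul]
  · have := D.bd_h l k h
    change D.bd l k • f l = 0
    rw [hf l (by omega), smul_zero]

theorem termIncl_mem {s : ℕ} {j : ℤ} {𝒴 : ℤ × ℤ → Submodule K A}
    {f : {k // D.h k = s} →₀ A}
    (hf : f ∈ freeGrading (totalGrading 𝒴) (fun k => totalDegree (D.deg k.1)) j) :
    D.termIncl A s f ∈ ⨆ w : {e | totalDegree e = j}, D.part (addFamily 𝒴) s w := by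
  refine mem_iSup_part _ (fun k => ?_) (fun k hk => termIncl_eq_zero _ (by exact_mod_cast hk))
  by_cases hk : D.h k = s
  · have := hf ⟨k, hk⟩
    rw [← termIncl_apply] at this
    rw [← totalGrading_sub_eq]
    exact this
  · rw [termIncl_eq_zero _ hk]; exact zero_mem _

/-- The total grading of a bigraded free resolution. -/
noncomputable def toGradedFreeResolution {ε : (D.κ →₀ A) →ₗ[A] N}
    (hD : D.Resolves (addFamily 𝒩) ε) {πA : ℤ × ℤ → A →+ A} {πN : ℤ × ℤ → N →+ N}
    (hA : EquivariantProj (addFamily 𝒜) (addFamily 𝒜) πA)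
    (hN : EquivariantProj (addFamily 𝒜) (addFamily 𝒩) πN)
    (hspan : ∀ a, a ∈ ⨆ e, addFamily 𝒜 e) (hspan' : ∀ y, y ∈ ⨆ e, addFamily 𝒩 e) :
    GradedFreeResolution (totalGrading 𝒜) (totalGrading 𝒩) where
  ι s := {k // D.h k = s}
  deg s k := totalDegree (D.deg k.1)
  d s := D.termRes A s ∘ₗ D.d A ∘ₗ D.termIncl A (s + 1)
  ε := ε ∘ₗ D.termIncl A 0
  d_homogeneous s j x hx k := by
    have h1 := termIncl_mem hx
    have h2 : (⨆ w : {e | totalDegree e = j}, D.part (addFamily 𝒜) (s + 1 : ℕ) w) ≤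
        (⨆ w : {e | totalDegree e = j}, D.part (addFamily 𝒜) s w).comap
          (D.d A).toAddMonoidHom := by
      refine iSup_le fun w f hf => AddSubgroup.mem_iSup_of_mem w ?_
      have := d_mem_part hD.mul_mem hf
      rwa [Nat.cast_succ, add_sub_cancel_right] at this
    have h3 := apply_mem_of_mem_iSup_part _ (h2 h1) k.1
    rw [← totalGrading_sub_eq] at h3
    exact h3
  ε_homogeneous j x hx := by
    have h1 := termIncl_mem hx
    have h2 : (⨆ w : {e | totalDegree e = j}, D.part (addFamily 𝒜) (0 : ℕ) w) ≤
        (⨆ w : {e | totalDegree e = j}, addFamily 𝒩 w).comap ε.toAddMonoidHom :=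
      iSup_le fun w f hf => AddSubgroup.mem_iSup_of_mem w (hD.ε_mem _ _ hf)
    have h3 := h2 h1
    change _ ∈ addFamily (totalGrading 𝒩) j
    rw [totalGrading_eq]
    exact h3
  ε_surjective := by
    intro y
    induction hspan' y using AddSubgroup.iSup_induction' with
    | h1 => exact ⟨0, map_zero _⟩
    | hadd y y' _ _ hy hy' =>
      obtain ⟨x, rfl⟩ := hy
      obtain ⟨x', rfl⟩ := hy'
      exact ⟨x + x', map_add _ _ _⟩
    | hp e y hy =>
      obtain ⟨x, hx, rfl⟩ := hD.surj e y hy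
      refine ⟨D.termRes A 0 x, ?_⟩
      rw [LinearMap.comp_apply, termIncl_termRes fun k hk => (hx k).2 (by exact_mod_cast hk)]
  exact_zero := by
    intro x
    constructor
    · intro hx
      have hspan2 : ∀ k, ∀ a : A, a ∈ ⨆ w : (Set.univ : Set (ℤ × ℤ)), addFamily 𝒜 (w - D.deg k) := by
        intro k a
        refine (iSup_le fun e => ?_ : (⨆ e, addFamily 𝒜 e) ≤ _) (hspan a)
        refine le_iSup_of_le (⟨e + D.deg k, trivial⟩ : (Set.univ : Set (ℤ × ℤ))) ?_
        rw [add_sub_cancel_right]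
      -- Exactness is now needed for inhomogeneous elements: the element is split into its bidegrees
      -- and each strand is treated separately.
      have hm := mem_iSup_part (D := D) (𝒵 := addFamily 𝒜) (n := 0) Set.univ
        (f := D.termIncl A 0 x) (fun k => hspan2 k _)
        (fun k hk => termIncl_eq_zero _ (by exact_mod_cast hk))
      obtain ⟨F, hF, hFs⟩ := AddSubgroup.exists_finsupp_of_mem_iSup _ hm
      have hF0 : ∀ w, ε (F w) = 0 := by
        intro w
        have h1 : πN w (ε (D.termIncl A 0 x)) = ε (F w) := by
          rw [← hFs, Finsupp.sum, map_sum, map_sum]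
          by_cases hw : w ∈ F.support
          · rw [Finset.sum_eq_single_of_mem w hw fun w' _ hne =>
              hN.ne _ _ (fun h => hne (Subtype.ext h)) _ (hD.ε_mem _ _ (hF w'))]
            exact hN.self _ _ (hD.ε_mem _ _ (hF w))
          · rw [Finsupp.notMem_support_iff.1 hw, map_zero]
            refine Finset.sum_eq_zero fun w' hw' =>
              hN.ne _ _ (fun h => hw ?_) _ (hD.ε_mem _ _ (hF w'))
            rwa [← Subtype.ext h]
        rw [← h1]
        have : ε (D.termIncl A 0 x) = 0 := hx
        rw [this, map_zero]
      choose g hg hgd using fun w : (Set.univ : Set (ℤ × ℤ)) => hD.exact_zero w (F w) (hF w) (hF0 w)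
      refine ⟨D.termRes A 1 (∑ w ∈ F.support, g w), ?_⟩
      rw [LinearMap.comp_apply, LinearMap.comp_apply, termIncl_termRes, map_sum]
      · have h1 : ∑ w ∈ F.support, D.d A (g w) = D.termIncl A 0 x := by
          rw [← hFs, Finsupp.sum]
          exact Finset.sum_congr rfl fun w _ => hgd w
        rw [h1, termRes_termIncl]
      · intro k hk
        rw [Finsupp.finsetSum_apply]
        exact Finset.sum_eq_zero fun w _ => (hg w k).2 (by exact_mod_cast hk)
    · rintro ⟨y, rfl⟩
      rw [LinearMap.comp_apply, LinearMap.comp_apply, LinearMap.comp_apply, termIncl_termRes]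
      · exact hD.ε_d _
      · exact d_eq_zero_of_h fun k hk => termIncl_eq_zero _ hk
  exact_succ s x := by
    have hk0 : ∀ k, D.h k ≠ s → D.d A (D.termIncl A (s + 1) x) k = 0 :=
      d_eq_zero_of_h fun k hk => termIncl_eq_zero _ hk
    constructor
    · intro hx
      have hx0 : D.d A (D.termIncl A (s + 1) x) = 0 := by
        rw [← termIncl_termRes hk0]
        exact (congrArg _ hx).trans (map_zero _)
      obtain ⟨g, -, hg, hgd⟩ := HV.coarsen hD.mul_mem hA (n := (s + 1 : ℕ)) Set.univ
        (fun w _ => hD.exact_pos _ (by omega) w) (D.termIncl A (s + 1) x)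
        (fun k => (iSup_le fun e => le_iSup_of_le
          (⟨e + D.deg k, trivial⟩ : (Set.univ : Set (ℤ × ℤ))) (by rw [add_sub_cancel_right]) :
            (⨆ e, addFamily 𝒜 e) ≤ _) (hspan _))
        (fun k hk => termIncl_eq_zero _ (by exact_mod_cast hk)) hx0
      refine ⟨D.termRes A _ g, ?_⟩
      rw [LinearMap.comp_apply, LinearMap.comp_apply,
        termIncl_termRes fun k hk => hg k (by exact_mod_cast hk), hgd, termRes_termIncl]
    · rintro ⟨y, rfl⟩
      rw [LinearMap.comp_apply, LinearMap.comp_apply, LinearMap.comp_apply, LinearMap.comp_apply,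
        termIncl_termRes, d_d, map_zero]
      exact d_eq_zero_of_h fun k hk => termIncl_eq_zero _ hk

/-- Vanishing of `Tor` for the total grading gives vanishing of the homology of a bigraded
resolution tensored with the residue field. -/
theorem HV.of_not_torNonzero {ε : (D.κ →₀ A) →ₗ[A] N}
    (hD : D.Resolves (addFamily 𝒩) ε) {πA : ℤ × ℤ → A →+ A} {πN : ℤ × ℤ → N →+ N}
    (hA : EquivariantProj (addFamily 𝒜) (addFamily 𝒜) πA)
    (hN : EquivariantProj (addFamily 𝒜) (addFamily 𝒩) πN)
    (hspan : ∀ a, a ∈ ⨆ e, addFamily 𝒜 e) (hspan' : ∀ y, y ∈ ⨆ e, addFamily 𝒩 e)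
    (h𝔪 : IsResidueIdeal (addFamily 𝒜) (positiveIdeal (totalGrading 𝒜))) {s : ℕ} {e : ℤ × ℤ}
    (h : ¬ TorNonzero (totalGrading 𝒜) (totalGrading 𝒩) s (totalDegree e)) :
    D.HV (residueFamily (positiveIdeal (totalGrading 𝒜))) s e := by
  classical
  set 𝔪 := positiveIdeal (totalGrading 𝒜)
  let q := 𝔪.mkQ
  let F := toGradedFreeResolution hD hA hN hspan hspan'
  intro f hf hd
  -- Coefficients in the residue field are lifted to degree-zero elements of the ring, so that the
  -- lifted chain is homogeneous.
  have hlift : ∀ e : ℤ × ℤ, ∀ z ∈ (residueFamily 𝔪 e : AddSubgroup (A ⧸ 𝔪)),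
      ∃ y ∈ (if e = 0 then addFamily 𝒜 0 else ⊥ : AddSubgroup A), q y = z := by
    intro e z hz
    by_cases he : e = 0
    · rw [if_pos he]; exact h𝔪.surj z
    · exact ⟨0, zero_mem _, by rw [map_zero, hz he]⟩
  obtain ⟨x, hx, rfl⟩ := exists_lift_part q hlift hf
  have hxs : ∀ k, D.h k ≠ s → x k = 0 := fun k hk => (hx k).2 (by exact_mod_cast hk)
  have hz1 : (1 : A ⧸ 𝔪) ⊗ₜ[A] D.termRes A s x ∈ F.torDegree s (totalDegree e) := by
    refine ⟨D.termRes A s x, fun k => ?_, rfl⟩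
    have h1 : x k.1 ∈ (if e - D.deg k.1 = 0 then addFamily 𝒜 0 else ⊥ : AddSubgroup A) := (hx k.1).1
    change x k.1 ∈ addFamily (totalGrading 𝒜) (totalDegree e - totalDegree (D.deg k.1))
    rw [← map_sub, totalGrading_eq]
    split_ifs at h1 with h2
    · rw [h2]
      exact AddSubgroup.mem_iSup_of_mem
        (⟨0, rfl⟩ : {g : ℤ × ℤ // totalDegree g = totalDegree 0}) h1
    · rw [AddSubgroup.mem_bot.1 h1]; exact zero_mem _
  have hz2 : (1 : A ⧸ 𝔪) ⊗ₜ[A] D.termRes A s x ∈ F.torCycles s := by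
    cases s with
    | zero => trivial
    | succ s =>
      change (1 : A ⧸ 𝔪) ⊗ₜ[A] D.termRes A s (D.d A (D.termIncl A (s + 1) (D.termRes A _ x))) = 0
      rw [termIncl_termRes hxs, one_tmul_eq_zero_iff]
      intro k
      rw [d_mapRange] at hd
      exact Ideal.Quotient.eq_zero_iff_mem.1 (DFunLike.congr_fun hd k.1)
  have hz3 : (1 : A ⧸ 𝔪) ⊗ₜ[A] D.termRes A s x ∈ F.torBoundaries s := by
    by_contra h'
    exact h ⟨F, _, hz1, hz2, h'⟩
  obtain ⟨y, hy⟩ := hz3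
  obtain ⟨(y : {k // D.h k = s + 1} →₀ A), rfl⟩ := exists_one_tmul 𝔪 y
  change (1 : A ⧸ 𝔪) ⊗ₜ[A] D.termRes A s (D.d A (D.termIncl A (s + 1) y)) = _ at hy
  rw [← sub_eq_zero, ← TensorProduct.tmul_sub, one_tmul_eq_zero_iff] at hy
  -- The boundary provided by the definition of `Tor` carries no degree condition; its component of
  -- the right bidegree is taken.
  refine exists_part_of_boundary (residue_equivariantProj 𝔪 h𝔪) hf
    (Finsupp.mapRange.linearMap q (D.termIncl A (s + 1) y)) ?_
  rw [d_mapRange]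
  ext k
  rw [Finsupp.mapRange.linearMap_apply, Finsupp.mapRange_apply, Finsupp.mapRange.linearMap_apply,
    Finsupp.mapRange_apply]
  by_cases hk : D.h k = s
  · have := hy ⟨k, hk⟩
    rw [← Ideal.Quotient.eq_zero_iff_mem, Finsupp.sub_apply, map_sub, sub_eq_zero] at this
    exact this
  · rw [hxs k hk, d_eq_zero_of_h (fun k hk => termIncl_eq_zero _ hk) k hk]

end FreeCpx

end ToResolution

/-! ### Gradings whose components are blocks of bidegrees -/

section BlockProjections

set_option linter.unusedSectionVars false

section

variable {K : Type*} [Field K] {Γ : Type*} [AddCommGroup Γ] [DecidableEq Γ]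
  {M : Type*} [AddCommGroup M] [Module K M]
  (ℳ : Γ → Submodule K M) [DirectSum.Decomposition ℳ]

open Classical in
/-- The projection onto the sum of the components with index in `W`. -/
noncomputable def blockProj (W : Set Γ) : M →+ M :=
  ((DirectSum.decomposeAddEquiv ℳ).symm.toAddMonoidHom.comp
    (DFinsupp.filterAddMonoidHom (fun e => ℳ e) (· ∈ W))).comp
      (DirectSum.decomposeAddEquiv ℳ).toAddMonoidHom

theorem blockProj_of_mem {W : Set Γ} {w : Γ} (hw : w ∈ W) {z : M} (hz : z ∈ ℳ w) :
    blockProj ℳ W z = z := by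
  classical
  lift z to ℳ w using hz
  have h1 : DFinsupp.filter (· ∈ W) (DirectSum.decompose ℳ (z : M)) =
      DirectSum.decompose ℳ (z : M) := by
    rw [DirectSum.decompose_coe]
    exact DFinsupp.filter_single_pos _ _ hw
  change (DirectSum.decompose ℳ).symm (DFinsupp.filter (· ∈ W) (DirectSum.decompose ℳ (z : M))) = _
  rw [h1, Equiv.symm_apply_apply]

theorem blockProj_of_notMem {W : Set Γ} {w : Γ} (hw : w ∉ W) {z : M} (hz : z ∈ ℳ w) :
    blockProj ℳ W z = 0 := by
  classical
  lift z to ℳ w using hz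
  have h1 : DFinsupp.filter (· ∈ W) (DirectSum.decompose ℳ (z : M)) = 0 := by
    rw [DirectSum.decompose_coe]
    exact DFinsupp.filter_single_neg _ _ hw
  change (DirectSum.decompose ℳ).symm (DFinsupp.filter (· ∈ W) (DirectSum.decompose ℳ (z : M))) = _
  rw [h1]
  exact DirectSum.decompose_symm_zero ℳ

theorem mem_iSup_addFamily (z : M) : z ∈ ⨆ e, addFamily ℳ e := by
  classical
  rw [← DirectSum.sum_support_decompose ℳ z]
  exact sum_mem fun e _ => AddSubgroup.mem_iSup_of_mem e (SetLike.coe_mem _)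

theorem blockProj_mem (W : Set Γ) (z : M) : blockProj ℳ W z ∈ ⨆ w : W, addFamily ℳ w := by
  induction mem_iSup_addFamily ℳ z using AddSubgroup.iSup_induction' with
  | h1 => rw [map_zero]; exact zero_mem _
  | hadd x y _ _ hx hy => rw [map_add]; exact add_mem hx hy
  | hp e x hx =>
    by_cases h : e ∈ W
    · rw [blockProj_of_mem ℳ h hx]
      exact AddSubgroup.mem_iSup_of_mem (⟨e, h⟩ : W) hx
    · rw [blockProj_of_notMem ℳ h hx]; exact zero_mem _

theorem blockProj_self (W : Set Γ) {z : M} (hz : z ∈ ⨆ w : W, addFamily ℳ w) :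
    blockProj ℳ W z = z := by
  induction hz using AddSubgroup.iSup_induction' with
  | h1 => rw [map_zero]
  | hadd x y _ _ hx hy => rw [map_add, hx, hy]
  | hp e x hx => exact blockProj_of_mem ℳ e.2 hx

theorem blockProj_ne {W W' : Set Γ} (h : Disjoint W W') {z : M}
    (hz : z ∈ ⨆ w : W, addFamily ℳ w) : blockProj ℳ W' z = 0 := by
  induction hz using AddSubgroup.iSup_induction' with
  | h1 => rw [map_zero]
  | hadd x y _ _ hx hy => rw [map_add, hx, hy, add_zero]
  | hp e x hx => exact blockProj_of_notMem ℳ (Set.disjoint_left.1 h e.2) hx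

theorem addFamily_homogeneousSMul {R : Type*} [CommRing R] [Module K R] {𝒜 : Γ → Submodule K R}
    [Module R M] [SetLike.GradedSMul 𝒜 ℳ] : HomogeneousSMul (addFamily 𝒜) (addFamily ℳ) :=
  fun _ _ _ _ ha hz => SetLike.GradedSMul.smul_mem (A := 𝒜) (B := ℳ) ha hz

variable {ℳ} {R : Type*} [CommRing R] [Module R M] {𝒜' : Γ → AddSubgroup R}
  {G : Type*} [AddCommGroup G]
  {A : Type*} [CommRing A] {N : Type*} [AddCommGroup N] [Module A N]
  {ρ : A → R} {i : N →+ M} {V W : G → Set Γ} {𝒱 : G → AddSubgroup A} {𝒩 : G → AddSubgroup N}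

theorem smul_mem_iSup_addFamily (h𝒜 : HomogeneousSMul 𝒜' (addFamily ℳ)) {V W X : Set Γ}
    (hVW : ∀ v ∈ V, ∀ w ∈ W, v + w ∈ X) {a : R} {z : M} (ha : a ∈ ⨆ v : V, 𝒜' v)
    (hz : z ∈ ⨆ w : W, addFamily ℳ w) : a • z ∈ ⨆ x : X, addFamily ℳ x := by
  induction ha using AddSubgroup.iSup_induction' with
  | h1 => rw [zero_smul]; exact zero_mem _
  | hadd a b _ _ ha hb => rw [add_smul]; exact add_mem ha hb
  | hp v a ha =>
    induction hz using AddSubgroup.iSup_induction' with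
    | h1 => rw [smul_zero]; exact zero_mem _
    | hadd x y _ _ hx hy => rw [smul_add]; exact add_mem hx hy
    | hp w z hz =>
      exact AddSubgroup.mem_iSup_of_mem (⟨v + w, hVW v v.2 w w.2⟩ : X) (h𝒜 ha hz)

/-- A module whose components are blocks of components of a bigraded module. -/
structure IsBlockModule (𝒜' : Γ → AddSubgroup R) (ℳ : Γ → Submodule K M) (ρ : A → R) (i : N →+ M)
    (V W : G → Set Γ) (𝒱 : G → AddSubgroup A) (𝒩 : G → AddSubgroup N) : Prop where
  inj : Function.Injective i
  map_smul : ∀ a z, i (a • z) = ρ a • i z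
  disjoint : ∀ g g', g ≠ g' → Disjoint (W g) (W g')
  add_mem : ∀ g g', ∀ v ∈ V g, ∀ w ∈ W g', v + w ∈ W (g + g')
  mem_ring : ∀ g, ∀ a ∈ 𝒱 g, ρ a ∈ ⨆ v : V g, 𝒜' v
  mem_iff : ∀ g z, z ∈ 𝒩 g ↔ i z ∈ ⨆ w : W g, addFamily ℳ w
  lift : ∀ g, ∀ m ∈ ⨆ w : W g, addFamily ℳ w, ∃ n, i n = m
  mem_span : ∀ z, i z ∈ ⨆ w : {w // ∃ g, w ∈ W g}, addFamily ℳ w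

namespace IsBlockModule

theorem homogeneousSMul (h : IsBlockModule 𝒜' ℳ ρ i V W 𝒱 𝒩)
    (h𝒜 : HomogeneousSMul 𝒜' (addFamily ℳ)) : HomogeneousSMul 𝒱 𝒩 := by
  intro g e a z ha hz
  rw [h.mem_iff] at hz ⊢
  rw [h.map_smul]
  exact smul_mem_iSup_addFamily h𝒜 (h.add_mem g e) (h.mem_ring g a ha) hz

theorem span (h : IsBlockModule 𝒜' ℳ ρ i V W 𝒱 𝒩) (z : N) : z ∈ ⨆ g, 𝒩 g := by
  have : (⨆ w : {w // ∃ g, w ∈ W g}, addFamily ℳ w) ≤ (⨆ g, 𝒩 g).map i := by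
    refine iSup_le fun w m hm => ?_
    obtain ⟨w, g, hw⟩ := w
    have hm' : m ∈ ⨆ w : W g, addFamily ℳ w := AddSubgroup.mem_iSup_of_mem (⟨w, hw⟩ : W g) hm
    obtain ⟨n, rfl⟩ := h.lift g m hm'
    exact ⟨n, AddSubgroup.mem_iSup_of_mem g ((h.mem_iff g n).2 hm'), rfl⟩
  obtain ⟨n, hn, hni⟩ := this (h.mem_span z)
  rwa [← h.inj hni]

/-- The projection of `M` to a block restricts to `N` because the elements of a block lift to `N`.
It commutes with scalars because a ring element of degree `g` moves block `g'` into block `g + g'`,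
and distinct blocks are disjoint. -/
theorem exists_equivariantProj (h : IsBlockModule 𝒜' ℳ ρ i V W 𝒱 𝒩)
    (h𝒜 : HomogeneousSMul 𝒜' (addFamily ℳ)) :
    ∃ π : G → N →+ N, EquivariantProj 𝒱 𝒩 π := by
  choose n hn using fun g z => h.lift g _ (blockProj_mem ℳ (W g) (i z))
  let π : G → N →+ N := fun g => AddMonoidHom.mk' (n g) fun x y => h.inj (by
    rw [hn, map_add, map_add, map_add, hn, hn])
  have hπ : ∀ g z, i (π g z) = blockProj ℳ (W g) (i z) := hn
  refine ⟨π, ⟨fun e z => ?_, fun e z hz => ?_, fun e e' hee z hz => ?_, fun g e a ha z => ?_⟩⟩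
  · rw [h.mem_iff, hπ]; exact blockProj_mem ℳ _ _
  · rw [h.mem_iff] at hz
    exact h.inj (by rw [hπ, blockProj_self ℳ _ hz])
  · rw [h.mem_iff] at hz
    exact h.inj (by rw [hπ, blockProj_ne ℳ (h.disjoint e e' hee) hz, map_zero])
  · apply h.inj
    rw [hπ, h.map_smul, h.map_smul, hπ]
    have ha' := h.mem_ring g a ha
    have hz := h.mem_span z
    generalize i z = y at hz ⊢
    induction hz using AddSubgroup.iSup_induction' with
    | h1 => simp
    | hadd x y _ _ hx hy => rw [smul_add, map_add, map_add, smul_add, hx, hy]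
    | hp w z hz =>
      obtain ⟨w, g', hw⟩ := w
      have hz' : z ∈ ⨆ w : W g', addFamily ℳ w :=
        AddSubgroup.mem_iSup_of_mem (⟨w, hw⟩ : W g') hz
      have haz := smul_mem_iSup_addFamily h𝒜 (h.add_mem g g') ha' hz'
      by_cases he : g' = e
      · subst he
        rw [blockProj_self ℳ _ haz, blockProj_self ℳ _ hz']
      · rw [blockProj_ne ℳ (h.disjoint g' e he) hz', smul_zero,
          blockProj_ne ℳ (h.disjoint _ _ fun h' => he (add_left_cancel h')) haz]

end IsBlockModule

/-- A bigraded module as the block module with singletons as blocks. -/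
theorem isBlockModule_self [Module K R] {𝒜 : Γ → Submodule K R} :
    IsBlockModule (addFamily 𝒜) ℳ (id : R → R) (AddMonoidHom.id M) (fun e => {e}) (fun e => {e})
      (addFamily 𝒜) (addFamily ℳ) where
  inj := Function.injective_id
  map_smul _ _ := rfl
  disjoint _ _ h := Set.disjoint_singleton.2 h
  add_mem := by rintro g g' _ rfl _ rfl; rfl
  mem_ring g a ha := AddSubgroup.mem_iSup_of_mem (⟨g, rfl⟩ : ({g} : Set Γ)) ha
  mem_iff g z := by
    constructor
    · exact fun ha => AddSubgroup.mem_iSup_of_mem (⟨g, rfl⟩ : ({g} : Set Γ)) ha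
    · intro hz
      refine (iSup_le ?_ : (⨆ w : ({g} : Set Γ), addFamily ℳ w) ≤ addFamily ℳ g) hz
      rintro ⟨_, rfl⟩
      exact le_rfl
  lift _ m _ := ⟨m, rfl⟩
  mem_span z := (iSup_le fun e => le_iSup (fun w : {w // ∃ g, w ∈ ({g} : Set Γ)} => addFamily ℳ w)
    ⟨e, e, rfl⟩ : (⨆ e, addFamily ℳ e) ≤ _) (mem_iSup_addFamily ℳ z)

end

end BlockProjections

/-! ### The subrings `⨁_{e ∈ D} R_e` and resolutions of their residue fields -/

section Subrings

set_option linter.unusedSectionVars false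

universe u v

section Cyclic

variable {A : Type v} [CommRing A] {G : Type} [AddCommGroup G] {𝒜 : G → AddSubgroup A}

variable (𝒜) in
/-- The augmentation of the canonical resolution of a cyclic module. -/
noncomputable abbrev cyclicAug (I : Ideal A) : ((cyclicCpx 𝒜 I).κ →₀ A) →ₗ[A] (A ⧸ I) :=
  Finsupp.linearCombination A ((cyclicStage G I).augBasis 𝒜 (fun _ => Ideal.Quotient.mk I 1))

theorem cyclicAug_single (I : Ideal A) (a : A) :
    cyclicAug 𝒜 I (Finsupp.single (cyclicGen 𝒜 I) a) = Ideal.Quotient.mk I a := by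
  rw [Finsupp.linearCombination_single]
  change a • Ideal.Quotient.mk I 1 = _
  rw [Algebra.smul_def, Ideal.Quotient.algebraMap_eq, ← map_mul, mul_one]

theorem eq_single_cyclicGen (I : Ideal A) {Y : Type*} [AddCommGroup Y] [Module A Y]
    {f : (cyclicCpx 𝒜 I).κ →₀ Y} (hf : ∀ k, (cyclicCpx 𝒜 I).h k ≠ 0 → f k = 0) :
    f = Finsupp.single (cyclicGen 𝒜 I) (f (cyclicGen 𝒜 I)) := by
  ext k
  by_cases hk : cyclicGen 𝒜 I = k
  · subst hk; rw [Finsupp.single_eq_same]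
  · rw [Finsupp.single_eq_of_ne' hk, hf k fun h => hk (eq_cyclicGen I k h).symm]

theorem cyclicCpx_resolves_residue {𝔪 : Ideal A} (h : IsResidueIdeal 𝒜 𝔪) :
    (cyclicCpx 𝒜 𝔪).Resolves (residueFamily 𝔪) (cyclicAug 𝒜 𝔪) := by
  refine cyclicCpx_resolves 𝔪 h.one_mem h.mul_mem h.smul_mem fun e y => ?_
  rw [mem_residueFamily]
  constructor
  · intro hy
    by_cases he : e = 0
    · subst he; exact h.surj y
    · exact ⟨0, zero_mem _, by rw [map_zero, hy he]⟩
  · rintro ⟨a, ha, rfl⟩ he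
    exact Ideal.Quotient.eq_zero_iff_mem.2 (h.mem e he a ha)

/-- In positive homological degrees this is exactness of the resolution. In homological degree 0 and
internal degree `e ≠ 0` the residue module is zero, so every element is a boundary. -/
theorem FreeCpx.Resolves.HV_self {D : FreeCpx.{u} 𝒜} {𝔪 : Ideal A} {ε : (D.κ →₀ A) →ₗ[A] (A ⧸ 𝔪)}
    (hD : D.Resolves (residueFamily 𝔪) ε) {n : ℤ} {e : G} (h : 0 < n ∨ e ≠ 0) :
    D.HV 𝒜 n e := by
  rcases lt_trichotomy n 0 with hn | hn | hn
  · exact HV.of_neg hn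
  · subst hn
    intro f hf _
    exact hD.exact_zero e f hf (hD.ε_mem e f hf (h.resolve_left (lt_irrefl _)))
  · exact hD.exact_pos n hn e

end Cyclic

variable {K : Type*} [Field K] {R : Type v} [CommRing R] [Algebra K R]
  (𝒜 : ℤ × ℤ → Submodule K R) [GradedAlgebra 𝒜] (D : AddSubgroup (ℤ × ℤ))
  {G : Type} [AddCommGroup G] (φ : G →+ ℤ × ℤ) (wt : G →+ ℤ)

/-- The components of `⨁_{e ∈ D} R_e`, indexed through a parametrization of `D`. -/
def subFamily (g : G) : AddSubgroup (gradedSubalgebra 𝒜 D) :=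
  (addFamily 𝒜 (φ g)).comap (gradedSubalgebra 𝒜 D).val.toLinearMap.toAddMonoidHom

/-- The maximal ideal of `⨁_{e ∈ D} R_e`. -/
def subIdeal : Ideal (gradedSubalgebra 𝒜 D) :=
  Ideal.span {x | ∃ g, 0 < wt g ∧ x ∈ subFamily 𝒜 D φ g}

variable {𝒜 D φ wt}

theorem mem_subFamily {g : G} {x : gradedSubalgebra 𝒜 D} :
    x ∈ subFamily 𝒜 D φ g ↔ (x : R) ∈ 𝒜 (φ g) := Iff.rfl

theorem mem_gradedSubalgebra {x : R} {e : ℤ × ℤ} (he : e ∈ D) (hx : x ∈ 𝒜 e) :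
    x ∈ gradedSubalgebra 𝒜 D :=
  (Submodule.mem_iSup_of_mem (p := fun e : D => 𝒜 e) ⟨e, he⟩ hx : x ∈ ⨆ e : D, 𝒜 e)

theorem mem_iSup_of_mem_gradedSubalgebra (x : gradedSubalgebra 𝒜 D) :
    (x : R) ∈ ⨆ e : D, addFamily 𝒜 e := by
  have h : (x : R) ∈ (⨆ e : D, 𝒜 e).toAddSubgroup := x.2
  rwa [Submodule.toAddSubgroup_iSup_eq] at h

theorem gradedSubalgebra_isBlockModule {H : Type*} [AddCommGroup H] {V : H → Set (ℤ × ℤ)}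
    (disjoint : ∀ g g', g ≠ g' → Disjoint (V g) (V g'))
    (add_mem' : ∀ g g', ∀ v ∈ V g, ∀ w ∈ V g', v + w ∈ V (g + g'))
    (hV : ∀ e, e ∈ D ↔ ∃ g, e ∈ V g) {𝒱 : H → AddSubgroup (gradedSubalgebra 𝒜 D)}
    (h𝒱 : ∀ g x, x ∈ 𝒱 g ↔ (x : R) ∈ ⨆ v : V g, addFamily 𝒜 v) :
    IsBlockModule (addFamily 𝒜) 𝒜 (fun x : gradedSubalgebra 𝒜 D => (x : R))
      (gradedSubalgebra 𝒜 D).val.toLinearMap.toAddMonoidHom V V 𝒱 𝒱 where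
  inj := Subtype.val_injective
  map_smul _ _ := rfl
  disjoint := disjoint
  add_mem := add_mem'
  mem_ring g a ha := (h𝒱 g a).1 ha
  mem_iff := h𝒱
  lift g m hm := by
    refine ⟨⟨m, ?_⟩, rfl⟩
    refine (iSup_le fun v x hx => ?_ : (⨆ v : V g, addFamily 𝒜 v) ≤
      (Subalgebra.toSubmodule (gradedSubalgebra 𝒜 D)).toAddSubgroup) hm
    exact mem_gradedSubalgebra ((hV v).2 ⟨g, v.2⟩) hx
  mem_span z := (iSup_le fun e => le_iSup (fun w : {w // ∃ g, w ∈ V g} => addFamily 𝒜 w)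
    ⟨e, (hV e).1 e.2⟩ : (⨆ e : D, addFamily 𝒜 e) ≤ _) (mem_iSup_of_mem_gradedSubalgebra z)

theorem subFamily_isBlockModule (hφ : Function.Injective φ) (hD : ∀ e, e ∈ D ↔ ∃ g, φ g = e) :
    IsBlockModule (addFamily 𝒜) 𝒜 (fun x : gradedSubalgebra 𝒜 D => (x : R))
      (gradedSubalgebra 𝒜 D).val.toLinearMap.toAddMonoidHom (fun g => {φ g}) (fun g => {φ g})
      (subFamily 𝒜 D φ) (subFamily 𝒜 D φ) := by
  refine gradedSubalgebra_isBlockModule ?_ ?_ ?_ ?_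
  · exact fun g g' h => Set.disjoint_singleton.2 (hφ.ne h)
  · rintro g g' _ rfl _ rfl; exact (map_add φ g g').symm
  · exact fun e => (hD e).trans (exists_congr fun g => eq_comm)
  · intro g x
    exact (isBlockModule_self (𝒜 := 𝒜) (ℳ := 𝒜)).mem_iff (φ g) (x : R)

theorem self_homogeneousSMul : HomogeneousSMul (addFamily 𝒜) (addFamily 𝒜) :=
  fun _ _ _ _ ha hb => SetLike.GradedMul.mul_mem (A := 𝒜) ha hb

theorem subIdeal_isResidueIdeal (hneg : ∀ e : ℤ × ℤ, e.1 < 0 ∨ e.2 < 0 → 𝒜 e = ⊥)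
    (hwt : ∀ g, g ≠ 0 → 0 ≤ (φ g).1 → 0 ≤ (φ g).2 → 0 < wt g)
    (hφ : Function.Injective φ) (hD : ∀ e, e ∈ D ↔ ∃ g, φ g = e) :
    IsResidueIdeal (subFamily 𝒜 D φ) (subIdeal 𝒜 D φ wt) := by
  have hb := subFamily_isBlockModule (𝒜 := 𝒜) hφ hD
  obtain ⟨π, hπ⟩ := hb.exists_equivariantProj self_homogeneousSMul
  have hbot : ∀ g, (φ g).1 < 0 ∨ (φ g).2 < 0 → subFamily 𝒜 D φ g = ⊥ := by
    intro g hg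
    rw [eq_bot_iff]
    intro x hx
    rw [mem_subFamily, hneg _ hg] at hx
    exact Subtype.ext hx
  refine isResidueIdeal_span hπ hb.span ?_
    (hb.homogeneousSMul self_homogeneousSMul) ?_ ?_
  · rw [mem_subFamily, map_zero]
    exact SetLike.GradedOne.one_mem
  · intro g hg hg'
    refine hbot g ?_
    by_contra! h
    exact absurd (hwt g hg h.1 h.2) (not_lt.2 hg')
  · intro g hg
    refine hbot _ ?_
    by_contra! h
    have := hwt (-g) (by intro h0; rw [neg_eq_zero] at h0; subst h0; simp at hg) h.1 h.2
    rw [map_neg] at this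
    omega

variable (𝒜 D φ wt) in
/-- The resolution of the residue field of `⨁_{e ∈ D} R_e`. -/
@[reducible] noncomputable def subCpx : FreeCpx.{v} (subFamily 𝒜 D φ) :=
  cyclicCpx (subFamily 𝒜 D φ) (subIdeal 𝒜 D φ wt)

variable (𝒜 D φ wt) in
/-- The resolution of the residue field of `⨁_{e ∈ D} R_e`, tensored with `R`. -/
@[reducible] noncomputable def subCpxBase : FreeCpx.{v} (addFamily 𝒜) :=
  (subCpx 𝒜 D φ wt).map (gradedSubalgebra 𝒜 D).val.toRingHom φ fun _ _ ha => ha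

/-- The degrees of the resolution `P` lie in `D`. In a bidegree of `D` the complex `P ⊗_A R` thus
involves only components of `R` with index in `D`; there it coincides with `P` itself. -/
theorem subCpxBase_HV_self (hneg : ∀ e : ℤ × ℤ, e.1 < 0 ∨ e.2 < 0 → 𝒜 e = ⊥)
    (hwt : ∀ g, g ≠ 0 → 0 ≤ (φ g).1 → 0 ≤ (φ g).2 → 0 < wt g)
    (hφ : Function.Injective φ) (hD : ∀ e, e ∈ D ↔ ∃ g, φ g = e) {n : ℤ} {e : ℤ × ℤ}
    (he : e ∈ D) (h : 0 < n ∨ e ≠ 0) : (subCpxBase 𝒜 D φ wt).HV (addFamily 𝒜) n e := by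
  obtain ⟨g, rfl⟩ := (hD e).1 he
  have hres := cyclicCpx_resolves_residue (subIdeal_isResidueIdeal hneg hwt hφ hD)
  have hHV := hres.HV_self (n := n) (e := g) (h.imp_right fun h h0 => h (by rw [h0, map_zero]))
  intro f hf hd
  let i : gradedSubalgebra 𝒜 D →ₗ[gradedSubalgebra 𝒜 D] R :=
    (Algebra.linearMap (gradedSubalgebra 𝒜 D) R)
  have hmap : ∀ x : (subCpx 𝒜 D φ wt).κ →₀ R, (subCpxBase 𝒜 D φ wt).d R x =
      (subCpx 𝒜 D φ wt).d R x := fun x => FreeCpx.map_d (fun a z => rfl) x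
  have hf0 : f ∈ (subCpx 𝒜 D φ wt).part (fun g' => addFamily 𝒜 (φ g')) n g := fun k => by
    have := hf k
    refine ⟨?_, this.2⟩
    change _ ∈ addFamily 𝒜 (φ (g - (subCpx 𝒜 D φ wt).deg k))
    rw [map_sub]; exact this.1
  obtain ⟨f', hf', rfl⟩ := FreeCpx.exists_lift_part (𝒵 := subFamily 𝒜 D φ) i (fun g' z hz =>
    ⟨⟨z, mem_gradedSubalgebra ((hD _).2 ⟨g', rfl⟩) hz⟩, hz, rfl⟩) hf0
  rw [hmap, FreeCpx.d_mapRange] at hd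
  have hinj : Function.Injective (Finsupp.mapRange.linearMap (α := (subCpx 𝒜 D φ wt).κ) i) :=
    Finsupp.mapRange_injective _ (map_zero i) Subtype.val_injective
  obtain ⟨y, hy, hyd⟩ := hHV f' hf' (hinj (hd.trans (map_zero _).symm))
  refine ⟨Finsupp.mapRange.linearMap i y, fun k => ?_, ?_⟩
  · have := hy k
    refine ⟨?_, fun hk => ?_⟩
    · have h2 : (y k : R) ∈ 𝒜 (φ (g - (subCpx 𝒜 D φ wt).deg k)) := this.1
      rw [map_sub] at h2; exact h2
    · have h2 := this.2 hk
      rw [Finsupp.mapRange.linearMap_apply, Finsupp.mapRange_apply, h2, map_zero]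
  · rw [hmap, FreeCpx.d_mapRange, hyd]

theorem subCpxBase_bd_mem {𝔪 : Ideal R} (h𝔪 : ∀ e, e ≠ 0 → ∀ a ∈ 𝒜 e, a ∈ 𝔪)
    (hφ : Function.Injective φ) (k : (subCpx 𝒜 D φ wt).κ) :
    (subCpxBase 𝒜 D φ wt).bd k (cyclicGen _ (subIdeal 𝒜 D φ wt)) ∈ 𝔪 := by
  have h1 : subIdeal 𝒜 D φ wt ≤ 𝔪.comap (gradedSubalgebra 𝒜 D).val.toRingHom := by
    refine Ideal.span_le.2 ?_
    rintro x ⟨g, hg, hx⟩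
    refine h𝔪 (φ g) (fun h => ?_) _ hx
    rw [map_eq_zero_iff φ hφ] at h
    subst h
    simp at hg
  exact h1 (cyclicCpx_bd_mem (subIdeal 𝒜 D φ wt) k)

theorem subCpxBase_deg (hneg : ∀ e : ℤ × ℤ, e.1 < 0 ∨ e.2 < 0 → 𝒜 e = ⊥)
    (hD : ∀ e, e ∈ D ↔ ∃ g, φ g = e) (k : (subCpx 𝒜 D φ wt).κ) :
    (subCpxBase 𝒜 D φ wt).deg k ∈ D ∧ 0 ≤ (subCpxBase 𝒜 D φ wt).deg k := by
  refine ⟨(hD _).2 ⟨_, rfl⟩, ?_⟩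
  refine cyclicCpx_deg_mem (subIdeal 𝒜 D φ wt) (fun g => 0 ≤ φ g) ?_ ?_ ?_ k
  · intro g g' h h'; rw [map_add]; exact add_nonneg h h'
  · intro g a ha h0
    by_contra h
    refine h0 (Subtype.ext ?_)
    rw [mem_subFamily, hneg _ ?_] at ha
    · exact ha
    · by_contra! h'; exact h ⟨h'.1, h'.2⟩
  · rw [map_zero]

end Subrings

/-! ### Weight gradings: `Tor` over a subring from homology in bidegrees -/

section Coarsening

set_option linter.unusedSectionVars false

universe u v

variable {K : Type*} [Field K] {R : Type v} [CommRing R] [Algebra K R]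
  {𝒜 : ℤ × ℤ → Submodule K R} [GradedAlgebra 𝒜] {D : AddSubgroup (ℤ × ℤ)}
  {G : Type} [AddCommGroup G] {φ : G →+ ℤ × ℤ} {wt : G →+ ℤ}

variable (φ wt) in
/-- The bidegrees of weight `j`. -/
def wtSet (j : ℤ) : Set (ℤ × ℤ) := {e | ∃ g, wt g = j ∧ φ g = e}

/-- The subring `⨁_{e ∈ D} R_e`, graded by weight. -/
structure IsWeightGrading (φ : G →+ ℤ × ℤ) (wt : G →+ ℤ)
    (𝒱 : ℤ → Submodule K (gradedSubalgebra 𝒜 D)) : Prop where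
  neg : ∀ e : ℤ × ℤ, e.1 < 0 ∨ e.2 < 0 → 𝒜 e = ⊥
  wt_pos : ∀ g, g ≠ 0 → 0 ≤ (φ g).1 → 0 ≤ (φ g).2 → 0 < wt g
  inj : Function.Injective φ
  mem_D : ∀ e, e ∈ D ↔ ∃ g, φ g = e
  mem_iff : ∀ j x, x ∈ 𝒱 j ↔ (x : R) ∈ ⨆ v : wtSet φ wt j, addFamily 𝒜 v

variable {𝒱 : ℤ → Submodule K (gradedSubalgebra 𝒜 D)}

namespace IsWeightGrading

theorem isBlockModule (h : IsWeightGrading φ wt 𝒱) :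
    IsBlockModule (addFamily 𝒜) 𝒜 (fun x : gradedSubalgebra 𝒜 D => (x : R))
      (gradedSubalgebra 𝒜 D).val.toLinearMap.toAddMonoidHom (wtSet φ wt) (wtSet φ wt)
      (addFamily 𝒱) (addFamily 𝒱) := by
  refine gradedSubalgebra_isBlockModule ?_ ?_ ?_ h.mem_iff
  · intro j j' hj
    rw [Set.disjoint_left]
    rintro _ ⟨g, rfl, rfl⟩ ⟨g', rfl, hg⟩
    exact hj (by rw [h.inj hg])
  · rintro _ _ _ ⟨g, rfl, rfl⟩ _ ⟨g', rfl, rfl⟩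
    exact ⟨g + g', map_add _ _ _, map_add _ _ _⟩
  · intro e
    rw [h.mem_D]
    constructor
    · rintro ⟨g, rfl⟩; exact ⟨_, g, rfl, rfl⟩
    · rintro ⟨_, g, -, rfl⟩; exact ⟨g, rfl⟩

theorem subFamily_le (h : IsWeightGrading φ wt 𝒱) {g : G} {x : gradedSubalgebra 𝒜 D}
    (hx : x ∈ subFamily 𝒜 D φ g) : x ∈ 𝒱 (wt g) :=
  (h.mem_iff _ _).2 (AddSubgroup.mem_iSup_of_mem
    (⟨φ g, g, rfl, rfl⟩ : wtSet φ wt (wt g)) hx)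

theorem eq_iSup (h : IsWeightGrading φ wt 𝒱) (j : ℤ) :
    addFamily 𝒱 j = ⨆ g : {g // wt g = j}, subFamily 𝒜 D φ g := by
  refine le_antisymm (fun x hx => ?_) (iSup_le ?_)
  · have hx' := (h.mem_iff _ _).1 hx
    have h1 : (⨆ v : wtSet φ wt j, addFamily 𝒜 v) ≤
        (⨆ g : {g // wt g = j}, subFamily 𝒜 D φ g).map
          (gradedSubalgebra 𝒜 D).val.toLinearMap.toAddMonoidHom := by
      refine iSup_le ?_
      rintro ⟨_, g, hg, rfl⟩ y hy
      exact ⟨⟨y, mem_gradedSubalgebra ((h.mem_D _).2 ⟨g, rfl⟩) hy⟩,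
        AddSubgroup.mem_iSup_of_mem (⟨g, hg⟩ : {g // wt g = j}) hy, rfl⟩
    obtain ⟨y, hy, hyx⟩ := h1 hx'
    rwa [← show y = x from Subtype.ext hyx]
  · rintro ⟨g, rfl⟩ x hx
    exact h.subFamily_le hx

theorem positiveIdeal_eq (h : IsWeightGrading φ wt 𝒱) :
    positiveIdeal 𝒱 = subIdeal 𝒜 D φ wt :=
  positiveIdeal_eq_span h.eq_iSup

theorem bot_of_wt (h : IsWeightGrading φ wt 𝒱) {g : G} (hg : g ≠ 0) (hg' : wt g ≤ 0) :
    𝒜 (φ g) = ⊥ := by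
  refine h.neg _ ?_
  by_contra! h'
  exact absurd (h.wt_pos g hg h'.1 h'.2) (not_lt.2 hg')

theorem isResidueIdeal (h : IsWeightGrading φ wt 𝒱) :
    IsResidueIdeal (addFamily 𝒱) (positiveIdeal 𝒱) := by
  obtain ⟨π, hπ⟩ := h.isBlockModule.exists_equivariantProj self_homogeneousSMul
  have hbot : ∀ j, j < 0 → addFamily 𝒱 j = ⊥ := by
    intro j hj
    rw [h.eq_iSup, eq_bot_iff]
    refine iSup_le ?_
    rintro ⟨g, rfl⟩ x hx
    rw [mem_subFamily, h.bot_of_wt (by rintro rfl; simp at hj) hj.le] at hx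
    exact Subtype.ext hx
  refine isResidueIdeal_span (wt := id) hπ h.isBlockModule.span ?_
    (h.isBlockModule.homogeneousSMul self_homogeneousSMul) ?_ ?_
  · have h1 : (1 : gradedSubalgebra 𝒜 D) ∈ 𝒱 (wt 0) := h.subFamily_le (by
      rw [mem_subFamily, map_zero]
      exact SetLike.GradedOne.one_mem)
    rwa [map_zero] at h1
  · intro g hg hg'
    exact hbot g (lt_of_le_of_ne hg' hg)
  · intro g hg
    exact hbot _ (neg_neg_of_pos hg)

variable {M : Type*} [AddCommGroup M] [Module K M] [Module R M]
  {ℳ : ℤ × ℤ → Submodule K M} [DirectSum.Decomposition ℳ] [SetLike.GradedSMul 𝒜 ℳ]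
  {N : Type*} [AddCommGroup N] [Module (gradedSubalgebra 𝒜 D) N]
  {i : N →+ M} {W : ℤ → Set (ℤ × ℤ)} {𝒩 : ℤ → AddSubgroup N}

/-- The resolution of the residue field of `⨁_{e ∈ D} R_e`, graded by weight. -/
@[reducible] noncomputable def cpx (h : IsWeightGrading φ wt 𝒱) : FreeCpx.{v} (addFamily 𝒱) :=
  (subCpx 𝒜 D φ wt).map (RingHom.id _) wt fun _ _ ha => h.subFamily_le ha

theorem cpx_d (h : IsWeightGrading φ wt 𝒱) {Z : Type*} [AddCommGroup Z]
    [Module (gradedSubalgebra 𝒜 D) Z] (x : (subCpx 𝒜 D φ wt).κ →₀ Z) :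
    h.cpx.d Z x = (subCpx 𝒜 D φ wt).d Z x := FreeCpx.map_d (fun _ _ => rfl) x

/-- The weight `j` part of `P ⊗ N` is the sum of the bidegrees in `W j` of `P ⊗ M`. The condition
`hW` ensures that the coefficients of a basis element of degree `δ` fill the whole block `W (j - wt
δ)`. -/
theorem HV_of_blocks (h : IsWeightGrading φ wt 𝒱)
    (hN : IsBlockModule (addFamily 𝒜) ℳ (fun x : gradedSubalgebra 𝒜 D => (x : R)) i
      (wtSet φ wt) W (addFamily 𝒱) 𝒩)
    (hW : ∀ j g w, w ∈ W j ↔ w + φ g ∈ W (j + wt g)) {n j : ℤ}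
    (hHV : ∀ w ∈ W j, (subCpxBase 𝒜 D φ wt).HV (addFamily ℳ) n w) : h.cpx.HV 𝒩 n j := by
  intro f hf hd
  let A := gradedSubalgebra 𝒜 D
  let _ : Module A M := Module.compHom M (gradedSubalgebra 𝒜 D).val.toRingHom
  let il : N →ₗ[A] M := { i with map_smul' := hN.map_smul }
  have hmap : ∀ x : (subCpx 𝒜 D φ wt).κ →₀ M, (subCpxBase 𝒜 D φ wt).d M x =
      (subCpx 𝒜 D φ wt).d M x := fun x => FreeCpx.map_d (fun a z => rfl) x
  have hset : ∀ k : (subCpx 𝒜 D φ wt).κ,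
      (⨆ w : W j, addFamily ℳ (w - φ ((subCpx 𝒜 D φ wt).deg k))) =
        ⨆ w : W (j - wt ((subCpx 𝒜 D φ wt).deg k)), addFamily ℳ w := by
    intro k
    set δ := (subCpx 𝒜 D φ wt).deg k
    refine le_antisymm (iSup_le fun w => ?_) (iSup_le fun w => ?_)
    · refine le_iSup (fun w : W (j - wt δ) => addFamily ℳ w) ⟨w - φ δ, ?_⟩
      rw [hW _ δ, sub_add_cancel, sub_add_cancel]
      exact w.2
    · refine le_iSup_of_le (⟨w + φ δ, ?_⟩ : W j) ?_
      · have := (hW _ δ _).1 w.2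
        rwa [sub_add_cancel] at this
      · rw [add_sub_cancel_right]
  obtain ⟨π, hπ⟩ := (isBlockModule_self (𝒜 := 𝒜) (ℳ := ℳ)).exists_equivariantProj
    (addFamily_homogeneousSMul ℳ)
  obtain ⟨y, hy, hy', hyd⟩ := FreeCpx.HV.coarsen (addFamily_homogeneousSMul ℳ) hπ (W j) hHV
    (Finsupp.mapRange.linearMap (α := (subCpx 𝒜 D φ wt).κ) il f)
    (fun k => by
      refine (hset k).symm ▸ ?_
      rw [Finsupp.mapRange.linearMap_apply, Finsupp.mapRange_apply]
      exact (hN.mem_iff _ _).1 (hf k).1)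
    (fun k hk => by
      rw [Finsupp.mapRange.linearMap_apply, Finsupp.mapRange_apply, (hf k).2 hk, map_zero])
    (by
      rw [hmap, FreeCpx.d_mapRange, ← h.cpx_d, hd, map_zero])
  have hlift : ∀ k, ∃ n, il n = y k ∧ (y k = 0 → n = 0) := by
    intro k
    have hk := hy k
    by_cases h0 : y k = 0
    · exact ⟨0, by rw [map_zero, h0], fun _ => rfl⟩
    · obtain ⟨n, hn⟩ := hN.lift (j - wt ((subCpx 𝒜 D φ wt).deg k)) (y k) ((hset k) ▸ hk)
      exact ⟨n, hn, fun h => absurd h h0⟩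
  choose z hz hz0 using hlift
  let y' : (subCpx 𝒜 D φ wt).κ →₀ N := Finsupp.onFinset y.support z fun k hk => by
    rw [Finsupp.mem_support_iff]; exact fun h => hk (hz0 k h)
  have hy'' : Finsupp.mapRange.linearMap il y' = y := by
    ext k
    exact hz k
  refine ⟨y', fun k => ⟨?_, fun hk => hz0 k (hy' k hk)⟩, ?_⟩
  · rw [hN.mem_iff]
    change il (z k) ∈ _
    rw [hz]
    exact (hset k) ▸ hy k
  · rw [hmap, ← hy'', FreeCpx.d_mapRange, ← h.cpx_d] at hyd
    exact Finsupp.mapRange_injective i (map_zero i) hN.inj hyd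

/-- Coarsening bidegrees to weights keeps the resolution a resolution. Exactness away from
homological degree 0 and weight 0 is the block criterion applied to the subring itself. -/
theorem cpx_resolves (h : IsWeightGrading φ wt 𝒱) :
    h.cpx.Resolves (residueFamily (subIdeal 𝒜 D φ wt))
      (cyclicAug (subFamily 𝒜 D φ) (subIdeal 𝒜 D φ wt)) := by
  have h𝔪 := h.isResidueIdeal
  rw [h.positiveIdeal_eq] at h𝔪
  have hfine := cyclicCpx_resolves_residue (subIdeal_isResidueIdeal (𝒜 := 𝒜) h.neg h.wt_pos
    h.inj h.mem_D)
  have hW : ∀ j g w, w ∈ wtSet φ wt j ↔ w + φ g ∈ wtSet φ wt (j + wt g) := by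
    intro j g w
    constructor
    · rintro ⟨g', rfl, rfl⟩
      exact ⟨g' + g, map_add _ _ _, map_add _ _ _⟩
    · rintro ⟨g', hg', hw⟩
      exact ⟨g' - g, by rw [map_sub, hg', add_sub_cancel_right],
        by rw [map_sub, hw, add_sub_cancel_right]⟩
  have hHV : ∀ {n j : ℤ}, 0 < n ∨ j ≠ 0 → h.cpx.HV (addFamily 𝒱) n j := by
    intro n j hn
    refine h.HV_of_blocks h.isBlockModule hW ?_
    rintro _ ⟨g, rfl, rfl⟩
    refine subCpxBase_HV_self h.neg h.wt_pos h.inj h.mem_D ((h.mem_D _).2 ⟨g, rfl⟩)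
      (hn.imp_right fun h0 h1 => h0 ?_)
    rw [(map_eq_zero_iff φ h.inj).1 h1, map_zero]
  have hsingle : ∀ e, ∀ x ∈ h.cpx.part (addFamily 𝒱) 0 e,
      x (cyclicGen _ (subIdeal 𝒜 D φ wt)) ∈ 𝒱 e ∧
      cyclicAug (subFamily 𝒜 D φ) (subIdeal 𝒜 D φ wt) x =
        Ideal.Quotient.mk _ (x (cyclicGen _ (subIdeal 𝒜 D φ wt))) ∧
      (x (cyclicGen _ (subIdeal 𝒜 D φ wt)) = 0 → x = 0) := by
    intro e x hx
    have h1 := eq_single_cyclicGen (subIdeal 𝒜 D φ wt) (f := x)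
      (fun k hk => (hx k).2 (by exact_mod_cast hk))
    refine ⟨?_, ?_, fun h0 => ?_⟩
    · have := (hx (cyclicGen _ (subIdeal 𝒜 D φ wt))).1
      change _ ∈ 𝒱 (e - wt 0) at this
      rwa [map_zero, sub_zero] at this
    · exact (congrArg _ h1).trans (cyclicAug_single _ _)
    · rw [h1, h0, Finsupp.single_zero]
  refine ⟨h𝔪.one_mem, h𝔪.mul_mem, h𝔪.smul_mem, hfine.ε_zero, ?_, ?_, ?_, ?_, ?_⟩
  · intro e x hx he
    rw [(hsingle e x hx).2.1, Ideal.Quotient.eq_zero_iff_mem]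
    exact h𝔪.mem e he _ (hsingle e x hx).1
  · intro x
    rw [h.cpx_d]
    exact hfine.ε_d x
  · intro e y hy
    by_cases he : e = 0
    · subst he
      obtain ⟨x, hx, hxy⟩ := hfine.surj 0 y (fun h0 => absurd rfl h0)
      refine ⟨x, fun k => ⟨?_, (hx k).2⟩, hxy⟩
      have h1 := h.subFamily_le (hx k).1
      rw [map_sub, map_zero] at h1
      exact h1
    · exact ⟨0, zero_mem _, by rw [map_zero, hy he]⟩
  · intro e x hx hx0
    by_cases he : e = 0
    · subst he
      refine ⟨0, zero_mem _, ?_⟩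
      obtain ⟨h1, h2, h3⟩ := hsingle 0 x hx
      rw [map_zero, h3 (h𝔪.zero _ h1 (Ideal.Quotient.eq_zero_iff_mem.1 (h2.symm.trans hx0)))]
    · exact hHV (Or.inr he) x hx
        (FreeCpx.eq_zero_of_mem_part (by omega) (FreeCpx.d_mem_part h𝔪.mul_mem hx))
  · exact fun n hn e => hHV (Or.inl hn)

end IsWeightGrading

/-- `Tor` over `⨁_{e ∈ D} R_e` is controlled by the homology of `P ⊗ M` in bidegrees. -/
theorem IsWeightGrading.not_torNonzero (h : IsWeightGrading φ wt 𝒱)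
    {M : Type*} [AddCommGroup M] [Module K M] [Module R M]
    {ℳ : ℤ × ℤ → Submodule K M} [DirectSum.Decomposition ℳ] [SetLike.GradedSMul 𝒜 ℳ]
    {N : Type*} [AddCommGroup N] [Module K N] [Module (gradedSubalgebra 𝒜 D) N]
    {i : N →+ M} {W : ℤ → Set (ℤ × ℤ)} {𝒩 : ℤ → Submodule K N}
    (hN : IsBlockModule (addFamily 𝒜) ℳ (fun x : gradedSubalgebra 𝒜 D => (x : R)) i
      (wtSet φ wt) W (addFamily 𝒱) (addFamily 𝒩))
    (hW : ∀ j g w, w ∈ W j ↔ w + φ g ∈ W (j + wt g)) {s : ℕ} {j : ℤ}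
    (hHV : ∀ w ∈ W j, (subCpxBase 𝒜 D φ wt).HV (addFamily ℳ) s w) : ¬ TorNonzero 𝒱 𝒩 s j := by
  obtain ⟨πA, hA⟩ := h.isBlockModule.exists_equivariantProj self_homogeneousSMul
  obtain ⟨πN, hπN⟩ := hN.exists_equivariantProj (addFamily_homogeneousSMul ℳ)
  have hres : ∃ ε, h.cpx.Resolves (residueFamily (subIdeal 𝒜 D φ wt)) ε := ⟨_, h.cpx_resolves⟩
  rw [← h.positiveIdeal_eq] at hres
  obtain ⟨ε, hres⟩ := hres
  exact not_torNonzero_of_HV hA hπN (hN.homogeneousSMul (addFamily_homogeneousSMul ℳ))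
    h.isBlockModule.span h.isResidueIdeal hres (h.HV_of_blocks hN hW hHV)

end Coarsening

/-! ### Algebra retracts and ideals with linear resolution -/

section Retracts

set_option linter.unusedSectionVars false

universe u v

variable {K : Type*} [Field K] {R : Type v} [CommRing R] [Algebra K R]
  {𝒜 : ℤ × ℤ → Submodule K R} [GradedAlgebra 𝒜]

theorem self_exists_equivariantProj :
    ∃ π, EquivariantProj (addFamily 𝒜) (addFamily 𝒜) π :=
  (isBlockModule_self (𝒜 := 𝒜) (ℳ := 𝒜)).exists_equivariantProj self_homogeneousSMul

theorem one_mem_addFamily : (1 : R) ∈ addFamily 𝒜 0 := SetLike.GradedOne.one_mem (A := 𝒜)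

theorem totalIdeal_isResidueIdeal (hneg : ∀ e : ℤ × ℤ, e.1 < 0 ∨ e.2 < 0 → 𝒜 e = ⊥) :
    IsResidueIdeal (addFamily 𝒜) (positiveIdeal (totalGrading 𝒜)) := by
  have hbot : ∀ e : ℤ × ℤ, e.1 < 0 ∨ e.2 < 0 → addFamily 𝒜 e = ⊥ := by
    intro e he
    change (𝒜 e).toAddSubgroup = ⊥
    rw [hneg e he]; rfl
  obtain ⟨π, hπ⟩ := self_exists_equivariantProj (𝒜 := 𝒜)
  rw [positiveIdeal_eq_span (totalGrading_eq 𝒜)]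
  refine isResidueIdeal_span hπ (mem_iSup_addFamily 𝒜) one_mem_addFamily self_homogeneousSMul ?_ ?_
  · intro e he he'
    refine hbot e ?_
    by_contra! h
    rw [totalDegree_apply] at he'
    exact he (Prod.ext (by simp; omega) (by simp; omega))
  · intro e he
    refine hbot _ ?_
    rw [totalDegree_apply] at he
    simp only [Prod.fst_neg, Prod.snd_neg]
    omega

variable (K) in
/-- The residue field in bidegree zero. -/
noncomputable def residueBigrading (𝔪 : Ideal R) (e : ℤ × ℤ) : Submodule K (R ⧸ 𝔪) :=
  if e = 0 then ⊤ else ⊥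

theorem addFamily_residueBigrading (𝔪 : Ideal R) :
    addFamily (residueBigrading K 𝔪) = residueFamily 𝔪 := by
  ext e x
  change x ∈ residueBigrading K 𝔪 e ↔ _
  rw [mem_residueFamily, residueBigrading]
  split_ifs with h
  · simp [h]
  · simp [h]

theorem totalGrading_residueBigrading :
    totalGrading (residueBigrading K (positiveIdeal (totalGrading 𝒜))) =
      residueGrading (totalGrading 𝒜) := by
  ext j x
  unfold totalGrading residueGrading
  split_ifs with h
  · subst h
    refine ⟨fun _ => trivial, fun _ => ?_⟩
    refine Submodule.mem_iSup_of_mem (⟨0, rfl⟩ : {e : ℤ × ℤ // e.1 + e.2 = 0}) ?_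
    rw [residueBigrading, if_pos rfl]
    trivial
  · constructor
    · intro hx
      refine (iSup_le ?_ : (⨆ e : {e : ℤ × ℤ // e.1 + e.2 = j},
        residueBigrading K (positiveIdeal (totalGrading 𝒜)) e) ≤ ⊥) hx
      rintro ⟨e, he⟩
      rw [residueBigrading, if_neg]
      rintro rfl
      exact h he.symm
    · intro hx
      rw [(Submodule.mem_bot K).1 hx]
      exact zero_mem _

/-- The homological form of the Koszul property, for arbitrary bigraded resolutions of the residue
field. -/
theorem HV_residue_of_koszul (hneg : ∀ e : ℤ × ℤ, e.1 < 0 ∨ e.2 < 0 → 𝒜 e = ⊥)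
    (hK : ∀ (s : ℕ) (j : ℤ),
      TorNonzero (totalGrading 𝒜) (residueGrading (totalGrading 𝒜)) s j → j ≤ s)
    {X : FreeCpx.{v} (addFamily 𝒜)}
    {ε : (X.κ →₀ R) →ₗ[R] (R ⧸ positiveIdeal (totalGrading 𝒜))}
    (hX : X.Resolves (residueFamily (positiveIdeal (totalGrading 𝒜))) ε) {n : ℤ} {e : ℤ × ℤ}
    (h : n < totalDegree e) : X.HV (residueFamily (positiveIdeal (totalGrading 𝒜))) n e := by
  rcases lt_or_ge n 0 with hn | hn
  · exact FreeCpx.HV.of_neg hn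
  obtain ⟨s, rfl⟩ := Int.eq_ofNat_of_zero_le hn
  obtain ⟨π, hπ⟩ := self_exists_equivariantProj (𝒜 := 𝒜)
  have h𝔪 := totalIdeal_isResidueIdeal hneg
  have hres := residue_equivariantProj _ h𝔪
  rw [← addFamily_residueBigrading (K := K)] at hX hres
  refine FreeCpx.HV.of_not_torNonzero hX hπ hres (mem_iSup_addFamily 𝒜) ?_ h𝔪 ?_
  · intro y
    refine AddSubgroup.mem_iSup_of_mem 0 ?_
    rw [addFamily_residueBigrading]
    exact fun h0 => absurd rfl h0
  · rw [totalGrading_residueBigrading]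
    intro h1
    exact absurd (hK _ _ h1) (not_le.2 h)

variable (c : ℤ × ℤ →+ ℤ)

variable (𝒜) in
/-- The ideal generated by the components with `0 < c e`. -/
def coneIdeal : Ideal R := Ideal.span {x | ∃ e, 0 < c e ∧ x ∈ addFamily 𝒜 e}

variable (𝒜) in
/-- The components with `0 < c e`. -/
noncomputable def coneFamily (e : ℤ × ℤ) : AddSubgroup R := if 0 < c e then addFamily 𝒜 e else ⊥

variable (𝒜) in
/-- The components of the quotient by the ideal generated by the components with `0 < c e`. -/
def coneQuotientFamily (e : ℤ × ℤ) : AddSubgroup (R ⧸ coneIdeal 𝒜 c) :=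
  (addFamily 𝒜 e).map (Ideal.Quotient.mk (coneIdeal 𝒜 c)).toAddMonoidHom

variable {c}

/-- `c` is nonnegative wherever the ring lives, so a multiple of an element with `0 < c` cannot
reach a degree with `c ≤ 0`. The ideal is thus a sum of full components. -/
theorem mem_coneIdeal_iff (hneg : ∀ e : ℤ × ℤ, e.1 < 0 ∨ e.2 < 0 → 𝒜 e = ⊥)
    (hc : ∀ e : ℤ × ℤ, 0 ≤ e.1 → 0 ≤ e.2 → 0 ≤ c e) {e : ℤ × ℤ} {x : R} (hx : x ∈ 𝒜 e) :
    x ∈ coneIdeal 𝒜 c ↔ x ∈ coneFamily 𝒜 c e := by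
  unfold coneFamily
  split_ifs with h
  · exact ⟨fun _ => hx, fun _ => Ideal.subset_span ⟨e, h, hx⟩⟩
  · refine ⟨fun hx' => ?_, fun hx' => ?_⟩
    · obtain ⟨π, hπ⟩ := self_exists_equivariantProj (𝒜 := 𝒜)
      refine eq_zero_of_mem_span hπ (mem_iSup_addFamily 𝒜) self_homogeneousSMul
        (fun g g' hg hgg => ?_) hx hx'
      change (𝒜 g').toAddSubgroup = ⊥
      rw [hneg g' ?_]
      · rfl
      by_contra! h'
      have := hc g' h'.1 h'.2
      rw [← hgg, map_add] at h
      omega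
    · rw [AddSubgroup.mem_bot.1 hx']; exact zero_mem _

theorem coneFamily_eq (hneg : ∀ e : ℤ × ℤ, e.1 < 0 ∨ e.2 < 0 → 𝒜 e = ⊥)
    (hc : ∀ e : ℤ × ℤ, 0 ≤ e.1 → 0 ≤ e.2 → 0 ≤ c e) :
    (fun e => addFamily 𝒜 e ⊓ (LinearMap.ker (coneIdeal 𝒜 c).mkQ).toAddSubgroup) =
      coneFamily 𝒜 c := by
  ext e x
  rw [Submodule.ker_mkQ]
  constructor
  · rintro ⟨hx, hx'⟩
    exact (mem_coneIdeal_iff hneg hc hx).1 hx'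
  · intro hx
    have hx' : x ∈ 𝒜 e := by
      unfold coneFamily at hx
      split_ifs at hx
      · exact hx
      · rw [AddSubgroup.mem_bot.1 hx]; exact zero_mem _
    exact ⟨hx', (mem_coneIdeal_iff hneg hc hx').2 hx⟩

theorem mem_coneQuotientFamily {e : ℤ × ℤ} {y : R ⧸ coneIdeal 𝒜 c} :
    y ∈ coneQuotientFamily 𝒜 c e ↔ ∃ a ∈ addFamily 𝒜 e, Ideal.Quotient.mk _ a = y := Iff.rfl

theorem coneQuotientFamily_homogeneousSMul :
    HomogeneousSMul (addFamily 𝒜) (coneQuotientFamily 𝒜 c) := by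
  rintro g e a _ ha ⟨b, hb, rfl⟩
  exact ⟨a * b, self_homogeneousSMul ha hb, map_mul (Ideal.Quotient.mk _) _ _⟩

/-- If the subring of the components with `c e = 0` is a retract of a Koszul algebra, then the
ideal of the other components has a linear resolution. -/
theorem HV_coneFamily (hneg : ∀ e : ℤ × ℤ, e.1 < 0 ∨ e.2 < 0 → 𝒜 e = ⊥)
    (hK : ∀ (s : ℕ) (j : ℤ),
      TorNonzero (totalGrading 𝒜) (residueGrading (totalGrading 𝒜)) s j → j ≤ s)
    (hc : ∀ e : ℤ × ℤ, 0 ≤ e.1 → 0 ≤ e.2 → 0 ≤ c e)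
    {P : FreeCpx.{u} (addFamily 𝒜)}
    {ε : (P.κ →₀ R) →ₗ[R] (R ⧸ positiveIdeal (totalGrading 𝒜))}
    (hP : P.Resolves (residueFamily (positiveIdeal (totalGrading 𝒜))) ε) {n : ℤ} {e : ℤ × ℤ}
    (h : n + 1 < totalDegree e) : P.HV (coneFamily 𝒜 c) n e := by
  rcases lt_or_ge n 0 with hn | hn
  · exact FreeCpx.HV.of_neg hn
  have h𝔪 := totalIdeal_isResidueIdeal hneg
  set 𝔪 := positiveIdeal (totalGrading 𝒜)
  let φ : c.ker →+ ℤ × ℤ := c.ker.subtype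
  let wt : c.ker →+ ℤ := totalDegree.comp φ
  have hφ : Function.Injective φ := Subtype.val_injective
  have hD : ∀ e, e ∈ c.ker ↔ ∃ g, φ g = e := fun e =>
    ⟨fun h => ⟨⟨e, h⟩, rfl⟩, by rintro ⟨g, rfl⟩; exact g.2⟩
  have hwt : ∀ g, g ≠ 0 → 0 ≤ (φ g).1 → 0 ≤ (φ g).2 → 0 < wt g := by
    intro g hg h1 h2
    change 0 < (φ g).1 + (φ g).2
    by_contra h3
    refine hg (hφ ?_)
    rw [map_zero]
    exact Prod.ext (by simp; omega) (by simp; omega)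
  -- `Y` is the base change to `R` of a resolution of K over the subring of the components with `c e
  -- = 0`; `E` below resolves the quotient `R/I` over `R`.
  let Y := subCpxBase 𝒜 c.ker φ wt
  let E := cyclicCpx (addFamily 𝒜) (coneIdeal 𝒜 c)
  have hE : E.Resolves (coneQuotientFamily 𝒜 c) (cyclicAug (addFamily 𝒜) (coneIdeal 𝒜 c)) :=
    cyclicCpx_resolves _ one_mem_addFamily self_homogeneousSMul
      coneQuotientFamily_homogeneousSMul fun e y => mem_coneQuotientFamily
  have hle : coneIdeal 𝒜 c ≤ 𝔪 := by
    refine Ideal.span_le.2 ?_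
    rintro x ⟨e, he, hx⟩
    exact h𝔪.mem e (by rintro rfl; simp at he) x hx
  have hsurj : ∀ e, ∀ z ∈ coneQuotientFamily 𝒜 c e, ∃ y ∈ addFamily 𝒜 e,
      (coneIdeal 𝒜 c).mkQ y = z := fun e z hz => hz
  have hmem : ∀ e, ∀ z ∈ addFamily 𝒜 e, (coneIdeal 𝒜 c).mkQ z ∈ coneQuotientFamily 𝒜 c e :=
    fun e z hz => ⟨z, hz, rfl⟩
  -- The subring maps isomorphically onto `R/I`, so `Y ⊗ R/I` is a resolution of K over that
  -- subring. In degrees with `c e = 0` the ideal contributes nothing and `Y ⊗ R` is exact; in all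
  -- other degrees `R/I` is zero.
  have hY : ∀ n e, n ≠ 0 ∨ e ≠ 0 → Y.HV (coneQuotientFamily 𝒜 c) n e := by
    intro n e hne
    have hdeg : ∀ k, c (Y.deg k) = 0 := fun k => (subCpxBase_deg (𝒜 := 𝒜) hneg hD k).1
    by_cases hce : c e = 0
    · refine FreeCpx.HV.quotient self_homogeneousSMul (coneIdeal 𝒜 c).mkQ hmem hsurj ?_ ?_
      · rcases lt_trichotomy n 0 with hn | hn | hn
        · exact FreeCpx.HV.of_neg hn
        · exact subCpxBase_HV_self hneg hwt hφ hD hce (Or.inr (hne.resolve_left (not_not.2 hn)))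
        · exact subCpxBase_HV_self hneg hwt hφ hD hce (Or.inl hn)
      · rw [coneFamily_eq hneg hc]
        refine FreeCpx.HV.of_bot fun k => ?_
        rw [coneFamily, if_neg]
        rw [map_sub, hdeg, hce]; simp
    · refine FreeCpx.HV.of_bot fun k => ?_
      rw [eq_bot_iff]
      rintro _ ⟨x, hx, rfl⟩
      refine Ideal.Quotient.eq_zero_iff_mem.2 ?_
      rw [mem_coneIdeal_iff hneg hc hx, coneFamily]
      split_ifs with h1
      · exact hx
      · have hx' : x ∈ 𝒜 (e - Y.deg k) := hx
        rw [hneg (e - Y.deg k) ?_] at hx'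
        · exact hx'
        · by_contra! h2
          have h3 := hc (e - Y.deg k) h2.1 h2.2
          rw [map_sub, hdeg, sub_zero] at h1 h3
          omega
  -- Hence `Y ⊗ E` resolves K over `R`.
  have hX := FreeCpx.Resolves.tensor_resolves (D := Y) (E := E) (h0 := self_homogeneousSMul)
    (h1 := one_mem_addFamily) (l₀ := cyclicGen _ (subIdeal 𝒜 c.ker φ wt))
    (k₀ := cyclicGen _ (coneIdeal 𝒜 c)) h𝔪 hE rfl (map_zero φ)
    (fun l hl => eq_cyclicGen (𝒜 := subFamily 𝒜 c.ker φ) (subIdeal 𝒜 c.ker φ wt) l hl) rfl rfl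
    (fun k hk => eq_cyclicGen (𝒜 := addFamily 𝒜) (coneIdeal 𝒜 c) k hk)
    (subCpxBase_bd_mem h𝔪.mem hφ)
    (fun k => hle (cyclicCpx_bd_mem (coneIdeal 𝒜 c) k)) hY
  -- `Tor(R/I, K)` is a summand of `Tor(K, K)`, so it inherits the Koszul vanishing. The passage to
  -- `I` shifts the homological degree by one.
  have hHV : ∀ {n : ℤ} {e : ℤ × ℤ}, n < totalDegree e → P.HV (coneQuotientFamily 𝒜 c) n e := by
    intro n e hne
    refine hP.balance hE ?_
    exact FreeCpx.HV.of_tensor (D := Y) (l₀ := cyclicGen _ (subIdeal 𝒜 c.ker φ wt))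
      self_homogeneousSMul one_mem_addFamily rfl
      (map_zero φ) (subCpxBase_bd_mem h𝔪.mem hφ) (HV_residue_of_koszul hneg hK hX hne)
  rw [← coneFamily_eq hneg hc]
  refine FreeCpx.HV.kernel (coneIdeal 𝒜 c).mkQ self_homogeneousSMul hmem hsurj ?_ (hHV h)
  refine hP.HV_self (Or.inr ?_)
  rintro rfl
  rw [map_zero] at h
  omega

end Retracts

/-! ### Dimension shifting over `R` and vanishing of `Tor(R, K)` over the subring -/

section Estimates

set_option linter.unusedSectionVars false

universe u v w

variable {K : Type*} [Field K] {R : Type v} [CommRing R] [Algebra K R]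
  {𝒜 : ℤ × ℤ → Submodule K R} [GradedAlgebra 𝒜]

variable (𝒜) in
/-- The canonical bigraded resolution of the residue field. -/
@[reducible] noncomputable def residueCpx : FreeCpx.{v} (addFamily 𝒜) :=
  cyclicCpx (addFamily 𝒜) (positiveIdeal (totalGrading 𝒜))

/-- A graded module which vanishes outside of `v₀ + ℕ²` and has regularity at most `r`. -/
structure HasRegularityBound {Z : Type*} [AddCommGroup Z] [Module R Z]
    (𝒜 : ℤ × ℤ → Submodule K R) [GradedAlgebra 𝒜] (𝒵 : ℤ × ℤ → AddSubgroup Z)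
    (v₀ : ℤ × ℤ) (r : ℤ) : Prop where
  smul : HomogeneousSMul (addFamily 𝒜) 𝒵
  bot : ∀ e, ¬ v₀ ≤ e → 𝒵 e = ⊥
  HV : ∀ i e, i + r < totalDegree e → (residueCpx 𝒜).HV 𝒵 i e

theorem bot_of_not_nonneg (hneg : ∀ e : ℤ × ℤ, e.1 < 0 ∨ e.2 < 0 → 𝒜 e = ⊥) {e : ℤ × ℤ}
    (he : ¬ 0 ≤ e) : addFamily 𝒜 e = ⊥ := by
  change (𝒜 e).toAddSubgroup = ⊥
  rw [hneg e ?_]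
  · rfl
  · by_contra! h; exact he ⟨h.1, h.2⟩

theorem residueCpx_resolves (hneg : ∀ e : ℤ × ℤ, e.1 < 0 ∨ e.2 < 0 → 𝒜 e = ⊥) :
    (residueCpx 𝒜).Resolves (residueFamily (positiveIdeal (totalGrading 𝒜)))
      (cyclicAug (addFamily 𝒜) (positiveIdeal (totalGrading 𝒜))) :=
  cyclicCpx_resolves_residue (totalIdeal_isResidueIdeal hneg)

theorem residueCpx_deg (hneg : ∀ e : ℤ × ℤ, e.1 < 0 ∨ e.2 < 0 → 𝒜 e = ⊥)
    (k : (residueCpx 𝒜).κ) : 0 ≤ (residueCpx 𝒜).deg k := by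
  refine cyclicCpx_deg_mem (positiveIdeal (totalGrading 𝒜)) (fun g : ℤ × ℤ => 0 ≤ g)
    (fun _ _ => add_nonneg) (fun g a ha h0 => ?_) le_rfl k
  by_contra h
  rw [bot_of_not_nonneg hneg h] at ha
  exact h0 ha

theorem totalDegree_pos {e : ℤ × ℤ} (he : 0 ≤ e) (h0 : e ≠ 0) : 0 < totalDegree e := by
  rw [totalDegree_apply]
  have h1 : 0 ≤ e.1 := he.1
  have h2 : 0 ≤ e.2 := he.2
  by_contra h3
  exact h0 (Prod.ext (by simp; omega) (by simp; omega))

namespace HasRegularityBound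

variable {Z : Type w} [AddCommGroup Z] [Module R Z] {𝒵 : ℤ × ℤ → AddSubgroup Z}
  {v₀ : ℤ × ℤ} {r : ℤ}

variable (𝒵 r) in
/-- The nonzero homogeneous elements of degree at most `r`. -/
abbrev Gen : Type w := {p : (ℤ × ℤ) × Z // p.2 ∈ 𝒵 p.1 ∧ p.2 ≠ 0 ∧ totalDegree p.1 ≤ r}

variable (R 𝒵 r) in
/-- The free module on the nonzero homogeneous elements of degree at most `r`, mapping to the
module. -/
noncomputable def cover : (Gen 𝒵 r →₀ R) →ₗ[R] Z :=
  Finsupp.linearCombination R (fun p => p.1.2)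

variable (𝒜 𝒵 r) in
/-- The grading of the free module on the nonzero homogeneous elements of degree at most `r`. -/
noncomputable def coverFamily (e : ℤ × ℤ) : AddSubgroup (Gen 𝒵 r →₀ R) :=
  ⨅ b, (addFamily 𝒜 (e - b.1.1)).comap (Finsupp.applyAddHom b)

theorem mem_coverFamily {e : ℤ × ℤ} {f : Gen 𝒵 r →₀ R} :
    f ∈ coverFamily 𝒜 𝒵 r e ↔ ∀ b, f b ∈ 𝒜 (e - b.1.1) := by
  rw [coverFamily, AddSubgroup.mem_iInf]
  rfl

theorem coverFamily_homogeneousSMul :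
    HomogeneousSMul (addFamily 𝒜) (coverFamily 𝒜 𝒵 r) := by
  intro g e a f ha hf
  rw [mem_coverFamily] at hf ⊢
  intro b
  rw [add_sub_assoc]
  exact self_homogeneousSMul (𝒜 := 𝒜) ha (hf b)

theorem cover_mem (h : HasRegularityBound 𝒜 𝒵 v₀ r) (e : ℤ × ℤ) (f : Gen 𝒵 r →₀ R)
    (hf : f ∈ coverFamily 𝒜 𝒵 r e) : cover R 𝒵 r f ∈ 𝒵 e := by
  rw [mem_coverFamily] at hf
  rw [cover, Finsupp.linearCombination_apply]
  refine sum_mem fun b _ => ?_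
  have := h.smul (hf b) b.2.1
  rwa [sub_add_cancel] at this

/-- Graded Nakayama: vanishing of `Tor_0` in degrees above `r` expresses an element of such a degree
through elements of smaller degree. The induction is on the excess of the degree over `r`. -/
theorem cover_surjective (hneg : ∀ e : ℤ × ℤ, e.1 < 0 ∨ e.2 < 0 → 𝒜 e = ⊥)
    (h : HasRegularityBound 𝒜 𝒵 v₀ r) (e : ℤ × ℤ) (z : Z) (hz : z ∈ 𝒵 e) :
    ∃ f ∈ coverFamily 𝒜 𝒵 r e, cover R 𝒵 r f = z := by
  obtain ⟨m, hm⟩ : ∃ m : ℕ, totalDegree e ≤ r + m := ⟨(totalDegree e - r).toNat, by omega⟩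
  induction m generalizing e z with
  | zero =>
    by_cases h0 : z = 0
    · exact ⟨0, zero_mem _, by rw [map_zero, h0]⟩
    refine ⟨Finsupp.single ⟨(e, z), hz, h0, by simpa using hm⟩ 1, ?_, ?_⟩
    · rw [mem_coverFamily]
      intro b
      by_cases hb : (⟨(e, z), hz, h0, by simpa using hm⟩ : Gen 𝒵 r) = b
      · subst hb
        rw [Finsupp.single_eq_same, sub_self]
        exact one_mem_addFamily
      · rw [Finsupp.single_eq_of_ne' hb]; exact zero_mem _
    · rw [cover, Finsupp.linearCombination_single, one_smul]
  | succ m ih =>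
    by_cases hle : totalDegree e ≤ r + m
    · exact ih e z hz hle
    have h𝔪 := totalIdeal_isResidueIdeal hneg
    let g := cyclicGen (addFamily 𝒜) (positiveIdeal (totalGrading 𝒜))
    have hpart : Finsupp.single g z ∈ (residueCpx 𝒜).part 𝒵 0 e := by
      intro k
      by_cases hk : g = k
      · subst hk
        rw [Finsupp.single_eq_same]
        refine ⟨?_, fun h => absurd rfl h⟩
        change z ∈ 𝒵 (e - 0)
        rwa [sub_zero]
      · rw [Finsupp.single_eq_of_ne' hk]; exact ⟨zero_mem _, fun _ => rfl⟩
    -- Placed on the generator of the residue resolution, `z` is a cycle of homological degree 0,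
    -- hence a boundary. Its coordinate there writes `z` as a combination of the `y k` with
    -- coefficients in the maximal ideal.
    obtain ⟨y, hy, hyd⟩ := h.HV 0 e (by omega) _ hpart
      (FreeCpx.eq_zero_of_mem_part (by omega) (FreeCpx.d_mem_part h.smul hpart))
    have h1 := DFunLike.congr_fun hyd g
    rw [Finsupp.single_eq_same, FreeCpx.d_apply] at h1
    rw [← h1]
    change _ ∈ (coverFamily 𝒜 𝒵 r e).map (cover R 𝒵 r).toAddMonoidHom
    refine sum_mem fun k _ => ?_
    have hbd : (residueCpx 𝒜).bd k g ∈ addFamily 𝒜 ((residueCpx 𝒜).deg k) := by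
      have := (residueCpx 𝒜).bd_mem k g
      change _ ∈ addFamily 𝒜 (_ - 0) at this
      rwa [sub_zero] at this
    have hbd' := cyclicCpx_bd_mem (𝒜 := addFamily 𝒜) (positiveIdeal (totalGrading 𝒜)) k
    -- A coefficient of degree 0 in the maximal ideal vanishes, so only elements of strictly smaller
    -- total degree contribute.
    by_cases hk : (residueCpx 𝒜).deg k = 0
    · rw [hk] at hbd
      change (residueCpx 𝒜).bd k g • y k ∈ _
      rw [h𝔪.zero _ hbd hbd', zero_smul]
      exact zero_mem _
    · have hpos := totalDegree_pos (residueCpx_deg hneg k) hk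
      obtain ⟨f, hf, hfy⟩ := ih (e - (residueCpx 𝒜).deg k) (y k) (hy k).1 (by
        rw [map_sub]; push_cast at hm; omega)
      refine ⟨(residueCpx 𝒜).bd k g • f, ?_, ?_⟩
      · have := coverFamily_homogeneousSMul hbd hf
        rwa [add_sub_cancel] at this
      · change cover R 𝒵 r _ = (residueCpx 𝒜).bd k g • y k
        rw [map_smul, hfy]

theorem cover_HV {D : FreeCpx.{u} (addFamily 𝒜)} {n : ℤ} {e : ℤ × ℤ}
    (hD : ∀ b : Gen 𝒵 r, D.HV (addFamily 𝒜) n (e - b.1.1)) :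
    D.HV (coverFamily 𝒜 𝒵 r) n e :=
  FreeCpx.HV.free (fun b : Gen 𝒵 r => b.1.1) hD

/-- `Tor` of the free cover lives in homological degree 0 and total degrees at most `r`. Above these
degrees, vanishing of `Tor_{i+1}` for the module gives vanishing of `Tor_i` for the syzygy module.
The generators lie in `v₀ + ℕ²`, so the syzygies do too. -/
theorem ker_cover (hneg : ∀ e : ℤ × ℤ, e.1 < 0 ∨ e.2 < 0 → 𝒜 e = ⊥)
    (h : HasRegularityBound 𝒜 𝒵 v₀ r) :
    HasRegularityBound 𝒜 (fun e => coverFamily 𝒜 𝒵 r e ⊓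
      (LinearMap.ker (cover R 𝒵 r)).toAddSubgroup) v₀ (r + 1) where
  smul := by
    rintro g e a f ha ⟨hf, hf'⟩
    exact ⟨coverFamily_homogeneousSMul ha hf, Submodule.smul_mem _ _ hf'⟩
  bot e he := by
    rw [eq_bot_iff]
    rintro f ⟨hf, -⟩
    replace hf : ∀ b, f b ∈ 𝒜 (e - b.1.1) := mem_coverFamily.1 hf
    ext b
    have hb : v₀ ≤ b.1.1 := by
      by_contra hb
      have := b.2.1
      rw [h.bot _ hb] at this
      exact b.2.2.1 this
    have h1 : f b ∈ addFamily 𝒜 (e - b.1.1) := hf b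
    rw [bot_of_not_nonneg hneg fun h0 => he (hb.trans (sub_nonneg.1 h0))] at h1
    exact h1
  HV i e hi := by
    rcases lt_or_ge i 0 with hi0 | hi0
    · exact FreeCpx.HV.of_neg hi0
    refine FreeCpx.HV.kernel (cover R 𝒵 r) coverFamily_homogeneousSMul h.cover_mem
      (h.cover_surjective hneg) (cover_HV fun b => ?_) (h.HV _ _ (by omega))
    refine (residueCpx_resolves hneg).HV_self (Or.inr fun h0 => ?_)
    have h1 := congrArg totalDegree h0
    rw [map_sub, map_zero] at h1
    have := b.2.2.2
    omega

theorem HV_step (hneg : ∀ e : ℤ × ℤ, e.1 < 0 ∨ e.2 < 0 → 𝒜 e = ⊥)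
    (h : HasRegularityBound 𝒜 𝒵 v₀ r) {D : FreeCpx.{u} (addFamily 𝒜)} {n : ℤ} {e : ℤ × ℤ}
    (h1 : ∀ u, v₀ ≤ u → totalDegree u ≤ r → D.HV (addFamily 𝒜) n (e - u))
    (h2 : D.HV (fun e => coverFamily 𝒜 𝒵 r e ⊓
      (LinearMap.ker (cover R 𝒵 r)).toAddSubgroup) (n - 1) e) : D.HV 𝒵 n e := by
  refine FreeCpx.HV.quotient coverFamily_homogeneousSMul (cover R 𝒵 r) h.cover_mem
    (h.cover_surjective hneg) (cover_HV fun b => h1 _ ?_ b.2.2.2) h2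
  by_contra hb
  have := b.2.1
  rw [h.bot _ hb] at this
  exact b.2.2.1 this

/-- Here `i` counts the syzygies taken: each lowers the homological degree by one and raises the
bound on generator degrees by one. The universe of `Z` is chosen to be stable under passing to
syzygies. -/
theorem HV_of_self_aux (hneg : ∀ e : ℤ × ℤ, e.1 < 0 ∨ e.2 < 0 → 𝒜 e = ⊥)
    {Z : Type (max v w)} [AddCommGroup Z] [Module R Z] {𝒵 : ℤ × ℤ → AddSubgroup Z} {r : ℤ}
    (h : HasRegularityBound 𝒜 𝒵 v₀ r) {D : FreeCpx.{u} (addFamily 𝒜)} (n : ℕ) {e : ℤ × ℤ}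
    (hD : ∀ i : ℤ, 0 ≤ i → i ≤ n → ∀ u, v₀ ≤ u → totalDegree u ≤ r + i →
      D.HV (addFamily 𝒜) (n - i) (e - u)) : D.HV 𝒵 n e := by
  induction n generalizing Z r with
  | zero =>
    refine h.HV_step hneg (fun u hu hu' => ?_) (FreeCpx.HV.of_neg (by simp))
    have := hD 0 le_rfl (by simp) u hu (by rwa [add_zero])
    rwa [sub_zero] at this
  | succ n ih =>
    refine h.HV_step hneg (fun u hu hu' => ?_) ?_
    · have := hD 0 le_rfl (by positivity) u hu (by rwa [add_zero])
      rwa [sub_zero] at this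
    · rw [Nat.cast_succ, add_sub_cancel_right]
      refine ih (h.ker_cover hneg) fun i hi hi' u hu hu' => ?_
      have := hD (i + 1) (by omega) (by push_cast; omega) u hu (by omega)
      rwa [Nat.cast_succ, add_sub_add_right_eq_sub] at this

/-- If `D ⊗ R` is acyclic in sufficiently many degrees, then so is `D ⊗ Z`. -/
theorem HV_of_self (hneg : ∀ e : ℤ × ℤ, e.1 < 0 ∨ e.2 < 0 → 𝒜 e = ⊥)
    (h : HasRegularityBound 𝒜 𝒵 v₀ r) {D : FreeCpx.{u} (addFamily 𝒜)} (n : ℤ) {e : ℤ × ℤ}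
    (hD : ∀ i : ℤ, 0 ≤ i → i ≤ n → ∀ u, v₀ ≤ u → totalDegree u ≤ r + i →
      D.HV (addFamily 𝒜) (n - i) (e - u)) : D.HV 𝒵 n e := by
  rcases lt_or_ge n 0 with hn | hn
  · exact FreeCpx.HV.of_neg hn
  refine h.HV_step hneg (fun u hu hu' => ?_) ?_
  · have := hD 0 le_rfl hn u hu (by rwa [add_zero])
    rwa [sub_zero] at this
  · rcases lt_or_ge (n - 1) 0 with hn1 | hn1
    · exact FreeCpx.HV.of_neg hn1
    obtain ⟨m, hm⟩ := Int.eq_ofNat_of_zero_le hn1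
    rw [hm]
    -- The first syzygy already lives in the stable universe, so only the first step is made
    -- separately.
    refine HV_of_self_aux.{u, v, w} hneg (h.ker_cover hneg) m fun i hi hi' u hu hu' => ?_
    have := hD (i + 1) (by omega) (by omega) u hu (by omega)
    rwa [show (m : ℤ) - i = n - (i + 1) by omega]

end HasRegularityBound

variable {D : AddSubgroup (ℤ × ℤ)} {G : Type} [AddCommGroup G] {φ : G →+ ℤ × ℤ} {wt : G →+ ℤ}

/-- A function `ℓ` on bidegrees such that `Tor_n(R, K)_e` over `⨁_{e ∈ D} R_e` vanishes for
`ℓ e > n`. -/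
structure IsAcyclicityBound (D : AddSubgroup (ℤ × ℤ)) (ℓ : ℤ × ℤ → ℤ) : Prop where
  zero : ℓ 0 ≤ 0
  fst : ∀ e, ℓ e ≤ ℓ (e - (1, 0)) + 1
  snd : ∀ e, ℓ e ≤ ℓ (e - (0, 1)) + 1
  -- Off the lattice, one direction can be lowered by one at no cost to `ℓ`, and every component met
  -- from `e` along `D` has positive degree in that direction.
  notMem : ∀ e, 0 ≤ e → e ∉ D →
    (ℓ e ≤ ℓ (e - (1, 0)) ∧ ∀ δ ∈ D, 0 ≤ e - δ → 1 ≤ (e - δ).1) ∨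
      (ℓ e ≤ ℓ (e - (0, 1)) ∧ ∀ δ ∈ D, 0 ≤ e - δ → 1 ≤ (e - δ).2)

namespace IsAcyclicityBound

variable {ℓ : ℤ × ℤ → ℤ}

theorem le_sub (h : IsAcyclicityBound D ℓ) (p q : ℕ) (e : ℤ × ℤ) :
    ℓ e ≤ ℓ (e - ((p : ℤ), (q : ℤ))) + (p + q) := by
  induction p with
  | zero =>
    induction q with
    | zero =>
      rw [show (((0 : ℕ) : ℤ), ((0 : ℕ) : ℤ)) = (0 : ℤ × ℤ) from rfl]
      simp
    | succ q ih =>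
      have h1 := h.snd (e - (((0 : ℕ) : ℤ), (q : ℤ)))
      rw [show e - (((0 : ℕ) : ℤ), (q : ℤ)) - (0, 1) = e - (((0 : ℕ) : ℤ), ((q + 1 : ℕ) : ℤ)) by
        ext <;> simp; ring] at h1
      push_cast at *
      omega
  | succ p ih =>
    have h1 := h.fst (e - ((p : ℤ), (q : ℤ)))
    rw [show e - ((p : ℤ), (q : ℤ)) - (1, 0) = e - (((p + 1 : ℕ) : ℤ), (q : ℤ)) by
      ext <;> simp; ring] at h1
    push_cast at *
    omega

theorem le_sub' (h : IsAcyclicityBound D ℓ) {u : ℤ × ℤ} (hu : 0 ≤ u) (e : ℤ × ℤ) :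
    ℓ e ≤ ℓ (e - u) + totalDegree u := by
  obtain ⟨p, q⟩ := u
  obtain ⟨p, rfl⟩ := Int.eq_ofNat_of_zero_le hu.1
  obtain ⟨q, rfl⟩ := Int.eq_ofNat_of_zero_le hu.2
  exact h.le_sub p q e

/-- Induction on the total degree of `e`. On the lattice the complex is exact away from the origin,
which `ℓ 0 ≤ 0` excludes. Off it, `R` may be replaced by the ideal of positive degree in the
direction given by `notMem`, and the linear resolution of that ideal leads to bidegrees `e - u` of
smaller total degree. -/
theorem HV_self (h : IsAcyclicityBound D ℓ)
    (hneg : ∀ e : ℤ × ℤ, e.1 < 0 ∨ e.2 < 0 → 𝒜 e = ⊥)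
    (hK : ∀ (s : ℕ) (j : ℤ),
      TorNonzero (totalGrading 𝒜) (residueGrading (totalGrading 𝒜)) s j → j ≤ s)
    (hwt : ∀ g, g ≠ 0 → 0 ≤ (φ g).1 → 0 ≤ (φ g).2 → 0 < wt g)
    (hφ : Function.Injective φ) (hD : ∀ e, e ∈ D ↔ ∃ g, φ g = e) {n : ℤ} {e : ℤ × ℤ}
    (hn : n < ℓ e) : (subCpxBase 𝒜 D φ wt).HV (addFamily 𝒜) n e := by
  obtain ⟨m, hm⟩ : ∃ m : ℕ, totalDegree e ≤ m := ⟨(totalDegree e).toNat, by omega⟩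
  induction m using Nat.strong_induction_on generalizing n e with
  | _ m ih =>
  rcases lt_or_ge n 0 with hn0 | hn0
  · exact FreeCpx.HV.of_neg hn0
  have hdeg := fun k => subCpxBase_deg (𝒜 := 𝒜) (wt := wt) hneg hD k
  by_cases he : 0 ≤ e
  swap
  · exact FreeCpx.HV.of_bot fun k => bot_of_not_nonneg hneg fun h0 =>
      he ((hdeg k).2.trans (sub_nonneg.1 h0))
  by_cases heD : e ∈ D
  · refine subCpxBase_HV_self hneg hwt hφ hD heD (Or.inr ?_)
    rintro rfl
    have := h.zero
    omega
  have key : ∀ (c : ℤ × ℤ →+ ℤ) (v₀ : ℤ × ℤ), (∀ e : ℤ × ℤ, 0 ≤ e.1 → 0 ≤ e.2 → 0 ≤ c e) →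
      0 ≤ v₀ → totalDegree v₀ = 1 → (∀ e, 0 ≤ e → 0 < c e → v₀ ≤ e) → ℓ e ≤ ℓ (e - v₀) →
      (∀ δ ∈ D, 0 ≤ e - δ → 1 ≤ c (e - δ)) → (subCpxBase 𝒜 D φ wt).HV (addFamily 𝒜) n e := by
    intro c v₀ hc hv hv1 hcv hℓ hδ
    have hbound : HasRegularityBound 𝒜 (coneFamily 𝒜 c) v₀ 1 := by
      refine ⟨?_, ?_, ?_⟩
      · rw [← coneFamily_eq hneg hc]
        rintro g e a f ha ⟨hf, hf'⟩
        exact ⟨self_homogeneousSMul ha hf, Submodule.smul_mem _ _ hf'⟩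
      · intro e he
        rw [coneFamily]
        split_ifs with h1
        · exact bot_of_not_nonneg hneg fun h0 => he (hcv e h0 h1)
        · rfl
      · intro i e hi
        exact HV_coneFamily hneg hK hc (residueCpx_resolves hneg) hi
    -- The complex sees `R` only in degrees `e - δ` with `δ ∈ D`, where the ideal and `R` agree.
    refine FreeCpx.HV.congr (𝒵 := coneFamily 𝒜 c) (fun k => ?_)
      (hbound.HV_of_self hneg n fun i hi hi' u hu hu' => ?_)
    · rw [coneFamily]
      split_ifs with h1
      · rfl
      · rw [bot_of_not_nonneg hneg]
        intro h0
        have := hδ _ (hdeg k).1 h0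
        omega
    -- The step `v₀` is free, and the remaining `u - v₀` costs at most `|u| - 1 ≤ i`, which the drop
    -- from `n` to `n - i` compensates.
    · have hu0 : 0 ≤ u - v₀ := sub_nonneg.2 hu
      have h1 := h.le_sub' hu0 (e - v₀)
      rw [show e - v₀ - (u - v₀) = e - u by abel, map_sub] at h1
      have h2 : 1 ≤ totalDegree u := by
        have h3 : 0 ≤ totalDegree (u - v₀) := add_nonneg hu0.1 hu0.2
        rw [map_sub] at h3
        omega
      have h4 : 0 < totalDegree e := totalDegree_pos he fun h0 => heD (h0 ▸ zero_mem D)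
      refine ih (m - 1) (by omega) (by omega) ?_
      rw [map_sub]
      omega
  rcases h.notMem e he heD with ⟨h1, h2⟩ | ⟨h1, h2⟩
  · exact key (AddMonoidHom.fst ℤ ℤ) (1, 0) (fun e h _ => h) (by decide) rfl
      (fun e he h => ⟨h, he.2⟩) h1 h2
  · exact key (AddMonoidHom.snd ℤ ℤ) (0, 1) (fun e _ h => h) (by decide) rfl
      (fun e he h => ⟨he.1, h⟩) h1 h2

end IsAcyclicityBound

end Estimates

/-! ### Acyclicity bounds for the lattices and floor/ceiling estimates -/

section Numerics

theorem ediv_le_ediv_sub_one_add_one {a : ℤ} (ha : 0 < a) (x : ℤ) : x / a ≤ (x - 1) / a + 1 := by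
  have h1 := Int.ediv_mul_le x ha.ne'
  have h2 : x / a - 1 ≤ (x - 1) / a := by
    rw [Int.le_ediv_iff_mul_le ha]
    linarith [sub_mul (x / a) 1 a]
  omega

theorem le_ediv_sub_one {a : ℤ} (ha : 0 < a) {k x : ℤ} (h : k * a < x) : k ≤ (x - 1) / a := by
  rw [Int.le_ediv_iff_mul_le ha]
  omega

theorem ediv_mul_lt_of_not_dvd {a : ℤ} (ha : 0 < a) {x : ℤ} (h : ¬ a ∣ x) : x / a * a < x :=
  lt_of_le_of_ne (Int.ediv_mul_le x ha.ne') fun h' => h ⟨x / a, by rw [mul_comm]; exact h'.symm⟩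

theorem mem_diagonal {a b : ℕ} {e : ℤ × ℤ} :
    e ∈ diagonal a b ↔ ∃ s : ℤ, (s * a, s * b) = e := by
  rw [diagonal, AddSubgroup.mem_zmultiples_iff]
  refine exists_congr fun s => ?_
  rw [Prod.smul_mk, smul_eq_mul, smul_eq_mul]

theorem mem_veroneseLattice {a b : ℕ} {e : ℤ × ℤ} :
    e ∈ veroneseLattice a b ↔ (a : ℤ) ∣ e.1 ∧ (b : ℤ) ∣ e.2 := by
  rw [veroneseLattice, AddSubgroup.mem_prod, Int.mem_zmultiples_iff, Int.mem_zmultiples_iff]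

/-- A point `(sa, sb) ≤ e` has `s` at most both quotients. If `⌊e₂/b⌋ a < e₁`, lowering `e₁` by one
keeps the minimum, and every difference `e - δ` with `e - δ ≥ 0` has positive first coordinate.
Otherwise the roles are exchanged, since failure in both directions would put `e` on the diagonal.
-/
theorem isAcyclicityBound_diagonal {a b : ℕ} (ha : 0 < a) (hb : 0 < b) :
    IsAcyclicityBound (diagonal a b) (fun e => min (e.1 / a) (e.2 / b)) := by
  have ha' : (0 : ℤ) < a := by exact_mod_cast ha
  have hb' : (0 : ℤ) < b := by exact_mod_cast hb
  refine ⟨by simp, fun e => ?_, fun e => ?_, fun e he heD => ?_⟩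
  · have := ediv_le_ediv_sub_one_add_one ha' e.1
    simp only [Prod.fst_sub, Prod.snd_sub, sub_zero]
    omega
  · have := ediv_le_ediv_sub_one_add_one hb' e.2
    simp only [Prod.fst_sub, Prod.snd_sub, sub_zero]
    omega
  · have h1 := Int.ediv_mul_le e.1 ha'.ne'
    have h2 := Int.ediv_mul_le e.2 hb'.ne'
    have hle : ∀ s : ℤ, 0 ≤ e - (s * a, s * b) → s ≤ e.1 / a ∧ s ≤ e.2 / b := by
      intro s hs
      have h3 : 0 ≤ e.1 - s * a := hs.1
      have h4 : 0 ≤ e.2 - s * b := hs.2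
      exact ⟨(Int.le_ediv_iff_mul_le ha').2 (by omega), (Int.le_ediv_iff_mul_le hb').2 (by omega)⟩
    by_cases h : e.2 / b * a < e.1 ∧ e.2 / b ≤ e.1 / a
    · refine Or.inl ⟨?_, fun δ hδ h0 => ?_⟩
      · have := le_ediv_sub_one ha' h.1
        simp only [Prod.fst_sub, Prod.snd_sub, sub_zero]
        omega
      · obtain ⟨s, rfl⟩ := mem_diagonal.1 hδ
        have h3 := mul_le_mul_of_nonneg_right (hle s h0).2 ha'.le
        change 1 ≤ e.1 - s * a
        omega
    refine Or.inr ?_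
    have h5 : e.1 / a * b < e.2 ∧ e.1 / a ≤ e.2 / b := by
      rcases lt_trichotomy (e.1 / (a : ℤ)) (e.2 / b) with hlt | heq | hgt
      · refine ⟨lt_of_lt_of_le (mul_lt_mul_of_pos_right hlt hb') h2, hlt.le⟩
      · refine ⟨?_, heq.le⟩
        by_contra h6
        rw [← heq] at h h2
        refine heD (mem_diagonal.2 ⟨e.1 / a, Prod.ext ?_ ?_⟩)
        · by_contra h7
          exact h ⟨lt_of_le_of_ne h1 h7, le_rfl⟩
        · exact le_antisymm h2 (not_lt.1 h6)
      · exact absurd ⟨lt_of_lt_of_le (mul_lt_mul_of_pos_right hgt ha') h1, hgt.le⟩ h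
    refine ⟨?_, ?_⟩
    · have := le_ediv_sub_one hb' h5.1
      simp only [Prod.fst_sub, Prod.snd_sub, sub_zero]
      omega
    · intro δ hδ h0
      obtain ⟨s, rfl⟩ := mem_diagonal.1 hδ
      have h3 := mul_le_mul_of_nonneg_right (hle s h0).1 hb'.le
      change 1 ≤ e.2 - s * b
      omega

/-- Off the first axis the second coordinate can be lowered freely. On the axis the first coordinate
is not divisible by `a`, so lowering it keeps its floor quotient. -/
theorem isAcyclicityBound_fst {D : AddSubgroup (ℤ × ℤ)} {a : ℕ} (ha : 0 < a)
    (hD : ∀ e : ℤ × ℤ, e ∈ D ↔ (a : ℤ) ∣ e.1 ∧ e.2 = 0) :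
    IsAcyclicityBound D (fun e => e.1 / a) := by
  have ha' : (0 : ℤ) < a := by exact_mod_cast ha
  refine ⟨by simp, fun e => ediv_le_ediv_sub_one_add_one ha' e.1, fun e => ?_,
    fun e he heD => ?_⟩
  · simp
  · by_cases h : e.2 = 0
    · have h1 : ¬ (a : ℤ) ∣ e.1 := fun h1 => heD ((hD e).2 ⟨h1, h⟩)
      refine Or.inl ⟨le_ediv_sub_one ha' (ediv_mul_lt_of_not_dvd ha' h1), fun δ hδ h0 => ?_⟩
      have h2 : 0 ≤ e.1 - δ.1 := h0.1
      have h3 : e.1 - δ.1 ≠ 0 := fun h3 => h1 (by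
        rw [sub_eq_zero.1 h3]; exact ((hD δ).1 hδ).1)
      change 1 ≤ e.1 - δ.1
      omega
    · refine Or.inr ⟨by simp, fun δ hδ _ => ?_⟩
      have h1 : 0 ≤ e.2 := he.2
      have h2 := ((hD δ).1 hδ).2
      change 1 ≤ e.2 - δ.2
      omega

theorem isAcyclicityBound_snd {D : AddSubgroup (ℤ × ℤ)} {b : ℕ} (hb : 0 < b)
    (hD : ∀ e : ℤ × ℤ, e ∈ D ↔ e.1 = 0 ∧ (b : ℤ) ∣ e.2) :
    IsAcyclicityBound D (fun e => e.2 / b) := by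
  have hb' : (0 : ℤ) < b := by exact_mod_cast hb
  refine ⟨by simp, fun e => ?_, fun e => ediv_le_ediv_sub_one_add_one hb' e.2,
    fun e he heD => ?_⟩
  · simp
  · by_cases h : e.1 = 0
    · have h1 : ¬ (b : ℤ) ∣ e.2 := fun h1 => heD ((hD e).2 ⟨h, h1⟩)
      refine Or.inr ⟨le_ediv_sub_one hb' (ediv_mul_lt_of_not_dvd hb' h1), fun δ hδ h0 => ?_⟩
      have h2 : 0 ≤ e.2 - δ.2 := h0.2
      have h3 : e.2 - δ.2 ≠ 0 := fun h3 => h1 (by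
        rw [sub_eq_zero.1 h3]; exact ((hD δ).1 hδ).2)
      change 1 ≤ e.2 - δ.2
      omega
    · refine Or.inl ⟨by simp, fun δ hδ _ => ?_⟩
      have h1 : 0 ≤ e.1 := he.1
      have h2 := ((hD δ).1 hδ).1
      change 1 ≤ e.1 - δ.1
      omega

/-- A coordinate not divisible by its period can be lowered by one without changing its floor
quotient, and it never agrees with that of a lattice point. -/
theorem isAcyclicityBound_veronese {a b : ℕ} (ha : 0 < a) (hb : 0 < b) :
    IsAcyclicityBound (veroneseLattice a b) (fun e => e.1 / a + e.2 / b) := by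
  have ha' : (0 : ℤ) < a := by exact_mod_cast ha
  have hb' : (0 : ℤ) < b := by exact_mod_cast hb
  refine ⟨by simp, fun e => ?_, fun e => ?_, fun e he heD => ?_⟩
  · have := ediv_le_ediv_sub_one_add_one ha' e.1
    simp only [Prod.fst_sub, Prod.snd_sub, sub_zero]
    omega
  · have := ediv_le_ediv_sub_one_add_one hb' e.2
    simp only [Prod.fst_sub, Prod.snd_sub, sub_zero]
    omega
  · by_cases h : (a : ℤ) ∣ e.1
    · have h1 : ¬ (b : ℤ) ∣ e.2 := fun h1 => heD (mem_veroneseLattice.2 ⟨h, h1⟩)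
      refine Or.inr ⟨?_, fun δ hδ h0 => ?_⟩
      · have := le_ediv_sub_one hb' (ediv_mul_lt_of_not_dvd hb' h1)
        simp only [Prod.fst_sub, Prod.snd_sub, sub_zero]
        omega
      · have h2 : 0 ≤ e.2 - δ.2 := h0.2
        have h3 : e.2 - δ.2 ≠ 0 := fun h3 => h1 (by
          rw [sub_eq_zero.1 h3]; exact (mem_veroneseLattice.1 hδ).2)
        change 1 ≤ e.2 - δ.2
        omega
    · refine Or.inl ⟨?_, fun δ hδ h0 => ?_⟩
      · have := le_ediv_sub_one ha' (ediv_mul_lt_of_not_dvd ha' h)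
        simp only [Prod.fst_sub, Prod.snd_sub, sub_zero]
        omega
      · have h2 : 0 ≤ e.1 - δ.1 := h0.1
        have h3 : e.1 - δ.1 ≠ 0 := fun h3 => h (by
          rw [sub_eq_zero.1 h3]; exact (mem_veroneseLattice.1 hδ).1)
        change 1 ≤ e.1 - δ.1
        omega

theorem le_mul_of_ceil_le {r c a B : ℤ} (ha : 0 < a) (h : ⌈((r : ℚ) - c) / a⌉ ≤ B) :
    r - c ≤ B * a := by
  have ha' : (0 : ℚ) < a := by exact_mod_cast ha
  rw [Int.ceil_le, div_le_iff₀ ha'] at h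
  exact_mod_cast h

/-- From `r - c ≤ B a`, `s + B + 1 ≤ j` and `p ≤ r + i` one gets `j a + c - p ≥ (s + 1) a - i`, and
`i ≤ i a` makes this at least `(s - i + 1) a`. -/
theorem lt_ediv_of_ceil_le {r c a B s i j p : ℤ} (ha : 0 < a) (h : ⌈((r : ℚ) - c) / a⌉ ≤ B)
    (hj : s + B < j) (hi : 0 ≤ i) (hp : p ≤ r + i) : s - i < (j * a + c - p) / a := by
  have h1 := le_mul_of_ceil_le ha h
  have h2 : s - i + 1 ≤ (j * a + c - p) / a := by
    rw [Int.le_ediv_iff_mul_le ha]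
    nlinarith [mul_nonneg hi (by omega : 0 ≤ a - 1),
      mul_nonneg (by omega : 0 ≤ j - s - B - 1) ha.le]
  omega

/-- After `x` and `y` are pulled out, the task is to bound `-⌊(c-p)/a⌋ - ⌊(d-q)/b⌋` by `B + i`. It
is at most `p + q ≤ r + i` because `a, b ≥ 1`, which gives the bound `r`. The other bound uses `q/b
≤ q/a`, where `a ≤ b` enters, and `i/a ≤ i`. -/
theorem lt_ediv_add_ediv {r c d a b B s i x y p q : ℤ} (ha : 0 < a) (hab : a ≤ b)
    (hc : 0 ≤ c) (hd : 0 ≤ d)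
    (hB : r ≤ B ∨ ⌈((r : ℚ) - c) / a - (d : ℚ) / b + 1⌉ ≤ B)
    (hj : s + B < x + y) (hi : 0 ≤ i) (hp : 0 ≤ p) (hq : 0 ≤ q) (hpq : p + q ≤ r + i) :
    s - i < (x * a + c - p) / a + (y * b + d - q) / b := by
  have hb : 0 < b := ha.trans_le hab
  rw [show x * a + c - p = (c - p) + x * a by ring, show y * b + d - q = (d - q) + y * b by ring,
    Int.add_mul_ediv_right _ _ ha.ne', Int.add_mul_ediv_right _ _ hb.ne']
  set α := (c - p) / a with hα
  set β := (d - q) / b with hβ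
  suffices h : -(α + β) ≤ B + i by omega
  rcases hB with hB | hB
  · have h1 : -p ≤ α := by
      rw [hα, Int.le_ediv_iff_mul_le ha]
      nlinarith [mul_nonneg hp (by omega : 0 ≤ a - 1)]
    have h2 : -q ≤ β := by
      rw [hβ, Int.le_ediv_iff_mul_le hb]
      nlinarith [mul_nonneg hq (by omega : 0 ≤ b - 1)]
    omega
  · suffices h : -(α + β) - i - 1 < ⌈((r : ℚ) - c) / a - (d : ℚ) / b + 1⌉ by omega
    rw [Int.lt_ceil]
    -- For integers the strict floor estimate gains one unit; the resulting `1/a + 1/b` makes the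
    -- final inequality strict.
    have h1 : c - p + 1 ≤ (α + 1) * a := Int.lt_ediv_add_one_mul_self (c - p) ha
    have h2 : d - q + 1 ≤ (β + 1) * b := Int.lt_ediv_add_one_mul_self (d - q) hb
    have ha' : (0 : ℚ) < a := by exact_mod_cast ha
    have hb' : (0 : ℚ) < b := by exact_mod_cast hb
    have h1' : ((c : ℚ) - p + 1) / a ≤ α + 1 := by
      rw [div_le_iff₀ ha']; exact_mod_cast h1
    have h2' : ((d : ℚ) - q + 1) / b ≤ β + 1 := by
      rw [div_le_iff₀ hb']; exact_mod_cast h2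
    have hu0 : (0 : ℚ) < (a : ℚ)⁻¹ := inv_pos.2 ha'
    have hv0 : (0 : ℚ) < (b : ℚ)⁻¹ := inv_pos.2 hb'
    have hu1 : (a : ℚ)⁻¹ ≤ 1 := inv_le_one_of_one_le₀ (by exact_mod_cast ha)
    have huv : (b : ℚ)⁻¹ ≤ (a : ℚ)⁻¹ := inv_anti₀ ha' (by exact_mod_cast hab)
    rw [div_eq_mul_inv] at h1' h2' ⊢
    rw [div_eq_mul_inv]
    push_cast
    have hi' : (0 : ℚ) ≤ i := by exact_mod_cast hi
    have hq' : (0 : ℚ) ≤ q := by exact_mod_cast hq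
    have hpq' : (0 : ℚ) ≤ r + i - p - q := by
      have : ((p + q : ℤ) : ℚ) ≤ ((r + i : ℤ) : ℚ) := by exact_mod_cast hpq
      push_cast at this
      linarith
    have e1 := mul_nonneg hq' (sub_nonneg.2 huv)
    have e2 := mul_nonneg hpq' hu0.le
    have e3 := mul_nonneg hi' (sub_nonneg.2 hu1)
    nlinarith [e1, e2, e3]

end Numerics

/-! ### Regularity of the modules cut out along a coset of the lattice -/

section Regularity

set_option linter.unusedSectionVars false

universe u v w

theorem regularity_le {K : Type u} [Field K] {A : Type v} [CommRing A] [Algebra K A]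
    {N : Type w} [AddCommGroup N] [Module K N] [Module A N] {𝒜 : ℤ → Submodule K A}
    {𝒩 : ℤ → Submodule K N} {B : ℤ} (h : ∀ (s : ℕ) (j : ℤ), TorNonzero 𝒜 𝒩 s j → j ≤ s + B) :
    regularity 𝒜 𝒩 ≤ ((B : ℝ) : EReal) := by
  refine iSup_le fun s => EReal.sub_le_of_le_add (sSup_le ?_)
  rintro _ ⟨j, hj, rfl⟩
  have h1 : (j : ℝ) ≤ B + s := by
    have := h s j hj
    rw [add_comm] at this
    exact_mod_cast this
  have h2 : ((j : ℝ) : EReal) ≤ ((B + s : ℝ) : EReal) := EReal.coe_le_coe_iff.2 h1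
  rw [EReal.coe_add] at h2
  exact h2

theorem le_of_torNonzero {K : Type u} [Field K] {A : Type v} [CommRing A] [Algebra K A]
    {N : Type w} [AddCommGroup N] [Module K N] [Module A N] {𝒜 : ℤ → Submodule K A}
    {𝒩 : ℤ → Submodule K N} {r : ℤ} (h : regularity 𝒜 𝒩 = ((r : ℝ) : EReal)) (s : ℕ) (j : ℤ)
    (hj : TorNonzero 𝒜 𝒩 s j) : j ≤ s + r := by
  have h1 : ((j : ℝ) : EReal) ≤ torTop 𝒜 𝒩 s := le_sSup ⟨j, hj, rfl⟩
  have h2 : torTop 𝒜 𝒩 s - (s : EReal) ≤ ((r : ℝ) : EReal) :=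
    h ▸ le_iSup (fun s : ℕ => torTop 𝒜 𝒩 s - (s : EReal)) s
  have h3 := (EReal.sub_le_sub h1 (le_refl (s : EReal))).trans h2
  have h4 : (((j : ℝ) - (s : ℝ) : ℝ) : EReal) ≤ ((r : ℝ) : EReal) := by
    rw [EReal.coe_sub]
    exact h3
  have h5 : (j : ℝ) - s ≤ r := EReal.coe_le_coe_iff.1 h4
  have h6 : (j : ℝ) ≤ s + r := by linarith
  exact_mod_cast h6

theorem IsStandardBigraded.eq_bot {K R : Type*} [Field K] [CommRing R] [Algebra K R]
    {𝒜 : ℤ × ℤ → Submodule K R} (h : IsStandardBigraded 𝒜) (e : ℤ × ℤ)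
    (he : e.1 < 0 ∨ e.2 < 0) : 𝒜 e = ⊥ := by
  obtain ⟨n, m, π, -, hπ⟩ := h
  rw [hπ, eq_bot_iff]
  rintro _ ⟨f, hf, rfl⟩
  have hf0 : f = 0 := by
    by_contra h0
    obtain ⟨d, hd⟩ := MvPolynomial.ne_zero_iff.1 h0
    have h1 := ((MvPolynomial.mem_weightedHomogeneousSubmodule _ _ _ _).1 hf) hd
    have h2 : 0 ≤ e := by
      rw [← h1, Finsupp.weight_apply]
      refine Finset.sum_nonneg fun i _ => nsmul_nonneg ?_ _
      rcases i with i | i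
      · exact ⟨zero_le_one, le_rfl⟩
      · exact ⟨le_rfl, zero_le_one⟩
    rcases he with he | he
    · exact absurd h2.1 (not_le.2 he)
    · exact absurd h2.2 (not_le.2 he)
  rw [hf0, map_zero]
  exact zero_mem _

variable {K : Type*} [Field K] {R : Type v} [CommRing R] [Algebra K R]
  {𝒜 : ℤ × ℤ → Submodule K R} [GradedAlgebra 𝒜]
  {M : Type w} [AddCommGroup M] [Module K M] [Module R M]
  {ℳ : ℤ × ℤ → Submodule K M} [DirectSum.Decomposition ℳ] [SetLike.GradedSMul 𝒜 ℳ]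

variable (R ℳ) in
/-- The first step of the canonical resolution of a bigraded module. -/
@[reducible] noncomputable def moduleStage : ResolutionStage.{w} R (ℤ × ℤ) where
  C := ULift.{v} {p : (ℤ × ℤ) × M // p.2 ∈ ℳ p.1}
  deg c := c.down.1.1
  Ker := LinearMap.ker (Finsupp.linearCombination R
    (fun c : ULift.{v} {p : (ℤ × ℤ) × M // p.2 ∈ ℳ p.1} => c.down.1.2))

variable (𝒜 ℳ) in
theorem moduleStage_resolves :
    ((moduleStage R ℳ).cpx (addFamily 𝒜)).Resolves (addFamily ℳ)
      (Finsupp.linearCombination R ((moduleStage R ℳ).augBasis (addFamily 𝒜)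
        (fun c : ULift.{v} {p : (ℤ × ℤ) × M // p.2 ∈ ℳ p.1} => c.down.1.2))) := by
  refine (moduleStage R ℳ).resolves (addFamily 𝒜) _ rfl one_mem_addFamily self_homogeneousSMul
    (addFamily_homogeneousSMul ℳ) (fun c => c.down.2) fun e y hy => ?_
  have h : ∀ c : ULift.{v} {p : (ℤ × ℤ) × M // p.2 ∈ ℳ p.1},
      Finsupp.single (ULift.up ⟨(e, y), hy⟩) (1 : R) c ∈ addFamily 𝒜 (e - c.down.1.1) := by
    intro c
    by_cases hc : (ULift.up ⟨(e, y), hy⟩ : ULift.{v} {p : (ℤ × ℤ) × M // p.2 ∈ ℳ p.1}) = c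
    · subst hc
      rw [Finsupp.single_eq_same, sub_self]
      exact one_mem_addFamily
    · rw [Finsupp.single_eq_of_ne' hc]; exact zero_mem _
  refine ⟨Finsupp.single (ULift.up ⟨(e, y), hy⟩) 1, h, ?_⟩
  · refine (Finsupp.linearCombination_single R _ _).trans ?_
    exact one_smul R y

/-- The regularity of `M` is read off a bigraded resolution of `M`. Balancing turns it into
vanishing for the residue resolution tensored with `M`, the form on which dimension shifting works.
-/
theorem hasRegularityBound_of_torNonzero
    (hneg : ∀ e : ℤ × ℤ, e.1 < 0 ∨ e.2 < 0 → 𝒜 e = ⊥)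
    (hM : ∀ i j : ℤ, (i < 0 ∨ j < 0) → ℳ (i, j) = ⊥) {r : ℤ}
    (hr : ∀ (s : ℕ) (j : ℤ), TorNonzero (totalGrading 𝒜) (totalGrading ℳ) s j → j ≤ s + r) :
    HasRegularityBound 𝒜 (addFamily ℳ) 0 r where
  smul := addFamily_homogeneousSMul ℳ
  bot e he := by
    change (ℳ (e.1, e.2)).toAddSubgroup = ⊥
    rw [hM e.1 e.2 ?_]
    · rfl
    · by_contra! h; exact he ⟨h.1, h.2⟩
  HV i e hi := by
    rcases lt_or_ge i 0 with hi0 | hi0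
    · exact FreeCpx.HV.of_neg hi0
    obtain ⟨s, rfl⟩ := Int.eq_ofNat_of_zero_le hi0
    obtain ⟨π, hπ⟩ := self_exists_equivariantProj (𝒜 := 𝒜)
    obtain ⟨πM, hπM⟩ := (isBlockModule_self (𝒜 := 𝒜) (ℳ := ℳ)).exists_equivariantProj
      (addFamily_homogeneousSMul ℳ)
    refine (residueCpx_resolves hneg).balance (moduleStage_resolves 𝒜 ℳ) ?_
    refine FreeCpx.HV.of_not_torNonzero (moduleStage_resolves 𝒜 ℳ) hπ hπM (mem_iSup_addFamily 𝒜)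
      (mem_iSup_addFamily ℳ) (totalIdeal_isResidueIdeal hneg) fun h => ?_
    have := hr _ _ h
    omega

variable {D : AddSubgroup (ℤ × ℤ)} {G : Type} [AddCommGroup G] {φ : G →+ ℤ × ℤ} {wt : G →+ ℤ}
  {𝒱 : ℤ → Submodule K (gradedSubalgebra 𝒜 D)}

/-- The two reductions combined: from `M` to `R` by dimension shifting, and for `R` by the
acyclicity bound. Only the arithmetic condition `hB` remains. -/
theorem IsWeightGrading.regularity_le (h : IsWeightGrading φ wt 𝒱) {ℓ : ℤ × ℤ → ℤ}
    (hℓ : IsAcyclicityBound D ℓ)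
    (hK : ∀ (s : ℕ) (j : ℤ),
      TorNonzero (totalGrading 𝒜) (residueGrading (totalGrading 𝒜)) s j → j ≤ s)
    {r : ℤ} (hM : HasRegularityBound 𝒜 (addFamily ℳ) 0 r)
    {N : Type*} [AddCommGroup N] [Module K N] [Module (gradedSubalgebra 𝒜 D) N]
    {i : N →+ M} {W : ℤ → Set (ℤ × ℤ)} {𝒩 : ℤ → Submodule K N}
    (hN : IsBlockModule (addFamily 𝒜) ℳ (fun x : gradedSubalgebra 𝒜 D => (x : R)) i
      (wtSet φ wt) W (addFamily 𝒱) (addFamily 𝒩))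
    (hW : ∀ j g w, w ∈ W j ↔ w + φ g ∈ W (j + wt g)) {B : ℤ}
    (hB : ∀ s j : ℤ, s + B < j → ∀ w ∈ W j, ∀ i p q : ℤ, 0 ≤ i → 0 ≤ p → 0 ≤ q → p + q ≤ r + i →
      s - i < ℓ (w - (p, q))) : regularity 𝒱 𝒩 ≤ ((B : ℝ) : EReal) := by
  refine _root_.regularity_le fun s j hsj => ?_
  by_contra hlt
  refine h.not_torNonzero hN hW (fun w hw => hM.HV_of_self h.neg s fun i hi _ u hu hu' => ?_) hsj
  refine hℓ.HV_self h.neg hK h.wt_pos h.inj h.mem_D ?_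
  exact hB s j (not_le.1 hlt) w hw i u.1 u.2 hi hu.1 hu.2 hu'

variable (φ wt) in
/-- The bidegrees of weight `j`, shifted by `v`. -/
def shiftedWtSet (v : ℤ × ℤ) (j : ℤ) : Set (ℤ × ℤ) := {e | ∃ g, wt g = j ∧ φ g + v = e}

theorem mem_shiftedWtSet_iff (v : ℤ × ℤ) (j : ℤ) (g : G) (w : ℤ × ℤ) :
    w ∈ shiftedWtSet φ wt v j ↔ w + φ g ∈ shiftedWtSet φ wt v (j + wt g) := by
  constructor
  · rintro ⟨g', rfl, rfl⟩
    exact ⟨g' + g, map_add _ _ _, by rw [map_add, add_right_comm]⟩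
  · rintro ⟨g', hg', hw⟩
    refine ⟨g' - g, by rw [map_sub, hg', add_sub_cancel_right], ?_⟩
    rw [map_sub, sub_add_eq_add_sub, hw, add_sub_cancel_right]

theorem IsWeightGrading.gradedSubmodule_isBlockModule (h : IsWeightGrading φ wt 𝒱) {v : ℤ × ℤ}
    {𝒩 : ℤ → AddSubgroup (gradedSubmodule 𝒜 ℳ D v)}
    (h𝒩 : ∀ j z, z ∈ 𝒩 j ↔ (z : M) ∈ ⨆ w : shiftedWtSet φ wt v j, addFamily ℳ w) :
    IsBlockModule (addFamily 𝒜) ℳ (fun x : gradedSubalgebra 𝒜 D => (x : R))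
      (gradedSubmodule 𝒜 ℳ D v).subtype.toAddMonoidHom
      (wtSet φ wt) (shiftedWtSet φ wt v) (addFamily 𝒱) 𝒩 where
  inj := Subtype.val_injective
  map_smul _ _ := rfl
  disjoint j j' hj := by
    rw [Set.disjoint_left]
    rintro _ ⟨g, rfl, rfl⟩ ⟨g', rfl, hg⟩
    exact hj (by rw [h.inj (add_right_cancel hg)])
  add_mem := by
    rintro _ _ _ ⟨g, rfl, rfl⟩ _ ⟨g', rfl, rfl⟩
    exact ⟨g + g', map_add _ _ _, by rw [map_add, add_assoc]⟩
  mem_ring j a ha := (h.mem_iff j a).1 ha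
  mem_iff := h𝒩
  lift j m hm := by
    refine ⟨⟨m, ?_⟩, rfl⟩
    refine (iSup_le ?_ : (⨆ w : shiftedWtSet φ wt v j, addFamily ℳ w) ≤
      (gradedSubmodule 𝒜 ℳ D v).toAddSubgroup) hm
    rintro ⟨_, g, hg, rfl⟩ x hx
    exact (Submodule.mem_iSup_of_mem (p := fun e : D => ℳ (e + v))
      ⟨φ g, (h.mem_D _).2 ⟨g, rfl⟩⟩ hx : x ∈ ⨆ e : D, ℳ (e + v))
  mem_span z := by
    have h1 : (z : M) ∈ (⨆ e : D, ℳ (e + v)).toAddSubgroup := z.2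
    rw [Submodule.toAddSubgroup_iSup_eq] at h1
    refine (iSup_le fun e => ?_ : (⨆ e : D, (ℳ (e + v)).toAddSubgroup) ≤ _) h1
    obtain ⟨g, hg⟩ := (h.mem_D e).1 e.2
    exact le_iSup (fun w : {w // ∃ j, w ∈ shiftedWtSet φ wt v j} => addFamily ℳ w)
      ⟨e + v, wt g, g, rfl, by rw [hg]⟩

end Regularity

/-! ### Diagonal and Veronese subrings with their modules -/

section Diagonals

set_option linter.unusedSectionVars false

universe u v w

theorem iSup_eq_of_mem_iff {ι Z : Type*} [AddCommGroup Z] (S : ι → AddSubgroup Z) {W : Set ι}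
    {e : ι} (hW : ∀ w, w ∈ W ↔ w = e) : (⨆ w : W, S w) = S e := by
  refine le_antisymm (iSup_le fun w => ?_) (le_iSup (fun w : W => S w) ⟨e, (hW e).2 rfl⟩)
  rw [(hW w).1 w.2]

theorem mem_iSup_iff_apply_mem_iSup {ι κ N M : Type*} [AddCommGroup N] [AddCommGroup M]
    {i : N →+ M} (hi : Function.Injective i) {S : ι → AddSubgroup N} {T : κ → AddSubgroup M}
    (h1 : ∀ k, ∀ z ∈ S k, i z ∈ ⨆ l, T l) (h2 : ∀ l, ∀ m ∈ T l, ∃ n ∈ ⨆ k, S k, i n = m) (z : N) :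
    z ∈ ⨆ k, S k ↔ i z ∈ ⨆ l, T l := by
  constructor
  · exact fun hz => (iSup_le h1 : (⨆ k, S k) ≤ (⨆ l, T l).comap i) hz
  · intro hz
    obtain ⟨n, hn, hnz⟩ := (iSup_le h2 : (⨆ l, T l) ≤ (⨆ k, S k).map i) hz
    rwa [← hi hnz]

/-- The parametrization of the diagonal. -/
def diagonalHom (a b : ℕ) : ℤ →+ ℤ × ℤ :=
  AddMonoidHom.mk' (fun j => (j * a, j * b)) fun i j => by
    simp only [add_mul, Prod.mk_add_mk]

@[simp] theorem diagonalHom_apply (a b : ℕ) (j : ℤ) : diagonalHom a b j = (j * a, j * b) := rfl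

/-- The bidegrees which occur in a generalized Veronese subring. -/
def veroneseIndexGroup (a b : ℕ) : AddSubgroup (ℤ × ℤ) where
  carrier := {e | IsVeroneseIndex a b e}
  add_mem' h h' := ⟨fun ha => by simp [h.1 ha, h'.1 ha], fun hb => by simp [h.2 hb, h'.2 hb]⟩
  zero_mem' := ⟨fun _ => rfl, fun _ => rfl⟩
  neg_mem' h := ⟨fun ha => by simp [h.1 ha], fun hb => by simp [h.2 hb]⟩

/-- The parametrization of the lattice `aℤ × bℤ`. -/
def veroneseHom (a b : ℕ) : veroneseIndexGroup a b →+ ℤ × ℤ :=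
  AddMonoidHom.mk' (fun g => (g.1.1 * a, g.1.2 * b)) fun g g' => by
    simp only [AddSubgroup.coe_add, Prod.fst_add, Prod.snd_add, add_mul, Prod.mk_add_mk]

theorem veroneseHom_apply (a b : ℕ) (g : veroneseIndexGroup a b) :
    veroneseHom a b g = (g.1.1 * a, g.1.2 * b) := rfl

/-- The total degree on the bidegrees which occur in a generalized Veronese subring. -/
def veroneseWt (a b : ℕ) : veroneseIndexGroup a b →+ ℤ :=
  totalDegree.comp (veroneseIndexGroup a b).subtype

theorem shiftedWtSet_zero {G : Type} [AddCommGroup G] (φ : G →+ ℤ × ℤ) (wt : G →+ ℤ) :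
    shiftedWtSet φ wt 0 = wtSet φ wt := by
  funext j
  ext e
  simp [shiftedWtSet, wtSet]

variable {K : Type*} [Field K] {R : Type v} [CommRing R] [Algebra K R]
  {𝒜 : ℤ × ℤ → Submodule K R} [GradedAlgebra 𝒜]
  {M : Type w} [AddCommGroup M] [Module K M] [Module R M] [IsScalarTower K R M]
  {ℳ : ℤ × ℤ → Submodule K M} [DirectSum.Decomposition ℳ] [SetLike.GradedSMul 𝒜 ℳ]

theorem mem_shiftedWtSet_diagonal {a b : ℕ} {v e : ℤ × ℤ} {j : ℤ} :
    e ∈ shiftedWtSet (diagonalHom a b) (AddMonoidHom.id ℤ) v j ↔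
      e = (j * a + v.1, j * b + v.2) := by
  constructor
  · rintro ⟨g, rfl, rfl⟩; rfl
  · rintro rfl; exact ⟨j, rfl, rfl⟩

theorem diagonal_isWeightGrading (hneg : ∀ e : ℤ × ℤ, e.1 < 0 ∨ e.2 < 0 → 𝒜 e = ⊥) {a b : ℕ}
    (hab : 0 < a ∨ 0 < b) :
    IsWeightGrading (diagonalHom a b) (AddMonoidHom.id ℤ) (diagonalGrading 𝒜 a b) where
  neg := hneg
  wt_pos j hj h1 h2 := by
    refine lt_of_le_of_ne ?_ hj.symm
    change 0 ≤ j * (a : ℤ) at h1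
    change 0 ≤ j * (b : ℤ) at h2
    rcases hab with h | h
    · exact nonneg_of_mul_nonneg_left h1 (by exact_mod_cast h)
    · exact nonneg_of_mul_nonneg_left h2 (by exact_mod_cast h)
  inj := by
    intro i j hij
    rw [diagonalHom_apply, diagonalHom_apply, Prod.mk.injEq] at hij
    rcases hab with h | h
    · exact mul_right_cancel₀ (by exact_mod_cast h.ne') hij.1
    · exact mul_right_cancel₀ (by exact_mod_cast h.ne') hij.2
  mem_D _ := mem_diagonal
  mem_iff j x := by
    rw [← shiftedWtSet_zero, iSup_eq_of_mem_iff _ fun _ => mem_shiftedWtSet_diagonal]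
    simp only [Prod.fst_zero, Prod.snd_zero, add_zero]
    rfl

theorem sidediagonal_regularity_le (hneg : ∀ e : ℤ × ℤ, e.1 < 0 ∨ e.2 < 0 → 𝒜 e = ⊥) {a b : ℕ}
    (hab : 0 < a ∨ 0 < b)
    (hK : ∀ (s : ℕ) (j : ℤ),
      TorNonzero (totalGrading 𝒜) (residueGrading (totalGrading 𝒜)) s j → j ≤ s)
    {r : ℤ} (hM : HasRegularityBound 𝒜 (addFamily ℳ) 0 r) {ℓ : ℤ × ℤ → ℤ}
    (hℓ : IsAcyclicityBound (diagonal a b) ℓ) (c d : ℕ) {B : ℤ}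
    (hB : ∀ s j : ℤ, s + B < j → ∀ i p q : ℤ, 0 ≤ i → 0 ≤ p → 0 ≤ q → p + q ≤ r + i →
      s - i < ℓ (j * a + c - p, j * b + d - q)) :
    regularity (diagonalGrading 𝒜 a b) (sidediagonalGrading 𝒜 ℳ a b c d) ≤
      ((B : ℝ) : EReal) := by
  have h := diagonal_isWeightGrading (𝒜 := 𝒜) hneg hab
  refine h.regularity_le hℓ hK hM (h.gradedSubmodule_isBlockModule (v := (c, d)) fun j z => ?_)
    (mem_shiftedWtSet_iff _) fun s j hsj w hw i p q => ?_
  · rw [iSup_eq_of_mem_iff _ fun _ => mem_shiftedWtSet_diagonal]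
    rfl
  · rw [mem_shiftedWtSet_diagonal] at hw
    subst hw
    exact hB s j hsj i p q

section Veronese

variable {a b : ℕ}

/-- Used with `v = 0` for the ring and with `v = (c, d)` for the relative Veronese modules. Indices
excluded by `IsVeroneseIndex` contribute zero, so no component is counted twice. -/
theorem mem_totalGrading_veronese {N : Type*} [AddCommGroup N] [Module K N]
    {𝒩 : ℤ × ℤ → Submodule K N} {i : N →+ M} (hi : Function.Injective i) {v : ℤ × ℤ}
    (h1 : ∀ (e : ℤ × ℤ) z, IsVeroneseIndex a b e → (z ∈ 𝒩 e ↔ i z ∈ ℳ (e.1 * a + v.1, e.2 * b + v.2)))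
    (h2 : ∀ e : ℤ × ℤ, ¬ IsVeroneseIndex a b e → 𝒩 e = ⊥)
    (h3 : ∀ e : ℤ × ℤ, ∀ m ∈ ℳ (e.1 * a + v.1, e.2 * b + v.2), ∃ n, i n = m) (j : ℤ) (z : N) :
    z ∈ totalGrading 𝒩 j ↔
      i z ∈ ⨆ w : shiftedWtSet (veroneseHom a b) (veroneseWt a b) v j, addFamily ℳ w := by
  change z ∈ addFamily (totalGrading 𝒩) j ↔ _
  rw [totalGrading_eq]
  refine mem_iSup_iff_apply_mem_iSup hi ?_ ?_ z
  · rintro ⟨e, he⟩ z hz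
    by_cases hidx : IsVeroneseIndex a b e
    · exact AddSubgroup.mem_iSup_of_mem
        (⟨_, ⟨e, hidx⟩, he, rfl⟩ : shiftedWtSet (veroneseHom a b) (veroneseWt a b) v j)
        ((h1 e z hidx).1 hz)
    · have hz' : z ∈ 𝒩 e := hz
      rw [h2 e hidx, Submodule.mem_bot] at hz'
      rw [hz', map_zero]; exact zero_mem _
  · rintro ⟨_, g, hg, rfl⟩ m hm
    obtain ⟨n, rfl⟩ := h3 g.1 m hm
    exact ⟨n, AddSubgroup.mem_iSup_of_mem (⟨g.1, hg⟩ : {e // totalDegree e = j})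
      ((h1 g.1 n g.2).2 hm), rfl⟩

theorem veronese_mem_D (e : ℤ × ℤ) :
    e ∈ veroneseLattice a b ↔ ∃ g, veroneseHom a b g = e := by
  rw [mem_veroneseLattice]
  constructor
  · rintro ⟨h1, h2⟩
    refine ⟨⟨(e.1 / a, e.2 / b), fun h => by simp [h], fun h => by simp [h]⟩, ?_⟩
    rw [veroneseHom_apply]
    exact Prod.ext (Int.ediv_mul_cancel h1) (Int.ediv_mul_cancel h2)
  · rintro ⟨g, rfl⟩
    exact ⟨dvd_mul_left _ _, dvd_mul_left _ _⟩

theorem veronese_isWeightGrading (hneg : ∀ e : ℤ × ℤ, e.1 < 0 ∨ e.2 < 0 → 𝒜 e = ⊥) :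
    IsWeightGrading (veroneseHom a b) (veroneseWt a b)
      (totalGrading (veroneseBigrading 𝒜 a b)) where
  neg := hneg
  wt_pos g hg h1 h2 := by
    rw [veroneseHom_apply] at h1 h2
    refine totalDegree_pos (e := g.1) ⟨?_, ?_⟩ fun h => hg (Subtype.ext h)
    · rcases Nat.eq_zero_or_pos a with h | h
      · exact (g.2.1 h).ge
      · exact nonneg_of_mul_nonneg_left h1 (by exact_mod_cast h)
    · rcases Nat.eq_zero_or_pos b with h | h
      · exact (g.2.2 h).ge
      · exact nonneg_of_mul_nonneg_left h2 (by exact_mod_cast h)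
  inj := by
    intro g g' h
    rw [veroneseHom_apply, veroneseHom_apply, Prod.mk.injEq] at h
    refine Subtype.ext (Prod.ext ?_ ?_)
    · rcases Nat.eq_zero_or_pos a with h0 | h0
      · rw [g.2.1 h0, g'.2.1 h0]
      · exact mul_right_cancel₀ (by exact_mod_cast h0.ne') h.1
    · rcases Nat.eq_zero_or_pos b with h0 | h0
      · rw [g.2.2 h0, g'.2.2 h0]
      · exact mul_right_cancel₀ (by exact_mod_cast h0.ne') h.2
  mem_D := veronese_mem_D
  mem_iff j x := by
    rw [← shiftedWtSet_zero]
    refine mem_totalGrading_veronese (ℳ := 𝒜) (v := 0)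
      (i := (gradedSubalgebra 𝒜 (veroneseLattice a b)).val.toLinearMap.toAddMonoidHom)
      Subtype.val_injective (fun e z he => ?_) (fun e he => ?_) (fun e m hm => ?_) j x
    · rw [veroneseBigrading, if_pos he, Prod.fst_zero, Prod.snd_zero, add_zero, add_zero]
      rfl
    · rw [veroneseBigrading, if_neg he]
    · rw [Prod.fst_zero, Prod.snd_zero, add_zero, add_zero] at hm
      exact ⟨⟨m, mem_gradedSubalgebra
        (mem_veroneseLattice.2 ⟨dvd_mul_left _ _, dvd_mul_left _ _⟩) hm⟩, rfl⟩

theorem relativeVeronese_regularity_le (hneg : ∀ e : ℤ × ℤ, e.1 < 0 ∨ e.2 < 0 → 𝒜 e = ⊥)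
    (hK : ∀ (s : ℕ) (j : ℤ),
      TorNonzero (totalGrading 𝒜) (residueGrading (totalGrading 𝒜)) s j → j ≤ s)
    {r : ℤ} (hM : HasRegularityBound 𝒜 (addFamily ℳ) 0 r) {ℓ : ℤ × ℤ → ℤ}
    (hℓ : IsAcyclicityBound (veroneseLattice a b) ℓ) (c d : ℕ) {B : ℤ}
    (hB : ∀ (s : ℤ) (e : ℤ × ℤ), IsVeroneseIndex a b e → s + B < e.1 + e.2 → ∀ i p q : ℤ, 0 ≤ i →
      0 ≤ p → 0 ≤ q → p + q ≤ r + i → s - i < ℓ (e.1 * a + c - p, e.2 * b + d - q)) :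
    regularity (totalGrading (veroneseBigrading 𝒜 a b))
        (totalGrading (relativeVeroneseBigrading 𝒜 ℳ a b c d)) ≤ ((B : ℝ) : EReal) := by
  have h := veronese_isWeightGrading (𝒜 := 𝒜) (a := a) (b := b) hneg
  refine h.regularity_le hℓ hK hM (h.gradedSubmodule_isBlockModule (v := (c, d)) fun j z => ?_)
    (mem_shiftedWtSet_iff _) fun s j hsj w hw i p q => ?_
  · refine mem_totalGrading_veronese (ℳ := ℳ) (v := (c, d))
      (i := (gradedSubmodule 𝒜 ℳ (veroneseLattice a b) (c, d)).subtype.toAddMonoidHom)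
      Subtype.val_injective (fun e z he => ?_) (fun e he => ?_) (fun e m hm => ?_) j z
    · rw [relativeVeroneseBigrading, if_pos he]
      rfl
    · rw [relativeVeroneseBigrading, if_neg he]
    · exact ⟨⟨m, (Submodule.mem_iSup_of_mem (p := fun e : veroneseLattice a b =>
        ℳ (e + ((c : ℤ), (d : ℤ)))) ⟨(e.1 * a, e.2 * b), mem_veroneseLattice.2
          ⟨dvd_mul_left _ _, dvd_mul_left _ _⟩⟩ hm :
            m ∈ ⨆ e : veroneseLattice a b, ℳ (e + ((c : ℤ), (d : ℤ))))⟩, rfl⟩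
  · obtain ⟨g, rfl, rfl⟩ := hw
    exact hB s g.1 g.2 hsj i p q

/-- By division with remainder, every bidegree belongs to exactly one pair `(c, d)` and one index
`(i, j)`. The blocks are therefore the level sets of the sum of the two quotients, and `M` is
handled at once without splitting `Tor` along the direct sum. -/
theorem veroneseRegrading_isBlockModule (ha : 0 < a) (hb : 0 < b)
    (h : IsWeightGrading (veroneseHom a b) (veroneseWt a b)
      (totalGrading (veroneseBigrading 𝒜 a b))) :
    IsBlockModule (addFamily 𝒜) ℳ (fun x : VeroneseSubalgebra 𝒜 a b => (x : R))
      (AddMonoidHom.id M) (wtSet (veroneseHom a b) (veroneseWt a b))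
      (fun j => {w : ℤ × ℤ | w.1 / a + w.2 / b = j})
      (addFamily (totalGrading (veroneseBigrading 𝒜 a b)))
      (addFamily (totalGrading (veroneseRegrading ℳ a b))) where
  inj := Function.injective_id
  map_smul _ _ := rfl
  disjoint j j' hj := by
    rw [Set.disjoint_left]
    rintro w rfl h
    exact hj h
  add_mem := by
    rintro _ _ _ ⟨g, rfl, rfl⟩ w rfl
    have ha' : (a : ℤ) ≠ 0 := by exact_mod_cast ha.ne'
    have hb' : (b : ℤ) ≠ 0 := by exact_mod_cast hb.ne'
    change (g.1.1 * a + w.1) / a + (g.1.2 * b + w.2) / b = g.1.1 + g.1.2 + (w.1 / a + w.2 / b)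
    rw [add_comm (g.1.1 * (a : ℤ)), add_comm (g.1.2 * (b : ℤ)), Int.add_mul_ediv_right _ _ ha',
      Int.add_mul_ediv_right _ _ hb']
    ring
  mem_ring j x hx := (h.mem_iff j x).1 hx
  mem_iff j z := by
    have ha' : (0 : ℤ) < a := by exact_mod_cast ha
    have hb' : (0 : ℤ) < b := by exact_mod_cast hb
    rw [totalGrading_eq]
    refine mem_iSup_iff_apply_mem_iSup Function.injective_id ?_ ?_ z
    · rintro ⟨e, rfl⟩ z hz
      have hz' : z ∈ (⨆ (c : Fin a) (d : Fin b),
        ℳ (e.1 * a + (c : ℕ), e.2 * b + (d : ℕ))).toAddSubgroup := hz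
      simp only [Submodule.toAddSubgroup_iSup_eq] at hz'
      refine (iSup_le fun c => iSup_le fun d => ?_ : (⨆ (c : Fin a) (d : Fin b),
        (ℳ (e.1 * a + (c : ℕ), e.2 * b + (d : ℕ))).toAddSubgroup) ≤ _) hz'
      refine le_iSup (fun w : {w : ℤ × ℤ | w.1 / (a : ℤ) + w.2 / b = totalDegree e} =>
        addFamily ℳ w) ⟨(e.1 * a + (c : ℕ), e.2 * b + (d : ℕ)), ?_⟩
      change (e.1 * a + ((c : ℕ) : ℤ)) / a + (e.2 * b + ((d : ℕ) : ℤ)) / b = e.1 + e.2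
      rw [add_comm (e.1 * (a : ℤ)), add_comm (e.2 * (b : ℤ)), Int.add_mul_ediv_right _ _ ha'.ne',
        Int.add_mul_ediv_right _ _ hb'.ne', Int.ediv_eq_zero_of_lt (by positivity)
          (by exact_mod_cast c.2), Int.ediv_eq_zero_of_lt (by positivity) (by exact_mod_cast d.2)]
      ring
    · rintro ⟨w, rfl⟩ m hm
      refine ⟨m, AddSubgroup.mem_iSup_of_mem (⟨(w.1 / a, w.2 / b), rfl⟩ :
        {e // totalDegree e = w.1 / (a : ℤ) + w.2 / b}) ?_, rfl⟩
      have h1 := Int.emod_nonneg w.1 ha'.ne'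
      have h2 := Int.emod_nonneg w.2 hb'.ne'
      have h3 := Int.emod_lt_of_pos w.1 ha'
      have h4 := Int.emod_lt_of_pos w.2 hb'
      change m ∈ veroneseRegrading ℳ a b (w.1 / a, w.2 / b)
      refine Submodule.mem_iSup_of_mem (⟨(w.1 % a).toNat, by omega⟩ : Fin a)
        (Submodule.mem_iSup_of_mem (⟨(w.2 % b).toNat, by omega⟩ : Fin b) ?_)
      change m ∈ ℳ (w.1 / a * a + ((w.1 % a).toNat : ℤ), w.2 / b * b + ((w.2 % b).toNat : ℤ))
      rw [Int.toNat_of_nonneg h1, Int.toNat_of_nonneg h2, mul_comm (w.1 / (a : ℤ)),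
        mul_comm (w.2 / (b : ℤ)), Int.mul_ediv_add_emod, Int.mul_ediv_add_emod]
      exact hm
  lift _ m _ := ⟨m, rfl⟩
  mem_span z := (iSup_le fun e => le_iSup (fun w : {w : ℤ × ℤ // ∃ j : ℤ,
    w ∈ {w : ℤ × ℤ | w.1 / (a : ℤ) + w.2 / b = j}} => addFamily ℳ w) ⟨e, _, rfl⟩ :
      (⨆ e, addFamily ℳ e) ≤ _) (mem_iSup_addFamily ℳ z)

theorem veroneseRegrading_regularity_le (hneg : ∀ e : ℤ × ℤ, e.1 < 0 ∨ e.2 < 0 → 𝒜 e = ⊥)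
    (ha : 0 < a) (hb : 0 < b)
    (hK : ∀ (s : ℕ) (j : ℤ),
      TorNonzero (totalGrading 𝒜) (residueGrading (totalGrading 𝒜)) s j → j ≤ s)
    {r : ℤ} (hM : HasRegularityBound 𝒜 (addFamily ℳ) 0 r) {ℓ : ℤ × ℤ → ℤ}
    (hℓ : IsAcyclicityBound (veroneseLattice a b) ℓ) {B : ℤ}
    (hB : ∀ (s : ℤ) (w : ℤ × ℤ), s + B < w.1 / a + w.2 / b → ∀ i p q : ℤ, 0 ≤ i →
      0 ≤ p → 0 ≤ q → p + q ≤ r + i → s - i < ℓ (w.1 - p, w.2 - q)) :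
    regularity (totalGrading (veroneseBigrading 𝒜 a b))
        (totalGrading (veroneseRegrading ℳ a b)) ≤ ((B : ℝ) : EReal) := by
  have h := veronese_isWeightGrading (𝒜 := 𝒜) (a := a) (b := b) hneg
  have ha' : (a : ℤ) ≠ 0 := by exact_mod_cast ha.ne'
  have hb' : (b : ℤ) ≠ 0 := by exact_mod_cast hb.ne'
  refine h.regularity_le hℓ hK hM (veroneseRegrading_isBlockModule ha hb h) (fun j g w => ?_)
    fun s j hsj w hw i p q => ?_
  · change w.1 / a + w.2 / b = j ↔
      (w.1 + g.1.1 * a) / a + (w.2 + g.1.2 * b) / b = j + (g.1.1 + g.1.2)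
    rw [Int.add_mul_ediv_right _ _ ha', Int.add_mul_ediv_right _ _ hb']
    omega
  · subst hw
    exact hB s w hsj i p q

end Veronese

end Diagonals

/-! ### The main theorem -/

theorem theorem2p6 {K : Type*} [Field K] {R : Type*} [CommRing R] [Algebra K R]
    (𝒜 : ℤ × ℤ → Submodule K R) [GradedAlgebra 𝒜] (hR : IsStandardBigraded 𝒜)
    (hKoszul : IsKoszul (totalGrading 𝒜))
    {M : Type*} [AddCommGroup M] [Module K M] [Module R M] [IsScalarTower K R M]
    [Module.Finite R M]
    (ℳ : ℤ × ℤ → Submodule K M) [DirectSum.Decomposition ℳ] [SetLike.GradedSMul 𝒜 ℳ]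
    (hnonneg : ∀ i j : ℤ, (i < 0 ∨ j < 0) → ℳ (i, j) = ⊥)
    (hindeg : HasInitialDegree (totalGrading ℳ) 0)
    (r : ℤ) (hr : regularity (totalGrading 𝒜) (totalGrading ℳ) = ((r : ℝ) : EReal))
    (a b : ℕ) :
    -- sidediagonal modules over the diagonal subalgebra
    (∀ c d : ℕ, (c, d) ∈ sidediagonalIndices a b →
      (b = 0 → 0 < a →
        regularity (diagonalGrading 𝒜 a b) (sidediagonalGrading 𝒜 ℳ a b c d) ≤
          (((max 0 ⌈((r : ℚ) - c) / a⌉ : ℤ) : ℝ) : EReal)) ∧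
      (a = 0 → 0 < b →
        regularity (diagonalGrading 𝒜 a b) (sidediagonalGrading 𝒜 ℳ a b c d) ≤
          (((max 0 ⌈((r : ℚ) - d) / b⌉ : ℤ) : ℝ) : EReal)) ∧
      (1 ≤ a → 1 ≤ b →
        regularity (diagonalGrading 𝒜 a b) (sidediagonalGrading 𝒜 ℳ a b c d) ≤
          (((max 0 (max ⌈((r : ℚ) - c) / a⌉ ⌈((r : ℚ) - d) / b⌉) : ℤ) : ℝ) : EReal))) ∧
    -- relative Veronese modules over the generalized Veronese subring
    (∀ c d : ℕ, (c, d) ∈ veroneseIndices a b →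
      (b = 0 → 0 < a →
        regularity (totalGrading (veroneseBigrading 𝒜 a b))
            (totalGrading (relativeVeroneseBigrading 𝒜 ℳ a b c d)) ≤
          (((max 0 ⌈(r : ℚ) / a⌉ : ℤ) : ℝ) : EReal)) ∧
      (a = 0 → 0 < b →
        regularity (totalGrading (veroneseBigrading 𝒜 a b))
            (totalGrading (relativeVeroneseBigrading 𝒜 ℳ a b c d)) ≤
          (((max 0 ⌈(r : ℚ) / b⌉ : ℤ) : ℝ) : EReal)) ∧
      (1 ≤ a → a ≤ b →
        regularity (totalGrading (veroneseBigrading 𝒜 a b))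
            (totalGrading (relativeVeroneseBigrading 𝒜 ℳ a b c d)) ≤
          (((min r ⌈((r : ℚ) - c) / a - (d : ℚ) / b + 1⌉ : ℤ) : ℝ) : EReal))) ∧
    -- the module itself over the generalized Veronese subring
    (1 ≤ a → a ≤ b →
      regularity (totalGrading (veroneseBigrading 𝒜 a b))
          (totalGrading (veroneseRegrading ℳ a b)) ≤
        (((min r ⌈(r : ℚ) / a + 1⌉ : ℤ) : ℝ) : EReal)) := by
  have hneg := hR.eq_bot
  have hK : ∀ (s : ℕ) (j : ℤ),
      TorNonzero (totalGrading 𝒜) (residueGrading (totalGrading 𝒜)) s j → j ≤ s := by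
    intro s j hj
    have := le_of_torNonzero (r := 0) (by rw [Int.cast_zero, EReal.coe_zero]; exact hKoszul) s j hj
    rwa [add_zero] at this
  have hM : HasRegularityBound 𝒜 (addFamily ℳ) 0 r :=
    hasRegularityBound_of_torNonzero hneg hnonneg (le_of_torNonzero hr)
  have hceil : ∀ (c m : ℕ) (B : ℤ), ⌈((r : ℚ) - c) / m⌉ ≤ B →
      ⌈((r : ℚ) - (c : ℤ)) / (m : ℤ)⌉ ≤ B := fun c m B h => by
    rwa [Int.cast_natCast, Int.cast_natCast]
  -- For one-sided lattices the argument yields the bound with `r - c` or `r - d`, which is at least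
  -- as sharp as the one stated for the Veronese modules.
  have hceil' : ∀ c m : ℕ, ⌈((r : ℚ) - c) / m⌉ ≤ ⌈(r : ℚ) / m⌉ := fun c m => by
    gcongr
    exact sub_le_self _ (Nat.cast_nonneg c)
  refine ⟨fun c d _ => ⟨?_, ?_, ?_⟩, fun c d _ => ⟨?_, ?_, ?_⟩, ?_⟩
  · rintro rfl ha
    refine sidediagonal_regularity_le hneg (Or.inl ha) hK hM (isAcyclicityBound_fst ha fun e => ?_)
      c d fun s j hsj i p q hi hp hq hpq => lt_ediv_of_ceil_le (by exact_mod_cast ha)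
        (hceil c a _ (le_max_right _ _)) hsj hi (by omega)
    rw [mem_diagonal]
    constructor
    · rintro ⟨s, rfl⟩; exact ⟨dvd_mul_left _ _, by simp⟩
    · rintro ⟨⟨s, hs⟩, h⟩
      exact ⟨s, Prod.ext (by rw [hs, mul_comm]) (by simp [h])⟩
  · rintro rfl hb
    refine sidediagonal_regularity_le hneg (Or.inr hb) hK hM (isAcyclicityBound_snd hb fun e => ?_)
      c d fun s j hsj i p q hi hp hq hpq => lt_ediv_of_ceil_le (by exact_mod_cast hb)
        (hceil d b _ (le_max_right _ _)) hsj hi (by omega)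
    rw [mem_diagonal]
    constructor
    · rintro ⟨s, rfl⟩; exact ⟨by simp, dvd_mul_left _ _⟩
    · rintro ⟨h, s, hs⟩
      exact ⟨s, Prod.ext (by rw [h, Nat.cast_zero, mul_zero])
        (by rw [hs]; exact mul_comm _ _)⟩
  · intro ha hb
    -- Since `ℓ` is a minimum, both quotients have to be controlled; this produces the maximum of
    -- the two ceilings.
    exact sidediagonal_regularity_le hneg (Or.inl ha) hK hM (isAcyclicityBound_diagonal ha hb)
      c d fun s j hsj i p q hi hp hq hpq => lt_min
        (lt_ediv_of_ceil_le (by exact_mod_cast ha)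
          (hceil c a _ ((le_max_left _ _).trans (le_max_right _ _))) hsj hi (by omega))
        (lt_ediv_of_ceil_le (by exact_mod_cast hb)
          (hceil d b _ ((le_max_right _ _).trans (le_max_right _ _))) hsj hi (by omega))
  · rintro rfl ha
    refine relativeVeronese_regularity_le hneg hK hM (isAcyclicityBound_fst ha fun e => ?_)
      c d fun s e he hsj i p q hi hp hq hpq => lt_ediv_of_ceil_le (by exact_mod_cast ha)
        (hceil c a _ ((hceil' c a).trans (le_max_right _ _)))
        (by rwa [he.2 rfl, add_zero] at hsj) hi (by omega)
    rw [mem_veroneseLattice, Nat.cast_zero, zero_dvd_iff]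
  · rintro rfl hb
    refine relativeVeronese_regularity_le hneg hK hM (isAcyclicityBound_snd hb fun e => ?_)
      c d fun s e he hsj i p q hi hp hq hpq => lt_ediv_of_ceil_le (by exact_mod_cast hb)
        (hceil d b _ ((hceil' d b).trans (le_max_right _ _)))
        (by rwa [he.1 rfl, zero_add] at hsj) hi (by omega)
    rw [mem_veroneseLattice, Nat.cast_zero, zero_dvd_iff]
  · intro ha hab
    refine relativeVeronese_regularity_le hneg hK hM
      (isAcyclicityBound_veronese ha (lt_of_lt_of_le ha hab))
      c d fun s e he hsj i p q hi hp hq hpq => ?_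
    refine lt_ediv_add_ediv (r := r) (a := (a : ℤ)) (b := (b : ℤ)) (c := (c : ℤ)) (d := (d : ℤ))
      (s := s) (i := i)
      (x := e.1) (y := e.2) (p := p) (q := q) (by exact_mod_cast ha)
      (by exact_mod_cast hab) (Int.natCast_nonneg c) (Int.natCast_nonneg d)
      (B := min r ⌈((r : ℚ) - c) / a - (d : ℚ) / b + 1⌉) ?_ hsj hi hp hq hpq
    simp only [Int.cast_natCast]
    exact min_le_iff.1 le_rfl
  · intro ha hab
    have hb : 0 < b := lt_of_lt_of_le ha hab
    refine veroneseRegrading_regularity_le hneg ha hb hK hM (isAcyclicityBound_veronese ha hb)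
      fun s w hsj i p q hi hp hq hpq => ?_
    have ha' : (0 : ℤ) < a := by exact_mod_cast ha
    have hb' : (0 : ℤ) < b := by exact_mod_cast hb
    have hc := Int.emod_nonneg w.1 ha'.ne'
    have hd := Int.emod_nonneg w.2 hb'.ne'
    -- The remainders of `w` modulo `a` and `b` play the roles of `c` and `d`. They are nonnegative,
    -- so dropping them gives a bound valid for all bidegrees.
    have hB : r ≤ min r ⌈(r : ℚ) / a + 1⌉ ∨
        ⌈((r : ℚ) - ((w.1 % a : ℤ) : ℚ)) / ((a : ℤ) : ℚ) -
          ((w.2 % b : ℤ) : ℚ) / ((b : ℤ) : ℚ) + 1⌉ ≤ min r ⌈(r : ℚ) / a + 1⌉ := by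
      refine (min_le_iff.1 (le_refl (min r ⌈(r : ℚ) / a + 1⌉))).imp_right fun h => le_trans ?_ h
      have h1 : (0 : ℚ) ≤ ((w.1 % a : ℤ) : ℚ) := by exact_mod_cast hc
      have h2 : (0 : ℚ) ≤ ((w.2 % b : ℤ) : ℚ) / ((b : ℤ) : ℚ) :=
        div_nonneg (by exact_mod_cast hd) (by exact_mod_cast hb'.le)
      have h3 : ((r : ℚ) - ((w.1 % a : ℤ) : ℚ)) / ((a : ℤ) : ℚ) ≤ (r : ℚ) / a := by
        rw [Int.cast_natCast]
        gcongr
        exact sub_le_self _ h1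
      exact Int.ceil_mono (by linarith)
    have key := lt_ediv_add_ediv ha' (show (a : ℤ) ≤ b by exact_mod_cast hab) hc hd hB hsj hi hp hq
      hpq
    rwa [Int.ediv_mul_add_emod, Int.ediv_mul_add_emod] at key
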